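/- Notation. For $a\in\mathbb Z^3$ and $r>0$ let $Q_r(a)=a+([-r,r]\cap\mathbb Z)^3\subset\mathbb Z^3\subset\mathbb R^3$ and $Q_r=Q_r(\mathbf 0)$. For $u:\mathbb Z^3\to\mathbb R$ let $\Delta u(a)=-6u(a)+\sum_{b\in\mathbb Z^3,\,|a-b|=1}u(b)$. Here $|\cdot|$ is the Euclidean norm on $\mathbb R^3$, $\operatorname{dist}(A,B)=\inf_{a\in A,b\in B}|a-b|$ and $\operatorname{diam}(A)=\sup_{a,b\in A}|a-b|$. Let $N\in\mathbb Z_+$ and $C,\varepsilon>0$. - For $l\ge 1$, a set $Z\subset\mathbb R^3$ is *$(N,l,\varepsilon)$-scattered* if $Z=\bigcup_{j\in\mathbb Z_+,\,1\le t\le N}Z^{(j,t)}$, where each $Z^{(j,t)}$ is an open ball of radius $l$ and $\operatorname{dist}(Z^{(j,t)},Z^{(j',t)})\ge l^{1+\varepsilon}$ for all $t$ and all $j\ne j'$. - A set $Z\subset\mathbb R^3$ is *$C$-unitscattered* if $Z=\bigcup_{j\in\mathbb Z_+}Z^{(j)}$, where each $Z^{(j)}$ is an open unit ball with centre in $\mathbb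 Z^3$ and $\operatorname{dist}(Z^{(j)},Z^{(j')})\ge C$ for all $j\ne j'$. - Let $d\in\mathbb Z_{\ge0}$ and $\vec l=(l_1,\dots,l_d)$. A set $E\subset\mathbb R^3$ is *$(N,\vec l,C,\varepsilon)$-graded* if $l_i>1$ for $1\le i\le d$, $l_{i-1}^{1+2\varepsilon}\le l_i$ for $2\le i\le d$, and $E=\bigcup_{i=0}^dE_i$, where $E_0$ is $C$-unitscattered and $E_i$ is $(N,l_i,\varepsilon)$-scattered for $1\le i\le d$. The number $l_1$ is its *first scale length*. - Such an $E$, with the pieces $E_0,\dots,E_d$, is *$(\overline C,\overline\varepsilon)$-normal* in a bounded set $A\subset\mathbb R^3$ if $E_0\cap A\ne\emptyset$ implies $\overline C\le\operatorname{diam}(A)$, and, for each $1\le i\le d$, $E_i\cap A\neq\emptyset$ implies $l_i\le\operatorname{diam}(A)^{1-\overline\varepsilon/2}$. **Theorem.** There exist constants $p>\frac32$ and $\varepsilon_0>0$ such that for every $\varepsilon\in(0,\varepsilon_0)$, every $N\in\mathbb Z_+$ and every real $K>0$ there are constants $C_{\varepsilon,K}>0$, depending only on $\varepsilon$ and $K$,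 and $C_{\varepsilon,N}>0$, depending only on $\varepsilon$ and $N$, for which the following holds. Let $n\in\mathbb Z_+$ with $n>C_{\varepsilon,N}^4$, and let $u,V:\mathbb Z^3\to\mathbb R$ satisfy $\Delta u=Vu$ and $|V|\le K$ on $Q_n$. Let $E\subset\mathbb R^3$ be an $(N,\vec l,\varepsilon^{-1},\varepsilon)$-graded set whose first scale length satisfies $l_1>C_{\varepsilon,N}$ (no condition if $d=0$) and which is $(1,\varepsilon)$-normal in $Q_n$. Then $$\bigl|\{a\in Q_n\setminus E:\ |u(a)|\ge\exp(-C_{\varepsilon,K}\,n)\,|u(\mathbf 0)|\}\bigr|\ \ge\ n^{p}.$$ -/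

import Mathlib

/-- Euclidean space `ℝ³`, with the Euclidean distance. -/
abbrev Space3 : Type := EuclideanSpace ℝ (Fin 3)

/-- The lattice `ℤ³`. -/
abbrev Lattice3 : Type := Fin 3 → ℤ

/-- The inclusion `ℤ³ ⊂ ℝ³`. -/
noncomputable def latticePoint (a : Lattice3) : Space3 :=
  WithLp.toLp 2 (fun i => (a i : ℝ))

/-- The discrete Laplacian on `ℤ³`: `Δu(a) = -6 u(a) + ∑_{|b - a| = 1} u(b)`,
the six neighbours of `a` being the points `a ± e_i`. -/
def latticeLaplacian (u : Lattice3 → ℝ) (a : Lattice3) : ℝ :=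
  -6 * u a + ∑ i : Fin 3, (u (a + Pi.single i 1) + u (a - Pi.single i 1))

/-- The cube `Q_r(a) = a + ([-r, r] ∩ ℤ)³`. -/
def latticeCube (a : Lattice3) (r : ℝ) : Set Lattice3 :=
  {b | ∀ i, |((b i - a i : ℤ) : ℝ)| ≤ r}

/-- `dist(A, B) = inf_{a ∈ A, b ∈ B} |a - b| ≥ s`. -/
def DistAtLeast (A B : Set Space3) (s : ℝ) : Prop :=
  ∀ a ∈ A, ∀ b ∈ B, s ≤ dist a b

/-- `Z` is `(N, l, ε)`-scattered: it is the union of open balls `Z^{(j,t)}` of radius `l`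
(`j` in a countably infinite index set, `t` in an index set with `N` elements), and balls with
the same `t` and different `j` are at distance at least `l^{1+ε}`. -/
def IsScattered (N : ℕ) (l ε : ℝ) (Z : Set Space3) : Prop :=
  1 ≤ l ∧ ∃ c : ℕ → Fin N → Space3,
    Z = ⋃ j, ⋃ t, Metric.ball (c j t) l ∧
    ∀ t j j', j ≠ j' →
      DistAtLeast (Metric.ball (c j t) l) (Metric.ball (c j' t) l) (l ^ (1 + ε))

/-- `Z` is `C`-unitscattered: it is the union of a sequence of open unit balls centred at lattice
points, with pairwise distances at least `C`. -/
def IsUnitscattered (C : ℝ) (Z : Set Space3) : Prop :=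
  ∃ z : ℕ → Lattice3,
    Z = ⋃ j, Metric.ball (latticePoint (z j)) 1 ∧
    ∀ j j', j ≠ j' →
      DistAtLeast (Metric.ball (latticePoint (z j)) 1) (Metric.ball (latticePoint (z j')) 1) C

/-- The vector `(l_1, …, l_d)` is `ε`-geometric: all `l_i > 1` and `l_{i-1}^{1+2ε} ≤ l_i` for
`2 ≤ i ≤ d`. The entries are indexed from `0` here. -/
def IsGeometricVector {d : ℕ} (ε : ℝ) (l : Fin d → ℝ) : Prop :=
  (∀ i, 1 < l i) ∧ ∀ i j : Fin d, (i : ℕ) + 1 = (j : ℕ) → l i ^ (1 + 2 * ε) ≤ l j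

/-- `E` is an `(N, l, C, ε)`-graded set, witnessed by the pieces `E₀` and `Es = (E_1, …, E_d)`. -/
structure IsGradedSet (N : ℕ) {d : ℕ} (l : Fin d → ℝ) (C ε : ℝ) (E E₀ : Set Space3)
    (Es : Fin d → Set Space3) : Prop where
  eq_union : E = E₀ ∪ ⋃ i, Es i
  geometric : IsGeometricVector ε l
  unitscattered : IsUnitscattered C E₀
  scattered : ∀ i, IsScattered N (l i) ε (Es i)

/-- The graded set with scale lengths `l` and pieces `E₀`, `Es` is `(C', ε')`-normal in the
bounded set `A`. -/
def IsNormalIn {d : ℕ} (l : Fin d → ℝ) (E₀ : Set Space3) (Es : Fin d → Set Space3)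
    (C' ε' : ℝ) (A : Set Space3) : Prop :=
  ((E₀ ∩ A).Nonempty → C' ≤ Metric.diam A) ∧
    ∀ i, (Es i ∩ A).Nonempty → l i ≤ Metric.diam A ^ (1 - ε' / 2)

open Finset Filter

/-! The proof joins a local estimate on cubes of size `m ≈ n ^ 0.499` with a tree that produces many
disjoint such cubes on whose centres `u` is not too small.

Local estimate (`card_large_ge`): if `|u|` exceeds `W ^ (100 m²) θ` at the centre of a cube, then
about `m² / log m` points of the cube outside `E` have `|u| > θ`. In a plane `x + y + z = s` the
equation says that the sums of `u` over unit triangles are controlled by `u` on the two planes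
below. With bounded triangle sums, a bound on a triangle passes to a row at distance `d` from one of
its sides. Up to alternating signs, the `d`-th differences of that row are the side itself plus an
error, so the row is nearly a polynomial of degree less than `d`, and `d` small values bound all of
it (`abs_le_of_fwdDiff_small`). If a row resists, most of its points are large or lie in `E`, and
`E` is sparse on segments. Triangles therefore grow from a single point to almost the whole section
(`TriRel.fill`). Climbing plane by plane fills a tetrahedron (`tetrahedron_fill`), and tetrahedra
standing on a cube enlarge it (`CubeBound.enlarge`). Each large point can stop only a limited number
of seeds, so with few large points some small seed cube grows until it contains the centre.

Tree: the equation lets one walk from any point inside a cone of directions, losing only a factor `κ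
+ 5` per step. Such walks meet the balls of a graded set rarely, so they pass through good points at
prescribed heights. Within radius `42 R` this gives `44` good points whose cubes of radius `R` are
disjoint (`exists_forty_four_children`): forty on two opposite walks, three at the end of a sideways
walk, and the start. Only boundedly many scales are spoiled by balls of comparable size.

Exponents: the loss `m² log m` must stay below `n`, so `m` is just under `n ^ (1/2)`. A single
straight walk would give about `n / m` cubes and at best `m² · n / m ≈ n ^ (3/2)`. Since `44 > 42 ^
1.01`, the tree gives about `(n / m) ^ 1.01` cubes, which exceeds `n ^ (3/2)` by a power and absorbs
the logarithm. -/

/-! ### A Remez inequality for sequences with small high differences -/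

/-- Newton form of an approximate polynomial: a sequence with small `d`-th differences. -/
theorem exists_newton_approx (d n : ℕ) (g : ℕ → ℝ) (H L : ℝ) (hL : (n + d : ℝ) + 1 ≤ L)
    (h : ∀ t ≤ n, |(fwdDiff 1)^[d] g t| ≤ H) :
    ∃ a : ℕ → ℝ, ∀ t ≤ n + d, |g t - ∑ k ∈ range d, a k * (t.choose k : ℝ)| ≤ L ^ d * H := by
  induction d generalizing g with
  | zero => exact ⟨0, fun t ht => by simpa using h t (by simpa using ht)⟩
  | succ d ih =>
    have hH : 0 ≤ H := (abs_nonneg _).trans (h 0 (Nat.zero_le _))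
    push_cast at hL
    have hL1 : 1 ≤ L := by have : (0 : ℝ) ≤ n + d := by positivity
                           linarith
    obtain ⟨a, ha⟩ := ih (fwdDiff 1 g) (by linarith) (fun t ht => by
      simpa [Function.iterate_succ_apply] using h t ht)
    -- The Newton coefficients of `g` are `g 0` followed by those of its difference. By Pascal's
    -- rule the error at `t` is a sum of `t ≤ L` errors for the difference.
    refine ⟨fun k => Nat.casesOn k (g 0) a, fun t ht => ?_⟩
    have key : ∀ t ≤ n + (d + 1), |g t - ∑ k ∈ range (d + 1),
        (Nat.casesOn k (g 0) a : ℝ) * (t.choose k : ℝ)| ≤ t * (L ^ d * H) := by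
      intro t
      induction t with
      | zero => intro _; simp [sum_range_succ']
      | succ t iht =>
        intro ht
        have h1 := iht (by omega)
        have h2 := ha t (by omega)
        have e : g (t + 1) - ∑ k ∈ range (d + 1),
            (Nat.casesOn k (g 0) a : ℝ) * ((t + 1).choose k : ℝ) =
            (g t - ∑ k ∈ range (d + 1), (Nat.casesOn k (g 0) a : ℝ) * (t.choose k : ℝ)) +
            (fwdDiff 1 g t - ∑ k ∈ range d, a k * (t.choose k : ℝ)) := by
          simp only [sum_range_succ', fwdDiff, Nat.choose_succ_succ, Nat.cast_add, mul_add,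
            sum_add_distrib, Nat.choose_zero_right]
          ring
        rw [e]
        refine (abs_add_le _ _).trans ?_
        push_cast
        linarith
    refine (key t ht).trans ?_
    rw [pow_succ]
    have : (t : ℝ) ≤ L := by
      have : (t : ℝ) ≤ n + (d + 1) := by exact_mod_cast ht
      linarith
    have : 0 ≤ L ^ d * H := by positivity
    nlinarith

theorem newton_eval_eq (d : ℕ) (a : ℕ → ℝ) :
    ∃ P : Polynomial ℝ, P.degree < d ∧
      ∀ t : ℕ, P.eval (t : ℝ) = ∑ k ∈ range d, a k * (t.choose k : ℝ) := by
  refine ⟨∑ k ∈ range d, Polynomial.C (a k / k.factorial) * descPochhammer ℝ k, ?_, fun t => ?_⟩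
  · refine (Polynomial.degree_sum_le _ _).trans_lt ?_
    refine (Finset.sup_lt_iff (by exact WithBot.bot_lt_coe d)).2 fun k hk => ?_
    refine Polynomial.degree_le_natDegree.trans_lt ?_
    refine lt_of_le_of_lt (b := ((k : ℕ) : WithBot ℕ)) ?_ (by exact_mod_cast mem_range.1 hk)
    have := Polynomial.natDegree_C_mul_le (a k / k.factorial) (descPochhammer ℝ k)
    rw [descPochhammer_natDegree] at this
    exact_mod_cast this
  · rw [Polynomial.eval_finsetSum]
    refine sum_congr rfl fun k _ => ?_
    rw [Polynomial.eval_mul, Polynomial.eval_C, descPochhammer_eval_eq_descFactorial,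
      Nat.descFactorial_eq_factorial_mul_choose]
    have : (k.factorial : ℝ) ≠ 0 := by positivity
    push_cast
    field_simp

/-- Crude Lagrange extrapolation over integer nodes. -/
theorem abs_eval_le_of_small_nodes (d : ℕ) (P : Polynomial ℝ) (hP : P.degree < d) (s : Finset ℕ)
    (hs : d ≤ #s) (L B : ℝ) (hL : 1 ≤ L) (hsL : ∀ t ∈ s, (t : ℝ) ≤ L)
    (hB : ∀ t ∈ s, |P.eval (t : ℝ)| ≤ B) (x : ℕ) (hx : (x : ℝ) ≤ L) :
    |P.eval (x : ℝ)| ≤ d * L ^ d * B := by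
  obtain ⟨s', hs', hcard⟩ := exists_subset_card_eq hs
  have hinj : Set.InjOn (fun t : ℕ => (t : ℝ)) s' := fun a _ b _ hab => Nat.cast_injective hab
  rcases Nat.eq_zero_or_pos d with rfl | hd
  · have : P = 0 := by
      rw [← Polynomial.degree_eq_bot]
      exact (Nat.WithBot.lt_zero_iff).1 (by simpa using hP)
    simp [this]
  have hB0 : 0 ≤ B := by
    obtain ⟨t, ht⟩ := card_pos.1 (hd.trans_le hs)
    exact (abs_nonneg _).trans (hB t ht)
  have := Lagrange.eq_interpolate hinj (f := P) (by rw [hcard]; exact hP)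
  rw [this, Lagrange.interpolate_apply, Polynomial.eval_finsetSum]
  refine (abs_sum_le_sum_abs _ _).trans ?_
  have hb : ∀ t ∈ s', |Polynomial.eval (x : ℝ) (Polynomial.C (P.eval (t : ℝ)) *
      Lagrange.basis s' (fun t : ℕ => (t : ℝ)) t)| ≤ L ^ d * B := by
    intro t ht
    rw [Polynomial.eval_mul, Polynomial.eval_C, abs_mul, Lagrange.basis, Polynomial.eval_prod,
      abs_prod]
    have h1 : ∏ j ∈ s'.erase t, |Polynomial.eval (x : ℝ) (Lagrange.basisDivisor (t : ℝ) (j : ℝ))|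
        ≤ L ^ d := by
      refine (prod_le_prod (g := fun _ => L) (fun _ _ => abs_nonneg _) fun j hj => ?_).trans (by
        rw [prod_const]
        exact pow_le_pow_right₀ hL (by rw [← hcard]; exact card_le_card (erase_subset _ _)))
      rw [Lagrange.basisDivisor, Polynomial.eval_mul, Polynomial.eval_C, Polynomial.eval_sub,
        Polynomial.eval_X, Polynomial.eval_C, abs_mul, abs_inv]
      have hj' := mem_erase.1 hj
      -- Distinct integer nodes are at distance at least one, so the denominators of the Lagrange
      -- basis can be dropped.
      have h2 : 1 ≤ |(t : ℝ) - j| := by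
        have : (1 : ℤ) ≤ |(t : ℤ) - j| := Int.one_le_abs (by
          intro h; apply hj'.1; omega)
        exact_mod_cast this
      have h3 : |(x : ℝ) - j| ≤ L := by
        have := hsL j (hs' hj'.2)
        rw [abs_le]
        constructor <;> [have := Nat.cast_nonneg (α := ℝ) x; have := Nat.cast_nonneg (α := ℝ) j] <;>
          linarith
      calc |(t : ℝ) - j|⁻¹ * |(x : ℝ) - j| ≤ 1 * L :=
            mul_le_mul (inv_le_one_of_one_le₀ h2) h3 (abs_nonneg _) zero_le_one
        _ = L := one_mul L
    have h2 := hB t (hs' ht)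
    calc _ ≤ B * L ^ d := mul_le_mul h2 h1 (prod_nonneg fun _ _ => abs_nonneg _) hB0
      _ = _ := mul_comm _ _
  refine (sum_le_sum hb).trans ?_
  rw [sum_const, hcard, nsmul_eq_mul, mul_assoc]

/-- A discrete Remez inequality. -/
theorem abs_le_of_fwdDiff_small (d n : ℕ) (g : ℕ → ℝ) (H B L : ℝ) (hL : (n + d : ℝ) + 1 ≤ L)
    (hB : 0 ≤ B) (h : ∀ t ≤ n, |(fwdDiff 1)^[d] g t| ≤ H)
    (hsmall : d ≤ #{t ∈ range (n + d + 1) | |g t| ≤ B}) (t : ℕ) (ht : t ≤ n + d) :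
    |g t| ≤ 2 * L ^ (2 * d + 1) * (B + H) := by
  have hH : 0 ≤ H := (abs_nonneg _).trans (h 0 (Nat.zero_le _))
  have hn : (0 : ℝ) ≤ n := by positivity
  have hd : (0 : ℝ) ≤ d := by positivity
  have hL1 : 1 ≤ L := by linarith
  obtain ⟨a, ha⟩ := exists_newton_approx d n g H L hL h
  obtain ⟨P, hP, hPe⟩ := newton_eval_eq d a
  have hcast : ∀ t : ℕ, t ≤ n + d → (t : ℝ) ≤ L := fun t ht => by
    have : (t : ℝ) ≤ n + d := by exact_mod_cast ht
    linarith
  have h1 := abs_eval_le_of_small_nodes d P hP _ hsmall L (B + L ^ d * H) hL1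
    (fun t ht => hcast t (by have := mem_range.1 (mem_filter.1 ht).1; omega))
    (fun t ht => by
      have h2 := ha t (by have := mem_range.1 (mem_filter.1 ht).1; omega)
      have h3 := (mem_filter.1 ht).2
      rw [hPe]
      calc _ = |g t - (g t - ∑ k ∈ range d, a k * (t.choose k : ℝ))| := by congr 1; ring
        _ ≤ _ := (abs_sub _ _).trans (add_le_add h3 h2)) t (hcast t ht)
  have h2 := ha t ht
  rw [← hPe] at h2
  have h3 : |g t| ≤ |g t - P.eval (t : ℝ)| + |P.eval (t : ℝ)| := by
    calc |g t| = |(g t - P.eval (t : ℝ)) + P.eval (t : ℝ)| := by congr 1; ring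
      _ ≤ _ := abs_add_le _ _
  have hLd : 1 ≤ L ^ d := one_le_pow₀ hL1
  have e : L ^ (2 * d + 1) = L ^ d * L ^ d * L := by ring
  rw [e]
  have hdL : (d : ℝ) ≤ L := by linarith
  set Q := L ^ d with hQ
  have i1 : d * Q * (B + Q * H) ≤ Q * Q * L * (B + H) := by
    have a1 : B + Q * H ≤ Q * (B + H) := by nlinarith
    have a2 : (d : ℝ) * Q ≤ L * Q := by nlinarith
    calc d * Q * (B + Q * H) ≤ (L * Q) * (Q * (B + H)) :=
          mul_le_mul a2 a1 (by positivity) (by positivity)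
      _ = _ := by ring
  have i2 : Q * H ≤ Q * Q * L * (B + H) := by
    have : Q ≤ Q * Q * L := by nlinarith [mul_le_mul hLd hL1 zero_le_one (by linarith)]
    exact mul_le_mul this (by linarith) hH (by positivity)
  linarith

/-! ### Triangles in the planes `x + y + z = s` and their rows -/

/-- The level `x + y + z` of a lattice point. -/
def lsum (v : Lattice3) : ℤ := v 0 + v 1 + v 2

theorem lsum_eq (v : Lattice3) (i : Fin 3) : lsum v = v i + v (i + 1) + v (i + 2) := by
  fin_cases i <;> simp [lsum] <;> ring

theorem sum_fin3 {M : Type*} [AddCommMonoid M] (F : Fin 3 → M) (i : Fin 3) :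
    ∑ k, F k = F i + F (i + 1) + F (i + 2) := by
  fin_cases i <;> simp [Fin.sum_univ_three]
  · abel
  · abel

theorem fin3_cases (i k : Fin 3) : k = i ∨ k = i + 1 ∨ k = i + 2 := by
  revert i k; decide

theorem forall_fin3 {P : Fin 3 → Prop} (i : Fin 3) (h0 : P i) (h1 : P (i + 1)) (h2 : P (i + 2)) :
    ∀ k, P k := fun k => by
  rcases fin3_cases i k with rfl | rfl | rfl <;> assumption

@[simp] theorem fin3_ne1 (i : Fin 3) : i + 1 ≠ i := by revert i; decide
@[simp] theorem fin3_ne2 (i : Fin 3) : i + 2 ≠ i := by revert i; decide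
@[simp] theorem fin3_ne3 (i : Fin 3) : i + 2 ≠ i + 1 := by revert i; decide
@[simp] theorem fin3_ne1' (i : Fin 3) : i ≠ i + 1 := by revert i; decide
@[simp] theorem fin3_ne2' (i : Fin 3) : i ≠ i + 2 := by revert i; decide
@[simp] theorem fin3_ne3' (i : Fin 3) : i + 1 ≠ i + 2 := by revert i; decide

/-- The point `p - d e_i + t e_{i+1} + r e_{i+2}`. -/
def rowPt (p : Lattice3) (i : Fin 3) (d t r : ℤ) : Lattice3 :=
  fun k => if k = i then p k - d else if k = i + 1 then p k + t else p k + r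

@[simp] theorem rowPt_zero (p : Lattice3) (i : Fin 3) (d t r : ℤ) :
    rowPt p i d t r i = p i - d := by simp [rowPt]
@[simp] theorem rowPt_one (p : Lattice3) (i : Fin 3) (d t r : ℤ) :
    rowPt p i d t r (i + 1) = p (i + 1) + t := by simp [rowPt]
@[simp] theorem rowPt_two (p : Lattice3) (i : Fin 3) (d t r : ℤ) :
    rowPt p i d t r (i + 2) = p (i + 2) + r := by simp [rowPt]

theorem lattice_ext (i : Fin 3) {v w : Lattice3} (h0 : v i = w i) (h1 : v (i + 1) = w (i + 1))
    (h2 : v (i + 2) = w (i + 2)) : v = w := funext (forall_fin3 i h0 h1 h2)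

theorem lsum_rowPt (p : Lattice3) (i : Fin 3) (d t r : ℤ) :
    lsum (rowPt p i d t r) = lsum p - d + t + r := by
  rw [lsum_eq _ i, lsum_eq p i]; simp; ring

theorem rowPt_add_zero (p : Lattice3) (i : Fin 3) (d t r : ℤ) :
    rowPt p i d t r + Pi.single i 1 = rowPt p i (d - 1) t r :=
  lattice_ext i (by simp; ring) (by simp) (by simp)
theorem rowPt_add_one (p : Lattice3) (i : Fin 3) (d t r : ℤ) :
    rowPt p i d t r + Pi.single (i + 1) 1 = rowPt p i d (t + 1) r :=
  lattice_ext i (by simp) (by simp; ring) (by simp)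
theorem rowPt_add_two (p : Lattice3) (i : Fin 3) (d t r : ℤ) :
    rowPt p i d t r + Pi.single (i + 2) 1 = rowPt p i d t (r + 1) :=
  lattice_ext i (by simp) (by simp) (by simp; ring)

/-- `|f| ≤ B` on the triangle `{v ≥ p, x + y + z = s}`. -/
def TriBound (f : Lattice3 → ℝ) (p : Lattice3) (s : ℤ) (B : ℝ) : Prop :=
  ∀ v, lsum v = s → (∀ i, p i ≤ v i) → |f v| ≤ B

/-- The sums of `f` over the unit upward triangles contained in `{v ≥ p, x + y + z = s}` are at
most `η` in absolute value. -/
def TriRel (f : Lattice3 → ℝ) (p : Lattice3) (s : ℤ) (η : ℝ) : Prop :=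
  ∀ b, lsum b = s - 1 → (∀ i, p i ≤ b i) → |∑ i, f (b + Pi.single i 1)| ≤ η

theorem TriBound.mono {f : Lattice3 → ℝ} {p q : Lattice3} {s : ℤ} {B B' : ℝ}
    (h : TriBound f p s B) (hpq : ∀ i, p i ≤ q i) (hB : B ≤ B') : TriBound f q s B' :=
  fun v hv hq => (h v hv fun i => (hpq i).trans (hq i)).trans hB

theorem TriRel.mono {f : Lattice3 → ℝ} {p q : Lattice3} {s : ℤ} {B B' : ℝ}
    (h : TriRel f p s B) (hpq : ∀ i, p i ≤ q i) (hB : B ≤ B') : TriRel f q s B' :=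
  fun v hv hq => (h v hv fun i => (hpq i).trans (hq i)).trans hB

section
variable {f : Lattice3 → ℝ} {p : Lattice3} {i : Fin 3} {s : ℤ} {n d : ℕ} {η : ℝ}

/-- One unit triangle has a vertex in row `d'` and two neighbouring vertices in row `d' + 1`. Here
`n` is the side length of the triangle with corner `p`, row `d'` is the line at distance `d'` beyond
its side, with `n + d' + 1` points, and `rowPt p i d 0 0` serves as the corner of the triangle
enlarged by `d` rows. -/
theorem row_step (hs : lsum p + n = s) (hrel : TriRel f (rowPt p i d 0 0) s η) (d' t : ℕ)
    (hd' : d' + 1 ≤ d) (ht : t + 1 ≤ n + (d' + 1)) :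
    |f (rowPt p i d' t (n + d' - t)) + f (rowPt p i (d' + 1) (t + 1) (n + (d' + 1) - (t + 1))) +
      f (rowPt p i (d' + 1) t (n + (d' + 1) - t))| ≤ η := by
  have h := hrel (rowPt p i (d' + 1) t (n + d' - t)) (by rw [lsum_rowPt]; linarith)
    (forall_fin3 i (by simp; omega) (by simp) (by simp; omega))
  rw [sum_fin3 _ i, rowPt_add_zero, rowPt_add_one, rowPt_add_two] at h
  convert h using 5 <;> ring_nf

/-- After multiplication by `(-1) ^ t`, the sum of two neighbours becomes a difference, so each
forward difference moves one row closer to the known triangle. The errors obey `e ↦ 2 e + η`. -/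
theorem row_diff (hs : lsum p + n = s) (hrel : TriRel f (rowPt p i d 0 0) s η)
    (k : ℕ) (hk : k ≤ d) (t : ℕ) (ht : t ≤ n + (d - k)) :
    |(fwdDiff 1)^[k] (fun t : ℕ => (-1 : ℝ) ^ t * f (rowPt p i d t (n + d - t))) t -
      (-1) ^ t * f (rowPt p i ((d - k : ℕ) : ℤ) t (n + ((d - k : ℕ) : ℤ) - t))| ≤
      (2 ^ k - 1) * η := by
  induction k generalizing t with
  | zero => simp
  | succ k ih =>
    rw [Function.iterate_succ_apply']
    have h1 := ih (by omega) (t + 1) (by omega)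
    have h2 := ih (by omega) t (by omega)
    obtain ⟨e, he⟩ : ∃ e, d - k = e + 1 := ⟨d - k - 1, by omega⟩
    have he' : d - (k + 1) = e := by omega
    have h3 := row_step (d := d) hs hrel e t (by omega) (by omega)
    rw [he'] at ht ⊢
    rw [he] at h1 h2
    simp only [fwdDiff]
    set X := (fwdDiff 1)^[k] (fun t : ℕ => (-1 : ℝ) ^ t * f (rowPt p i d t (n + d - t)))
    push_cast at h1 h2 ⊢
    set a := f (rowPt p i e t (n + e - t))
    set b := f (rowPt p i (e + 1) (t + 1) (n + (e + 1) - (t + 1)))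
    set c := f (rowPt p i (e + 1) t (n + (e + 1) - t))
    have h4 : |(-1 : ℝ) ^ (t + 1) * b - (-1) ^ t * c - (-1) ^ t * a| ≤ η := by
      have : (-1 : ℝ) ^ (t + 1) * b - (-1) ^ t * c - (-1) ^ t * a = -(-1) ^ t * (a + b + c) := by
        ring
      rw [this, abs_mul]; simpa using h3
    rw [pow_succ (2 : ℝ) k]
    rw [abs_le] at *
    constructor <;> linarith [h1.1, h1.2, h2.1, h2.2, h4.1, h4.2]

/-- Extension of a bound across one side of a triangle. -/
theorem TriBound.extend {B θ W : ℝ} (hs : lsum p + n = s) (hB : TriBound f p s B)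
    (hrel : TriRel f (rowPt p i d 0 0) s B) (hB0 : 0 ≤ B) (hθ : θ ≤ B) (hW2 : 2 ≤ W)
    (hW : (n + d : ℝ) + 1 ≤ W)
    (hsmall : d ≤ #{t ∈ range (n + d + 1) | |f (rowPt p i d (t : ℕ) (n + d - (t : ℕ)))| ≤ θ}) :
    TriBound f (rowPt p i d 0 0) s (W ^ (5 * d + 3) * B) := by
  have hW1 : 1 ≤ W := by linarith
  -- The `d`-th difference of the alternating outermost row is the side of the known triangle up to
  -- `(2 ^ d - 1) B`, so the Remez inequality applies to that row.
  have top : ∀ t ≤ n + d, |f (rowPt p i d (t : ℕ) (n + d - (t : ℕ)))| ≤ W ^ (3 * d + 3) * B := by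
    intro t ht
    have := abs_le_of_fwdDiff_small d n (fun t : ℕ => (-1 : ℝ) ^ t * f (rowPt p i d t (n + d - t)))
      (2 ^ d * B) B W hW hB0 (fun t ht => by
        have h1 := row_diff hs hrel d le_rfl t (by omega)
        have h2 : |(-1 : ℝ) ^ t * f (rowPt p i ((d - d : ℕ) : ℤ) t (n + ((d - d : ℕ) : ℤ) - t))|
            ≤ B := by
          rw [abs_mul]
          simp only [abs_pow, abs_neg, abs_one, one_pow, one_mul]
          refine hB _ (by rw [lsum_rowPt]; simp; linarith)
            (forall_fin3 i (by simp) (by simp) (by simp; omega))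
        have h3 := abs_sub_abs_le_abs_sub ((fwdDiff 1)^[d] (fun t : ℕ =>
          (-1 : ℝ) ^ t * f (rowPt p i d t (n + d - t))) t)
          ((-1 : ℝ) ^ t * f (rowPt p i ((d - d : ℕ) : ℤ) t (n + ((d - d : ℕ) : ℤ) - t)))
        linarith) (hsmall.trans (card_le_card (monotone_filter_right _ fun t _ h => by
          simpa [abs_mul] using h.trans hθ))) t ht
    rw [abs_mul] at this
    simp only [abs_pow, abs_neg, abs_one, one_pow, one_mul] at this
    refine this.trans ?_
    have e : W ^ (3 * d + 3) * B = W * W ^ (2 * d + 1) * (W ^ d * W * B) := by ring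
    rw [e]
    have h2d : (2 : ℝ) ^ d ≤ W ^ d := pow_le_pow_left₀ (by norm_num) hW2 d
    have h1d : (1 : ℝ) ≤ W ^ d := one_le_pow₀ hW1
    have h3d : 1 + 2 ^ d ≤ W ^ d * W := by nlinarith
    have : B + 2 ^ d * B ≤ W ^ d * W * B := by nlinarith
    gcongr
  -- The rows in between are recovered from the outermost one inwards: each value is minus the sum
  -- of two values one row further out, up to the error in the relation. The factor `3` per row is
  -- absorbed in `W ^ 2`.
  have down : ∀ k ≤ d, ∀ t ≤ n + (d - k),
      |f (rowPt p i ((d - k : ℕ) : ℤ) (t : ℕ) (n + ((d - k : ℕ) : ℤ) - (t : ℕ)))| ≤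
        W ^ (2 * k) * (W ^ (3 * d + 3) * B) := by
    intro k
    induction k with
    | zero => intro _ t ht; simpa using top t ht
    | succ k ih =>
      intro hk t ht
      obtain ⟨e, he⟩ : ∃ e, d - k = e + 1 := ⟨d - k - 1, by omega⟩
      have he' : d - (k + 1) = e := by omega
      have h1 := ih (by omega) t (by omega)
      have h2 := ih (by omega) (t + 1) (by omega)
      have h3 := row_step (d := d) hs hrel e t (by omega) (by omega)
      rw [he'] at ht ⊢
      rw [he] at h1 h2
      push_cast at h1 h2
      have hX : B ≤ W ^ (2 * k) * (W ^ (3 * d + 3) * B) := by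
        have a1 : 1 ≤ W ^ (2 * k) * W ^ (3 * d + 3) :=
          one_le_mul_of_one_le_of_one_le (one_le_pow₀ hW1) (one_le_pow₀ hW1)
        nlinarith
      have e2 : W ^ (2 * (k + 1)) = W ^ (2 * k) * W ^ 2 := by ring
      rw [e2]
      set X := W ^ (2 * k) * (W ^ (3 * d + 3) * B)
      have hX3 : 3 * X ≤ W ^ (2 * k) * W ^ 2 * (W ^ (3 * d + 3) * B) := by
        have : W ^ (2 * k) * W ^ 2 * (W ^ (3 * d + 3) * B) = W ^ 2 * X := by ring
        rw [this]
        have : 3 ≤ W ^ 2 := by nlinarith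
        exact mul_le_mul_of_nonneg_right this (hB0.trans hX)
      rw [abs_le] at *
      constructor <;> linarith [h1.1, h1.2, h2.1, h2.2, h3.1, h3.2]
  intro v hv hpv
  have hfin : ∀ k ≤ d, W ^ (2 * k) * (W ^ (3 * d + 3) * B) ≤ W ^ (5 * d + 3) * B := by
    intro k hk
    rw [← mul_assoc, ← pow_add]
    exact mul_le_mul_of_nonneg_right (pow_le_pow_right₀ hW1 (by omega)) hB0
  have q0 := hpv i
  have q1 := hpv (i + 1)
  have q2 := hpv (i + 2)
  simp only [rowPt_zero, rowPt_one, rowPt_two, add_zero] at q0 q1 q2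
  rw [lsum_eq _ i] at hv
  have hs' := hs
  rw [lsum_eq _ i] at hs'
  by_cases hvi : p i ≤ v i
  · refine (hB v (by rw [lsum_eq _ i]; exact hv) (forall_fin3 i hvi q1 q2)).trans ?_
    nlinarith [one_le_pow₀ hW1 (n := 5 * d + 3)]
  · obtain ⟨d', hd'⟩ := Int.eq_ofNat_of_zero_le (a := p i - v i) (by omega)
    obtain ⟨t, ht⟩ := Int.eq_ofNat_of_zero_le (a := v (i + 1) - p (i + 1)) (by omega)
    have h := down (d - d') (by omega) t (by omega)
    have hdd : d - (d - d') = d' := by omega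
    rw [hdd] at h
    have hv' : v = rowPt p i d' t (n + d' - t) :=
      lattice_ext i (by simp; omega) (by simp; omega) (by simp; omega)
    rw [hv']
    exact h.trans (hfin _ (by omega))

end

/-! ### Rows that resist the extension contain many large points -/

open scoped Classical in
/-- Fewer than `d` points of the `d`-th row below the triangle `{v ≥ p}` are small. -/
def RowFull (f : Lattice3 → ℝ) (θ : ℝ) (p : Lattice3) (i : Fin 3) (n d : ℕ) : Prop :=
  #{t ∈ range (n + d + 1) | |f (rowPt p i d (t : ℕ) (n + d - (t : ℕ)))| ≤ θ} < d

/-- A nonzero lattice vector with coordinates in `{-1, 0, 1}`. -/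
def IsUnitStep (v : Lattice3) : Prop := (∃ k, v k ≠ 0) ∧ ∀ k, |v k| ≤ 1

open scoped Classical in
/-- Every lattice segment of `L` points within distance `C L` of `q` has at most `L / 100` points
in `E`. -/
def SparseAt (E : Set Lattice3) (C : ℕ) (q : Lattice3) : Prop :=
  ∀ (L : ℕ) (b v : Lattice3), 1 ≤ L → IsUnitStep v →
    (∀ t < L, ∀ k, |b k + t * v k - q k| ≤ C * L) →
    100 * #{t ∈ range L | (fun k => b k + (t : ℕ) * v k) ∈ E} ≤ L

theorem rowPt_eq_segment (p : Lattice3) (i : Fin 3) (d t r : ℤ) :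
    rowPt p i d t (r - t) = fun k => rowPt p i d 0 r k +
      t * (Pi.single (i + 1) (1 : ℤ) - Pi.single (i + 2) 1 : Lattice3) k :=
  lattice_ext i (by simp) (by simp) (by simp; ring)

theorem isUnitStep_row (i : Fin 3) :
    IsUnitStep (Pi.single (i + 1) (1 : ℤ) - Pi.single (i + 2) 1 : Lattice3) :=
  ⟨⟨i + 1, by simp⟩, forall_fin3 i (by simp) (by simp) (by simp)⟩

open scoped Classical in
theorem SparseAt.row {E : Set Lattice3} {C : ℕ} {q : Lattice3} (h : SparseAt E C q)
    (p : Lattice3) (i : Fin 3) (d r : ℤ) (L : ℕ) (hL : 1 ≤ L)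
    (hq : ∀ t < L, ∀ k, |rowPt p i d (t : ℕ) (r - (t : ℕ)) k - q k| ≤ C * L) :
    100 * #{t ∈ range L | rowPt p i d (t : ℕ) (r - (t : ℕ)) ∈ E} ≤ L := by
  have := h L (rowPt p i d 0 r) _ hL (isUnitStep_row i) (fun t ht k => by
    have := hq t ht k
    rwa [rowPt_eq_segment] at this)
  simpa only [← rowPt_eq_segment] using this

-- Of the `n + d + 1` points of the row at most `d - 1` are small and at most half of `n + 2` lie in
-- `E`. The remaining ones, at least half of `n + 2`, are large.
open scoped Classical in
theorem large_of_rowFull {f : Lattice3 → ℝ} {θ : ℝ} {p : Lattice3} {i : Fin 3} {n d : ℕ} {s : ℤ}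
    {E : Set Lattice3} {A : Finset Lattice3} (hs : lsum p + n = s) (hfull : RowFull f θ p i n d)
    (hA : ∀ v, lsum v = s → (∀ k, rowPt p i d 0 0 k ≤ v k) → v ∉ E → θ < |f v| → v ∈ A)
    (hE : 2 * #{t ∈ range (n + d + 1) | rowPt p i d (t : ℕ) (n + d - (t : ℕ)) ∈ E} ≤ n + 2) :
    n + 2 ≤ 2 * #{v ∈ A | v i = p i - d ∧ lsum v = s ∧ ∀ k, rowPt p i d 0 0 k ≤ v k} := by
  unfold RowFull at hfull
  set S := {t ∈ range (n + d + 1) | |f (rowPt p i d (t : ℕ) (n + d - (t : ℕ)))| ≤ θ}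
  set F := {t ∈ range (n + d + 1) | rowPt p i d (t : ℕ) (n + d - (t : ℕ)) ∈ E}
  have h1 : #(range (n + d + 1) \ (S ∪ F)) ≤
      #{v ∈ A | v i = p i - d ∧ lsum v = s ∧ ∀ k, rowPt p i d 0 0 k ≤ v k} := by
    refine card_le_card_of_injOn (fun t : ℕ => rowPt p i d (t : ℕ) (n + d - (t : ℕ))) ?_ ?_
    · intro t ht
      simp only [coe_sdiff, coe_union, Set.mem_sdiff, mem_coe, mem_range, Set.mem_union, S, F,
        mem_filter, not_or, not_and, not_le] at ht
      obtain ⟨ht, h2, h3⟩ := ht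
      have a1 : lsum (rowPt p i d (t : ℕ) (n + d - (t : ℕ))) = s := by rw [lsum_rowPt]; linarith
      have a2 : ∀ k, rowPt p i d 0 0 k ≤ rowPt p i d (t : ℕ) (n + d - (t : ℕ)) k :=
        forall_fin3 i (by simp) (by simp) (by simp; omega)
      simp only [mem_coe, mem_filter, rowPt_zero, true_and]
      exact ⟨hA _ a1 a2 (h3 ht) (h2 ht), a1, a2⟩
    · intro t _ t' _ h
      have := congrFun h (i + 1)
      simpa using this
  have h2 : n + d + 1 ≤ #(range (n + d + 1) \ (S ∪ F)) + (#S + #F) := by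
    have := le_card_sdiff (S ∪ F) (range (n + d + 1))
    have := card_union_le S F
    rw [card_range] at *
    omega
  omega

theorem card_mul_le_of_fibers {A : Finset Lattice3} {i : Fin 3} {x : ℤ} (D : Finset ℕ) (c : ℕ)
    (P : Lattice3 → Prop) [DecidablePred P] (h : ∀ d ∈ D, c ≤ 2 * #{v ∈ A | v i = x - (d : ℕ) ∧ P v}) :
    #D * c ≤ 2 * #{v ∈ A | P v} := by
  have h1 : ∑ d ∈ D, #{v ∈ A | v i = x - (d : ℕ) ∧ P v} ≤ #{v ∈ A | P v} := by
    rw [← card_biUnion]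
    · refine card_le_card fun v hv => ?_
      simp only [mem_biUnion, mem_filter] at hv ⊢
      obtain ⟨d, _, h1, _, h2⟩ := hv
      exact ⟨h1, h2⟩
    · intro d _ d' _ hdd
      rw [Function.onFun, disjoint_left]
      intro v hv hv'
      simp only [mem_filter] at hv hv'
      apply hdd
      have := hv.2.1.symm.trans hv'.2.1
      omega
  calc #D * c = ∑ d ∈ D, c := by simp
    _ ≤ ∑ d ∈ D, 2 * #{v ∈ A | v i = x - (d : ℕ) ∧ P v} := sum_le_sum h
    _ = 2 * ∑ d ∈ D, #{v ∈ A | v i = x - (d : ℕ) ∧ P v} := (mul_sum _ _ _).symm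
    _ ≤ _ := by omega

theorem rowPt_le {p : Lattice3} {i : Fin 3} {d d' : ℤ} (h : d' ≤ d) (k : Fin 3) :
    rowPt p i d 0 0 k ≤ rowPt p i d' 0 0 k :=
  forall_fin3 (P := fun k => rowPt p i d 0 0 k ≤ rowPt p i d' 0 0 k) i (by simp; omega) (by simp)
    (by simp) k

section
variable {f : Lattice3 → ℝ} {θ B W : ℝ} {p : Lattice3} {i : Fin 3} {s : ℤ} {n : ℕ}
  {E : Set Lattice3} {A : Finset Lattice3}

theorem TriBound.extend_of_not_rowFull {d x : ℕ} (hdx : d ≤ x) (hs : lsum p + n = s)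
    (hB : TriBound f p s B) (hrel : TriRel f (rowPt p i x 0 0) s B) (hB0 : 0 ≤ B) (hθ : θ ≤ B)
    (hW2 : 2 ≤ W) (hW : (n + x : ℝ) + 1 ≤ W) (hd : ¬ RowFull f θ p i n d) :
    TriBound f (rowPt p i d 0 0) s (W ^ (5 * x + 3) * B) := by
  have hdx' : (d : ℝ) ≤ x := by exact_mod_cast hdx
  refine (hB.extend hs (hrel.mono (rowPt_le (by exact_mod_cast hdx)) le_rfl) hB0 hθ hW2
    (by linarith) (not_lt.1 hd)).mono (fun _ => le_rfl) ?_
  exact mul_le_mul_of_nonneg_right (pow_le_pow_right₀ (by linarith) (by omega)) hB0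

open scoped Classical in
/-- Extension of a bound across one side of a triangle by `e` rows, unless there are many large
points. -/
theorem TriBound.extend_or_large {e : ℕ} (he : 1 ≤ e) (hs : lsum p + n = s)
    (hB : TriBound f p s B) (hrel : TriRel f (rowPt p i (2 * e : ℕ) 0 0) s B) (hB0 : 0 ≤ B)
    (hθ : θ ≤ B) (hW2 : 2 ≤ W) (hW : (n + (2 * e : ℕ) : ℝ) + 1 ≤ W)
    (hA : ∀ v, lsum v = s → (∀ k, rowPt p i (2 * e : ℕ) 0 0 k ≤ v k) → v ∉ E → θ < |f v| → v ∈ A)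
    (hE : ∀ d < 2 * e,
      2 * #{t ∈ range (n + d + 1) | rowPt p i d (t : ℕ) (n + d - (t : ℕ)) ∈ E} ≤ n + 2) :
    TriBound f (rowPt p i e 0 0) s (W ^ (10 * e + 3) * B) ∨
      e * (n + 2) ≤ 2 * #{v ∈ A | lsum v = s ∧ ∀ k, rowPt p i (2 * e : ℕ) 0 0 k ≤ v k} := by
  -- Any row among `e, …, 2e - 1` that is not full allows an extension by at least `e` rows.
  -- Otherwise all `e` of these rows contribute large points.
  by_cases hfull : ∀ d ∈ Ico e (2 * e), RowFull f θ p i n d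
  · right
    have := card_mul_le_of_fibers (A := A) (i := i) (x := p i) (Ico e (2 * e)) (n + 2)
      (fun v => lsum v = s ∧ ∀ k, rowPt p i (2 * e : ℕ) 0 0 k ≤ v k) (fun d hd => by
        have hd' : d < 2 * e := (mem_Ico.1 hd).2
        have hle : (d : ℤ) ≤ (2 * e : ℕ) := by exact_mod_cast hd'.le
        refine (large_of_rowFull hs (hfull d hd)
          (fun v h1 h2 => hA v h1 fun k => (rowPt_le hle k).trans (h2 k)) (hE d hd')).trans ?_
        refine Nat.mul_le_mul_left _ (card_le_card (monotone_filter_right _ fun v _ hv =>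
          ⟨hv.1, hv.2.1, fun k => (rowPt_le hle k).trans (hv.2.2 k)⟩)))
    have h2 : 2 * e - e = e := by omega
    simpa [h2] using this
  · left
    push Not at hfull
    obtain ⟨d, hd, hd'⟩ := hfull
    rw [mem_Ico] at hd
    refine (hB.extend_of_not_rowFull (x := 2 * e) hd.2.le hs hrel hB0 hθ hW2 hW hd').mono
      (rowPt_le (by exact_mod_cast hd.1)) (le_of_eq (by ring_nf))

open scoped Classical in
/-- Extension of a bound across one side of a triangle as far as possible: each row that is not
reached contains many large points. -/
theorem TriBound.extend_max (x : ℕ) (hs : lsum p + n = s)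
    (hB : TriBound f p s B) (hrel : TriRel f (rowPt p i x 0 0) s B) (hB0 : 0 ≤ B)
    (hθ : θ ≤ B) (hW2 : 2 ≤ W) (hW : (n + x : ℝ) + 1 ≤ W)
    (hA : ∀ v, lsum v = s → (∀ k, rowPt p i x 0 0 k ≤ v k) → v ∉ E → θ < |f v| → v ∈ A)
    (hE : ∀ d ≤ x,
      2 * #{t ∈ range (n + d + 1) | rowPt p i d (t : ℕ) (n + d - (t : ℕ)) ∈ E} ≤ n + 2) :
    ∃ j ≤ x, TriBound f (rowPt p i ((x - j : ℕ) : ℤ) 0 0) s (W ^ (5 * x + 3) * B) ∧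
      j * (n + 2) ≤ 2 * #{v ∈ A | lsum v = s ∧ ∀ k, rowPt p i x 0 0 k ≤ v k} := by
  set D := Nat.findGreatest (fun d => ¬ RowFull f θ p i n d) x with hD
  have hDx : D ≤ x := Nat.findGreatest_le x
  refine ⟨x - D, by omega, ?_, ?_⟩
  · rw [Nat.sub_sub_self hDx]
    refine hB.extend_of_not_rowFull hDx hs hrel hB0 hθ hW2 hW ?_
    -- Row `0` is never full, since no cardinality is less than `0`. So the greatest row that is not
    -- full exists.
    exact Nat.findGreatest_spec (P := fun d => ¬ RowFull f θ p i n d) (Nat.zero_le x)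
      (by simp [RowFull])
  · have := card_mul_le_of_fibers (A := A) (i := i) (x := p i) (Ioc D x) (n + 2)
      (fun v => lsum v = s ∧ ∀ k, rowPt p i x 0 0 k ≤ v k) (fun d hd => by
        rw [mem_Ioc] at hd
        have hle : (d : ℤ) ≤ x := by exact_mod_cast hd.2
        have hf := Nat.findGreatest_is_greatest hd.1 hd.2
        refine (large_of_rowFull hs (not_not.1 hf)
          (fun v h1 h2 => hA v h1 fun k => (rowPt_le hle k).trans (h2 k)) (hE d hd.2)).trans ?_
        refine Nat.mul_le_mul_left _ (card_le_card (monotone_filter_right _ fun v _ hv =>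
          ⟨hv.1, hv.2.1, fun k => (rowPt_le hle k).trans (hv.2.2 k)⟩)))
    simpa using this

end

/-! ### Triangles growing from single points of a plane -/

theorem rowPt_diag (p : Lattice3) (i : Fin 3) (d : ℤ) (k : Fin 3) :
    rowPt p i d 0 0 k = p k - if k = i then d else 0 := by
  simp only [rowPt]; split_ifs <;> simp

theorem abs_sub_le_of_lsum {P v : Lattice3} {c : ℤ} (h : lsum v = lsum P)
    (hv : ∀ k, P k - c ≤ v k) (k : Fin 3) : |v k - P k| ≤ 2 * c := by
  have h0 := hv 0
  have h1 := hv 1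
  have h2 := hv 2
  simp only [lsum] at h
  rw [abs_le]
  fin_cases k <;> constructor <;> simp <;> omega

/-- A segment of one point may contain at most `1 / 100` points of `E`, hence none. -/
theorem SparseAt.not_mem {E : Set Lattice3} {C : ℕ} {q v : Lattice3} (h : SparseAt E C q)
    (hv : ∀ k, |v k - q k| ≤ C) : v ∉ E := by
  classical
  intro hvE
  have := h 1 v (Pi.single 0 1) le_rfl ⟨⟨0, by simp⟩, fun k => by
    fin_cases k <;> simp⟩ (fun t ht k => by
      obtain rfl : t = 0 := by omega
      simpa using hv k)
  rw [filter_true_of_mem (fun t ht => by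
    obtain rfl : t = 0 := by simpa using ht
    simpa using hvE)] at this
  simp at this

/-- The sequence of radii of the growing triangles. -/
def seedRad : ℕ → ℕ
  | 0 => 0
  | t + 1 => seedRad t + (seedRad t / 2 + 1)

section
variable {f : Lattice3 → ℝ} {θ B W : ℝ} {s : ℤ} {E : Set Lattice3} {A : Finset Lattice3}

open scoped Classical in
/-- A bound on a triangle around `P` extends to a bigger triangle, unless there are many large
points near `P`. -/
theorem TriBound.grow {P : Lattice3} {a e : ℕ} (he : e = a / 2 + 1) (hs : lsum P = s)
    (hP : SparseAt E 4 P) (hB : TriBound f (fun k => P k - a) s B)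
    (hrel : TriRel f (fun k => P k - (a + 2 * e : ℕ)) s B) (hB0 : 0 ≤ B) (hθ : θ ≤ B)
    (hW2 : 2 ≤ W) (hW : 5 * (a : ℝ) + 5 ≤ W)
    (hA : ∀ v, lsum v = s → (∀ k, P k - (a + 2 * e : ℕ) ≤ v k) → v ∉ E → θ < |f v| → v ∈ A) :
    TriBound f (fun k => P k - (a + e : ℕ)) s (W ^ (39 * e) * B) ∨
      (a + 1) ^ 2 ≤ 2 * #{v ∈ A | lsum v = s ∧ ∀ k, |v k - P k| ≤ 4 * a + 4} := by
  have he1 : 1 ≤ e := by omega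
  have he2 : 2 * e ≤ a + 2 := by omega
  have he2' : 2 * (e : ℝ) ≤ a + 2 := by exact_mod_cast he2
  have hW1 : 1 ≤ W := by linarith
  have step : ∀ (i : Fin 3) (p : Lattice3) (n : ℕ) (B' : ℝ), 3 * a ≤ n → n ≤ 3 * a + 2 * e →
      lsum p + n = s → (∀ k, P k - (a + 2 * e : ℕ) ≤ rowPt p i (2 * e : ℕ) 0 0 k) →
      B ≤ B' → TriBound f p s B' →
      TriBound f (rowPt p i e 0 0) s (W ^ (10 * e + 3) * B') ∨
      (a + 1) ^ 2 ≤ 2 * #{v ∈ A | lsum v = s ∧ ∀ k, |v k - P k| ≤ 4 * a + 4} := by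
    intro i p n B' hn1 hn2 hp hpP hBB hT
    have hn1' : (n : ℝ) ≤ 3 * a + 2 * e := by exact_mod_cast hn2
    have hnear : ∀ v, lsum v = s → (∀ k, rowPt p i (2 * e : ℕ) 0 0 k ≤ v k) →
        ∀ k, |v k - P k| ≤ 4 * a + 4 := fun v hv hv2 k => by
      have := abs_sub_le_of_lsum (hv.trans hs.symm) (fun k => (hpP k).trans (hv2 k)) k
      push_cast at this
      omega
    rcases hT.extend_or_large (E := E) (A := A) (i := i) (e := e) (θ := θ) (W := W) he1 hp
      (hrel.mono hpP hBB) (hB0.trans hBB) (hθ.trans hBB) hW2 (by push_cast; linarith)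
      (fun v h1 h2 => hA v h1 fun k => (hpP k).trans (h2 k)) (fun d hd => by
        have := hP.row p i d (n + d) (n + d + 1) (by omega) (fun t ht k => by
          have := hnear (rowPt p i d (t : ℕ) (n + d - (t : ℕ))) (by rw [lsum_rowPt]; linarith)
            (forall_fin3 i (by simp; omega) (by simp) (by simp; omega)) k
          push_cast
          omega)
        omega) with h | h
    · exact Or.inl h
    · right
      refine le_trans ?_ (h.trans (Nat.mul_le_mul_left _ (card_le_card
        (monotone_filter_right _ fun v _ hv => ⟨hv.1, hnear v hv.1 hv.2⟩))))
      calc (a + 1) ^ 2 ≤ (2 * e) * (a + 1) := by rw [sq]; exact Nat.mul_le_mul_right _ (by omega)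
        _ = e * (2 * (a + 1)) := by ring
        _ ≤ e * (n + 2) := Nat.mul_le_mul_left _ (by omega)
  have hmono : ∀ B', 0 ≤ B' → B' ≤ W ^ (10 * e + 3) * B' := fun B' h =>
    le_mul_of_one_le_left h (one_le_pow₀ hW1)
  set p0 : Lattice3 := fun k => P k - a with hp0
  have l0 : lsum p0 = s - 3 * a := by rw [← hs]; simp [lsum, hp0]; ring
  rcases step 0 p0 (3 * a) B le_rfl (by omega) (by rw [l0]; push_cast; ring)
    (fun k => by rw [rowPt_diag]; fin_cases k <;> simp [hp0] <;> omega) le_rfl hB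
    with h1 | h1
  swap; · exact Or.inr h1
  set p1 := rowPt p0 0 e 0 0 with hp1
  have l1 : lsum p1 = s - 3 * a - e := by rw [hp1, lsum_rowPt, l0]; ring
  rcases step 1 p1 (3 * a + e) _ (by omega) (by omega) (by rw [l1]; push_cast; ring)
    (fun k => by rw [rowPt_diag, hp1, rowPt_diag]; fin_cases k <;> simp [hp0] <;> omega)
    (hmono B hB0) h1 with h2 | h2
  swap; · exact Or.inr h2
  set p2 := rowPt p1 1 e 0 0 with hp2
  have l2 : lsum p2 = s - 3 * a - e - e := by rw [hp2, lsum_rowPt, l1]; ring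
  rcases step 2 p2 (3 * a + 2 * e) _ (by omega) (by omega) (by rw [l2]; push_cast; ring)
    (fun k => by
      rw [rowPt_diag, hp2, rowPt_diag, hp1, rowPt_diag]; fin_cases k <;> simp [hp0] <;> omega)
    ((hmono B hB0).trans (hmono _ (by positivity))) h2 with h3 | h3
  swap; · exact Or.inr h3
  left
  have c3 : ∀ k, rowPt p2 2 e 0 0 k ≤ P k - (a + e : ℕ) := fun k => by
    rw [rowPt_diag, hp2, rowPt_diag, hp1, rowPt_diag]; fin_cases k <;> simp [hp0] <;> omega
  refine h3.mono c3 ?_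
  -- Three sides cost `3 (10 e + 3) ≤ 39 e` powers of `W`, because `e ≥ 1`.
  rw [← mul_assoc, ← mul_assoc, ← pow_add, ← pow_add]
  exact mul_le_mul_of_nonneg_right (pow_le_pow_right₀ hW1 (by omega)) hB0

/-- The bound is quadratic rather than cubic because two coordinates determine a point of a level
plane. It matches the number of large points needed to stop a triangle, so each scale stops only
`O(#A)` seeds. -/
theorem card_level_near_le (S : Finset Lattice3) (hS : ∀ P ∈ S, lsum P = s) (v : Lattice3) (c : ℕ)
    (h : ∀ P ∈ S, ∀ k, |v k - P k| ≤ c) : #S ≤ (2 * c + 1) ^ 2 := by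
  have : #S ≤ #(Icc (v 0 - c) (v 0 + c) ×ˢ Icc (v 1 - c) (v 1 + c)) := by
    refine card_le_card_of_injOn (fun P => (P 0, P 1)) (fun P hP => ?_) (fun P hP Q hQ hPQ => ?_)
    · have h0 := abs_le.1 (h P hP 0)
      have h1 := abs_le.1 (h P hP 1)
      simp only [mem_coe, mem_product, mem_Icc]
      omega
    · simp only [Prod.mk.injEq] at hPQ
      have h1 := hS P hP
      have h2 := hS Q hQ
      simp only [lsum] at h1 h2
      exact lattice_ext 0 hPQ.1 hPQ.2 (by simp; omega)
  refine this.trans (le_of_eq ?_)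
  rw [card_product, Int.card_Icc, Int.card_Icc, sq]
  congr 1 <;> omega

open scoped Classical in
/-- If there are few large points then one of the seeds grows to a triangle of size
`3 * seedRad τ`. -/
theorem exists_seed {p : Lattice3} {S : Finset Lattice3} {τ : ℕ} (hS : ∀ P ∈ S, lsum P = s)
    (hSp : ∀ P ∈ S, ∀ k, p k + 2 * seedRad τ ≤ P k) (hSE : ∀ P ∈ S, SparseAt E 4 P)
    (hrel : TriRel f p s B) (hB0 : 0 ≤ B) (hθ : θ ≤ B) (hW2 : 2 ≤ W)
    (hW : 5 * (seedRad τ : ℝ) + 5 ≤ W)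
    (hA : ∀ v, lsum v = s → (∀ k, p k ≤ v k) → v ∉ E → θ < |f v| → v ∈ A)
    (hcard : (162 * τ + 1) * #A < #S) :
    ∃ P ∈ S, TriBound f (fun k => P k - seedRad τ) s (W ^ (39 * seedRad τ) * B) := by
  by_contra hcon
  push Not at hcon
  have hW1 : 1 ≤ W := by linarith
  have hmono : ∀ t, seedRad t ≤ seedRad (t + 1) := fun t => by simp [seedRad]
  have hmono' : Monotone seedRad := monotone_nat_of_le_succ hmono
  set bl : ℕ → Finset Lattice3 := fun t => {P ∈ S | (seedRad t + 1) ^ 2 ≤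
    2 * #{v ∈ A | lsum v = s ∧ ∀ k, |v k - P k| ≤ 4 * seedRad t + 4}} with hbl
  -- By the contradiction hypothesis no seed reaches the last scale, so every seed is either a large
  -- point itself or is stopped at one of the `τ` scales.
  have hcover : S ⊆ A ∪ (range τ).biUnion bl := by
    intro P hP
    by_contra hno
    simp only [mem_union, mem_biUnion, mem_range, not_or, not_exists, not_and] at hno
    refine hcon P hP ?_
    have : ∀ t ≤ τ, TriBound f (fun k => P k - seedRad t) s (W ^ (39 * seedRad t) * B) := by
      intro t
      induction t with
      | zero =>
        intro _ v hv hPv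
        have hv0 : v = P := by
          have h1 := hS P hP
          have := fun k => hPv k
          simp only [seedRad, Nat.cast_zero, sub_zero] at this
          have h0 := this 0
          have h1' := this 1
          have h2 := this 2
          simp only [lsum] at hv h1
          exact lattice_ext 0 (by omega) (by simp; omega) (by simp; omega)
        have hPE : P ∉ E := (hSE P hP).not_mem (by simp)
        have : ¬ θ < |f P| := fun h => hno.1 (hA P (hS P hP)
          (fun k => by have := hSp P hP k; omega) hPE h)
        rw [hv0]
        simpa [seedRad] using (not_lt.1 this).trans hθ
      | succ t ih =>
        intro ht
        have h1 := ih (by omega)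
        have ha : seedRad (t + 1) ≤ seedRad τ := hmono' ht
        have hstep : seedRad (t + 1) = seedRad t + (seedRad t / 2 + 1) := rfl
        have hle : ∀ k, p k ≤ P k - (seedRad t + 2 * (seedRad t / 2 + 1) : ℕ) := fun k => by
          have := hSp P hP k
          push_cast
          omega
        have hBB : B ≤ W ^ (39 * seedRad t) * B := le_mul_of_one_le_left hB0 (one_le_pow₀ hW1)
        have ha' : (seedRad t : ℝ) ≤ seedRad τ := by exact_mod_cast hmono' (by omega)
        rcases h1.grow (E := E) (A := A) (θ := θ) (W := W) rfl (hS P hP) (hSE P hP)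
          (hrel.mono hle hBB) (hB0.trans hBB) (hθ.trans hBB) hW2 (by linarith)
          (fun v h1 h2 => hA v h1 fun k => (hle k).trans (h2 k)) with h2 | h2
        · rw [hstep]
          refine h2.mono (fun _ => le_rfl) (le_of_eq ?_)
          rw [← mul_assoc, ← pow_add]
          ring_nf
        · exact absurd (mem_filter.2 ⟨hP, h2⟩) (hno.2 t (by omega))
    exact this τ le_rfl
  -- Double counting: a large point is near at most `(8 a + 9)² ≤ 81 (a + 1)²` seeds of the plane,
  -- while a stopped seed has at least `(a + 1)² / 2` large points near it.
  have hbl' : ∀ t, #(bl t) ≤ 162 * #A := by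
    intro t
    set a := seedRad t with ha
    have h1 : ∑ P ∈ bl t, #{v ∈ A | lsum v = s ∧ ∀ k, |v k - P k| ≤ 4 * a + 4} ≤
        #A * (8 * a + 9) ^ 2 := by
      have := sum_card_bipartiteAbove_eq_sum_card_bipartiteBelow (s := bl t) (t := A)
        (fun P v => lsum v = s ∧ ∀ k, |v k - P k| ≤ 4 * a + 4)
      simp only [bipartiteAbove, bipartiteBelow] at this
      rw [this]
      refine (sum_le_card_nsmul A _ ((8 * a + 9) ^ 2) fun v _ => ?_).trans (by simp)
      refine (card_level_near_le (s := s) _ (fun P hP => hS P ?_) v (4 * a + 4)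
        (fun P hP k => ?_)).trans (le_of_eq (by ring))
      · exact (mem_filter.1 (mem_filter.1 hP).1).1
      · have := (mem_filter.1 hP).2.2 k
        push_cast
        exact this
    have h2 : #(bl t) * (a + 1) ^ 2 ≤ 2 * ∑ P ∈ bl t,
        #{v ∈ A | lsum v = s ∧ ∀ k, |v k - P k| ≤ 4 * a + 4} := by
      rw [mul_sum]
      refine (card_nsmul_le_sum (bl t) _ ((a + 1) ^ 2) fun P hP => ?_).trans' (by simp)
      exact (mem_filter.1 hP).2
    have h3 : (8 * a + 9) ^ 2 ≤ 81 * (a + 1) ^ 2 := by nlinarith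
    have h4 : #(bl t) * (a + 1) ^ 2 ≤ 162 * #A * (a + 1) ^ 2 := by
      calc _ ≤ 2 * (#A * (8 * a + 9) ^ 2) := h2.trans (Nat.mul_le_mul_left _ h1)
        _ ≤ 2 * (#A * (81 * (a + 1) ^ 2)) := by gcongr
        _ = _ := by ring
    exact Nat.le_of_mul_le_mul_right h4 (by positivity)
  have h5 := (card_le_card hcover).trans (card_union_le _ _)
  have h6 : #((range τ).biUnion bl) ≤ τ * (162 * #A) :=
    (card_biUnion_le).trans ((sum_le_card_nsmul _ _ _ fun t _ => hbl' t).trans (by simp))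
  nlinarith

end

/-- Two steps multiply the radius by about `9 / 4`, so logarithmically many scales suffice. -/
theorem two_pow_le_seedRad (t : ℕ) : 2 ^ t ≤ seedRad (2 * t) + 1 := by
  induction t with
  | zero => simp
  | succ t ih =>
    have : seedRad (2 * (t + 1)) = seedRad (2 * t) + (seedRad (2 * t) / 2 + 1) +
      ((seedRad (2 * t) + (seedRad (2 * t) / 2 + 1)) / 2 + 1) := rfl
    rw [this, pow_succ]
    omega

theorem exists_seedRad (M : ℕ) (hM : 1 ≤ M) : ∃ τ, τ ≤ 2 * Nat.log 2 M + 2 ∧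
    M ≤ 100 * seedRad τ ∧ 200 * seedRad τ ≤ 3 * M + 200 := by
  have hex : ∃ τ, M ≤ 100 * seedRad τ := ⟨2 * (Nat.log 2 M + 1), by
    have := two_pow_le_seedRad (Nat.log 2 M + 1)
    have := Nat.lt_pow_succ_log_self (b := 2) (by norm_num) M
    simp only [Nat.succ_eq_add_one] at this
    omega⟩
  classical
  refine ⟨Nat.find hex, Nat.find_min' hex ?_, Nat.find_spec hex, ?_⟩
  · have := two_pow_le_seedRad (Nat.log 2 M + 1)
    have := Nat.lt_pow_succ_log_self (b := 2) (by norm_num) M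
    simp only [Nat.succ_eq_add_one] at this
    rw [show 2 * Nat.log 2 M + 2 = 2 * (Nat.log 2 M + 1) by ring]
    omega
  · have h0 : Nat.find hex ≠ 0 := fun h => by
      have := Nat.find_spec hex
      rw [h] at this
      simp [seedRad] at this
      omega
    obtain ⟨t, ht⟩ := Nat.exists_eq_succ_of_ne_zero h0
    have := Nat.find_min hex (m := t) (by omega)
    rw [ht, Nat.succ_eq_add_one, seedRad]
    omega

/-! ### Filling a triangular section of a plane -/

section
variable {f : Lattice3 → ℝ} {θ B W : ℝ} {s : ℤ} {E E₁ : Set Lattice3} {A : Finset Lattice3}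
  {p q : Lattice3} {M C : ℕ}

open scoped Classical in
theorem SparseAt.mono {C : ℕ} (h : SparseAt E₁ C q) (hE : E ⊆ E₁) : SparseAt E C q :=
  fun L b v h1 h2 h3 => (Nat.mul_le_mul_left _ (card_le_card
    (monotone_filter_right _ fun _ _ h => hE h))).trans (h L b v h1 h2 h3)

-- The seeds are taken from a rhombus of `M / 10` rows with `M / 10` points each, at distance `M /
-- 4` from the sides of the triangle. Sparseness of `E₁` removes at most one percent of each row.
open scoped Classical in
theorem exists_many_seeds (hM : 1000 ≤ M) (hs : lsum p + M = s) (hq : SparseAt E₁ C q)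
    (hnear : ∀ v, lsum v = s → (∀ k, p k ≤ v k) → ∀ k, |v k - q k| * 34 ≤ C * M) :
    ∃ S : Finset Lattice3, M ^ 2 ≤ 125 * #S ∧
      ∀ P ∈ S, lsum P = s ∧ P ∉ E₁ ∧ ∀ k, p k + (M / 4 : ℕ) ≤ P k := by
  set pp : Lattice3 := fun k => p k + (M / 4 : ℕ) with hpp
  set L := M / 10 with hL
  have lpp : lsum pp = lsum p + 3 * (M / 4 : ℕ) := by simp [lsum, hpp]; ring
  set F : ℕ → ℕ → Lattice3 := fun x t =>
    rowPt pp 0 (-x) t ((M - 3 * (M / 4 : ℕ) - x : ℤ) - t) with hF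
  have F0 : ∀ x t, F x t 0 = p 0 + (M / 4 : ℕ) + x := fun x t => by
    rw [hF]; simp only; rw [rowPt_zero]; simp [hpp]
  have F1 : ∀ x t, F x t 1 = p 1 + (M / 4 : ℕ) + t := fun x t => rowPt_one pp 0 _ _ _
  have F2 : ∀ x t, F x t 2 = p 2 + (M / 4 : ℕ) + ((M - 3 * (M / 4 : ℕ) - x : ℤ) - t) :=
    fun x t => rowPt_two pp 0 _ _ _
  have hFs : ∀ x t, lsum (F x t) = s := fun x t => by
    rw [hF]; simp only; rw [lsum_rowPt, lpp]; linarith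
  have hFp : ∀ x < L, ∀ t < L, ∀ k, p k + (M / 4 : ℕ) ≤ F x t k := fun x hx t ht =>
    forall_fin3 0 (by rw [F0]; omega) (by rw [zero_add, F1]; omega) (by rw [zero_add, F2]; omega)
  refine ⟨((range L ×ˢ range L).filter fun xt => F xt.1 xt.2 ∉ E₁).image fun xt => F xt.1 xt.2,
    ?_, ?_⟩
  · rw [card_image_of_injOn]
    · have h1 : ∀ x ∈ range L, L - L / 100 ≤ #{t ∈ range L | F x t ∉ E₁} := by
        intro x hx
        rw [mem_range] at hx
        have := hq.row pp 0 (-x) (M - 3 * (M / 4 : ℕ) - x : ℤ) L (by omega) (fun t ht k => by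
          have := hnear (F x t) (hFs x t) (fun k => (by
            have := hFp x hx t ht k
            omega)) k
          simp only [hF] at this
          have hLM : (M : ℤ) ≤ 34 * L := by omega
          nlinarith)
        have h2 := card_filter_add_card_filter_not (s := range L) (fun t => F x t ∈ E₁)
        rw [card_range] at h2
        simp only [hF] at h2 ⊢
        omega
      have h2 : L * (L - L / 100) ≤ #((range L ×ˢ range L).filter fun xt => F xt.1 xt.2 ∉ E₁) := by
        rw [card_filter, sum_product]
        simp only [← card_filter]
        simpa using card_nsmul_le_sum _ _ _ h1
      have h3 : 99 * L ≤ 100 * (L - L / 100) := by omega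
      have h4 : M ≤ 10 * L + 9 := by omega
      have h5 : 100 ≤ L := by omega
      have h6 : 99 * (L * L) ≤ 100 * (L * (L - L / 100)) := by nlinarith
      nlinarith
    · rintro ⟨x, t⟩ _ ⟨x', t'⟩ _ h
      simp only at h
      have h0 := congrFun h 0
      have h1 := congrFun h 1
      rw [F0, F0] at h0
      rw [F1, F1] at h1
      ext <;> simp <;> omega
  · intro P hP
    simp only [mem_image, mem_filter, mem_product, mem_range, Prod.exists] at hP
    obtain ⟨x, t, ⟨⟨hx, ht⟩, hE⟩, rfl⟩ := hP
    exact ⟨hFs x t, hE, hFp x hx t ht⟩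

open scoped Classical in
/-- A function on a triangle with few large points, for which the sums over unit triangles are
small, is bounded on a slightly smaller triangle. -/
theorem TriRel.fill (hM : 1000 ≤ M) (hs : lsum p + M = s) (hrel : TriRel f p s B) (hB0 : 0 ≤ B)
    (hθ : θ ≤ B) (hW : 10 * (M : ℝ) ≤ W) (hE : E ⊆ E₁) (hE₁ : ∀ P, P ∉ E₁ → SparseAt E 4 P)
    (hq : SparseAt E₁ C q)
    (hnear : ∀ v, lsum v = s → (∀ k, p k ≤ v k) → ∀ k, |v k - q k| * 34 ≤ C * M)
    (hA : ∀ v, lsum v = s → (∀ k, p k ≤ v k) → v ∉ E → θ < |f v| → v ∈ A)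
    (hcard : 50000 * (Nat.log 2 M + 1) * #A < M ^ 2) :
    ∃ J : ℕ, J * M ≤ 67 * #A ∧ TriBound f (fun k => p k + J) s (W ^ (17 * M) * B) := by
  have hMR : (1000 : ℝ) ≤ M := by exact_mod_cast hM
  have hW1 : 1 ≤ W := by linarith
  obtain ⟨τ, hτ, hτ1, hτ2⟩ := exists_seedRad M (by omega)
  obtain ⟨S, hSc, hS⟩ := exists_many_seeds hM hs hq hnear
  set a := seedRad τ with ha
  have haR : 200 * (a : ℝ) ≤ 3 * M + 200 := by exact_mod_cast hτ2
  obtain ⟨P, hP, hT⟩ := exists_seed (f := f) (θ := θ) (B := B) (W := W) (s := s) (E := E) (A := A)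
    (p := p) (S := S) (τ := τ) (fun P hP => (hS P hP).1)
    (fun P hP k => by have := (hS P hP).2.2 k; omega) (fun P hP => hE₁ P (hS P hP).2.1)
    hrel hB0 hθ (by linarith) (by linarith) hA (by nlinarith)
  obtain ⟨hPs, -, hPp⟩ := hS P hP
  have hPp' : ∀ k, p k + a ≤ P k := fun k => by have := hPp k; omega
  have hmono : ∀ B', 0 ≤ B' → B' ≤ W ^ (5 * M + 3) * B' := fun B' h =>
    le_mul_of_one_le_left h (one_le_pow₀ hW1)
  have step : ∀ (i : Fin 3) (p' : Lattice3) (n x : ℕ) (B' : ℝ), 3 * a ≤ n → n + x ≤ M →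
      lsum p' + n = s → (∀ k, p k ≤ rowPt p' i x 0 0 k) → B ≤ B' → TriBound f p' s B' →
      ∃ j ≤ x, TriBound f (rowPt p' i ((x - j : ℕ) : ℤ) 0 0) s (W ^ (5 * M + 3) * B') ∧
        j * M ≤ 67 * #A := by
    intro i p' n x B' hn hx hp' hpp hBB hT
    have hxR : (n + x : ℝ) ≤ M := by exact_mod_cast hx
    obtain ⟨j, hj, h1, h2⟩ := hT.extend_max (E := E) (A := A) (i := i) (θ := θ) (W := W) x hp'
      (hrel.mono hpp hBB) (hB0.trans hBB) (hθ.trans hBB) (by linarith) (by linarith)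
      (fun v h1 h2 => hA v h1 fun k => (hpp k).trans (h2 k)) (fun d hd => by
        have := (hq.mono hE).row p' i d (n + d) (n + d + 1) (by omega) (fun t ht k => by
          have := hnear (rowPt p' i d (t : ℕ) (n + d - (t : ℕ))) (by rw [lsum_rowPt]; linarith)
            (fun k => (hpp k).trans (forall_fin3
              (P := fun k => rowPt p' i x 0 0 k ≤ rowPt p' i d (t : ℕ) (n + d - (t : ℕ)) k)
              i (by simp; omega) (by simp) (by simp; omega) k)) k
          -- The seed triangle has side at least `3 M / 100`, so all rows considered have more than
          -- `M / 34` points. This is where the factor `34` in the hypothesis on distances to `q`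
          -- comes from.
          have hLM : (M : ℤ) ≤ 34 * (n + d + 1 : ℕ) := by push_cast; omega
          nlinarith)
        omega)
    refine ⟨j, hj, h1.mono (fun _ => le_rfl) ?_, ?_⟩
    · exact mul_le_mul_of_nonneg_right (pow_le_pow_right₀ hW1 (by omega)) (hB0.trans hBB)
    -- With `n ≥ 3 M / 100` this gives `j M ≤ (200 / 3) #A`, hence the constant `67`.
    · have h3 : j * (n + 2) ≤ 2 * #A := h2.trans (Nat.mul_le_mul_left _ (card_filter_le _ _))
      have h4 : 3 * M ≤ 100 * (n + 2) := by omega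
      have h5 : 3 * (j * M) ≤ 200 * #A := by nlinarith
      omega
  have hPsum := hPs
  rw [lsum] at hPsum
  have hps := hs
  rw [lsum] at hps
  set p0 : Lattice3 := fun k => P k - a with hp0
  have l0 : lsum p0 = s - 3 * a := by rw [← hPs]; simp [lsum, hp0]; ring
  obtain ⟨x0, hx0⟩ := Int.eq_ofNat_of_zero_le (a := P 0 - a - p 0) (by have := hPp' 0; omega)
  obtain ⟨x1, hx1⟩ := Int.eq_ofNat_of_zero_le (a := P 1 - a - p 1) (by have := hPp' 1; omega)
  obtain ⟨x2, hx2⟩ := Int.eq_ofNat_of_zero_le (a := P 2 - a - p 2) (by have := hPp' 2; omega)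
  have hB1 : B ≤ W ^ (39 * a) * B := le_mul_of_one_le_left hB0 (one_le_pow₀ hW1)
  have hq0 := hPp' 0
  have hq1 := hPp' 1
  have hq2 := hPp' 2
  obtain ⟨j0, hj0, T1, c0⟩ := step 0 p0 (3 * a) x0 _ le_rfl (by omega) (by rw [l0]; push_cast; ring)
    (fun k => by rw [rowPt_diag]; fin_cases k <;> simp [hp0] <;> omega) hB1 hT
  set p1 := rowPt p0 0 ((x0 - j0 : ℕ) : ℤ) 0 0 with hp1
  have l1 : lsum p1 = s - 3 * a - ((x0 - j0 : ℕ) : ℤ) := by rw [hp1, lsum_rowPt, l0]; ring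
  obtain ⟨j1, hj1, T2, c1⟩ := step 1 p1 (3 * a + (x0 - j0)) x1 _ (by omega) (by omega)
    (by rw [l1]; push_cast; ring)
    (fun k => by rw [rowPt_diag, hp1, rowPt_diag]; fin_cases k <;> simp [hp0] <;> omega)
    (hB1.trans (hmono _ (by positivity))) T1
  set p2 := rowPt p1 1 ((x1 - j1 : ℕ) : ℤ) 0 0 with hp2
  have l2 : lsum p2 = s - 3 * a - ((x0 - j0 : ℕ) : ℤ) - ((x1 - j1 : ℕ) : ℤ) := by
    rw [hp2, lsum_rowPt, l1]; ring
  obtain ⟨j2, hj2, T3, c2⟩ := step 2 p2 (3 * a + (x0 - j0) + (x1 - j1)) x2 _ (by omega) (by omega)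
    (by rw [l2]; push_cast; ring)
    (fun k => by
      rw [rowPt_diag, hp2, rowPt_diag, hp1, rowPt_diag]; fin_cases k <;> simp [hp0] <;> omega)
    ((hB1.trans (hmono _ (by positivity))).trans (hmono _ (by positivity))) T2
  -- The three sides fall short by `j0`, `j1`, `j2` rows. The largest of these is cut off on every
  -- side to return to a triangle with corner `p` plus a constant.
  refine ⟨max j0 (max j1 j2), ?_, T3.mono (fun k => ?_) ?_⟩
  · rcases le_total j0 (max j1 j2) with h | h
    · rw [max_eq_right h]
      rcases le_total j1 j2 with h | h
      · rwa [max_eq_right h]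
      · rwa [max_eq_left h]
    · rwa [max_eq_left h]
  · rw [rowPt_diag, hp2, rowPt_diag, hp1, rowPt_diag]; fin_cases k <;> simp [hp0] <;> omega
  · rw [← mul_assoc, ← mul_assoc, ← mul_assoc, ← pow_add, ← pow_add, ← pow_add]
    exact mul_le_mul_of_nonneg_right (pow_le_pow_right₀ hW1 (by omega)) hB0

end

/-! ### Climbing through a tetrahedron, plane by plane -/

/-- The sum of `f` over the six neighbours of `b`. -/
def nbrSum (f : Lattice3 → ℝ) (b : Lattice3) : ℝ :=
  ∑ i : Fin 3, (f (b + Pi.single i 1) + f (b - Pi.single i 1))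

theorem lsum_sub_single (b : Lattice3) (i : Fin 3) (c : ℤ) :
    lsum (b - Pi.single i c) = lsum b - c := by
  rw [lsum_eq _ i, lsum_eq b i]; simp; ring

theorem le_sub_single (b : Lattice3) (i k : Fin 3) :
    b k - 1 ≤ (b - Pi.single i 1 : Lattice3) k := by
  simp only [Pi.sub_apply, Pi.single_apply]; split_ifs <;> omega

section
variable {f : Lattice3 → ℝ} {θ B W κ : ℝ} {E E₁ : Set Lattice3} {A : Finset Lattice3}
  {p q : Lattice3} {C : ℕ}

/-- Of the six neighbours of a point in plane `s`, three form a unit triangle in plane `s + 1` and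
the other three lie in plane `s - 1`. -/
theorem TriRel.of_triBound {s : ℤ} (hf : ∀ b, lsum b = s → (∀ k, p k ≤ b k) →
      |nbrSum f b| ≤ κ * |f b|) (hκ : 0 ≤ κ)
    (h1 : TriBound f p s B) (h0 : TriBound f (fun k => p k - 1) (s - 1) B) :
    TriRel f p (s + 1) ((κ + 3) * B) := by
  intro b hb hpb
  have hb' : lsum b = s := by linarith
  have h2 := hf b hb' hpb
  rw [nbrSum, sum_add_distrib] at h2
  have h3 : |∑ i : Fin 3, f (b - Pi.single i 1)| ≤ 3 * B := by
    refine (abs_sum_le_sum_abs _ _).trans ((sum_le_card_nsmul univ _ B fun i _ => ?_).trans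
      (by simp))
    exact h0 _ (by rw [lsum_sub_single, hb']) fun k =>
      (sub_le_sub_right (hpb k) 1).trans (le_sub_single b i k)
  have h4 : κ * |f b| ≤ κ * B := mul_le_mul_of_nonneg_left (h1 b hb' hpb) hκ
  have h5 := abs_add_le (∑ i : Fin 3, f (b + Pi.single i 1) + ∑ i : Fin 3, f (b - Pi.single i 1))
    (-∑ i : Fin 3, f (b - Pi.single i 1))
  rw [abs_neg, add_neg_cancel_right] at h5
  linarith

open scoped Classical in
/-- A bound on two consecutive triangles extends to the tetrahedron above them, unless there are
many large points. -/
theorem tetrahedron_fill {s H μ J₀ : ℕ} (hμ : 1000 ≤ μ) (hsize : 2 * μ + H + 1 + 6 * J₀ ≤ 2 * s)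
    (hκ : 0 ≤ κ) (hκW : κ + 3 ≤ W) (hsW : 10 * (s : ℝ) ≤ W) (hB0 : 0 ≤ B) (hθ : θ ≤ B)
    (hf : ∀ b, lsum b ≤ lsum p + s + H → (∀ k, p k ≤ b k) → |nbrSum f b| ≤ κ * |f b|)
    (h0 : TriBound f p (lsum p + s) B) (h1 : TriBound f p (lsum p + s + 1) B)
    (hE : E ⊆ E₁) (hE₁ : ∀ P, P ∉ E₁ → SparseAt E 4 P) (hq : SparseAt E₁ C q)
    (hnear : ∀ v, lsum v ≤ lsum p + s + H + 1 → (∀ k, p k ≤ v k) → ∀ k, |v k - q k| * 34 ≤ C * μ)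
    (hA : ∀ v, lsum v ≤ lsum p + s + H + 1 → (∀ k, p k ≤ v k) → v ∉ E → θ < |f v| → v ∈ A)
    (hcard : 50000 * (Nat.log 2 s + 1) * #A < μ ^ 2) (hcard' : 67 * #A ≤ J₀ * μ) :
    ∀ h ≤ H, TriBound f (fun k => p k + (h / 2 + J₀ : ℕ)) (lsum p + s + h)
      (W ^ ((17 * s + 1) * H) * B) := by
  have hW1 : 1 ≤ W := by linarith
  set X := W ^ (17 * s + 1) with hX
  have hX1 : 1 ≤ X := one_le_pow₀ hW1
  -- The cut-off `J` accumulates over the planes, but is charged to large points in different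
  -- planes, so it never exceeds `J₀`. Apart from `J`, the corner moves by one every two planes,
  -- because the relation at height `h + 2` needs the plane two below with margin one.
  have claim : ∀ h ≤ H, ∃ J : ℕ, J * μ ≤ 67 * #{v ∈ A | lsum v ≤ lsum p + s + h + 1} ∧
      TriBound f (fun k => p k + (h / 2 + J : ℕ)) (lsum p + s + h) (X ^ h * B) ∧
      TriBound f (fun k => p k + ((h + 1) / 2 + J : ℕ)) (lsum p + s + h + 1) (X ^ h * B) := by
    intro h
    induction h with
    | zero =>
      intro _
      exact ⟨0, by simp, by simpa using h0, by simpa using h1⟩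
    | succ h ih =>
      intro hh
      obtain ⟨J, hJ, T0, T1⟩ := ih (by omega)
      have hJ0 : J ≤ J₀ := by
        have := hJ.trans ((Nat.mul_le_mul_left 67 (card_filter_le _ _)).trans hcard')
        exact Nat.le_of_mul_le_mul_right this (by omega)
      set p' : Lattice3 := fun k => p k + ((h + 2) / 2 + J : ℕ) with hp'
      have lp' : lsum p' = lsum p + 3 * ((h + 2) / 2 + J : ℕ) := by simp [lsum, hp']; ring
      obtain ⟨M, hM⟩ : ∃ M : ℕ, M + 3 * ((h + 2) / 2 + J) = s + h + 2 :=
        ⟨s + h + 2 - 3 * ((h + 2) / 2 + J), by omega⟩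
      have hμM : μ ≤ M := by omega
      have hMs : M ≤ s := by omega
      have hMsR : (M : ℝ) ≤ s := by exact_mod_cast hMs
      have hpp : ∀ k, p k ≤ p' k := fun k => by simp only [hp']; omega
      -- The section of side `M` has `μ ≤ M ≤ s`: the lower bound is exactly what `hsize` and `J ≤
      -- J₀` provide.
      have hXB : B ≤ X ^ h * B := le_mul_of_one_le_left hB0 (one_le_pow₀ hX1)
      have hXB0 : 0 ≤ X ^ h * B := hB0.trans hXB
      have hrel : TriRel f p' (lsum p + s + h + 1 + 1) ((κ + 3) * (X ^ h * B)) := by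
        have T0' : TriBound f (fun k => p' k - 1) (lsum p + s + h + 1 - 1) (X ^ h * B) := by
          rw [add_sub_cancel_right]
          exact T0.mono (fun k => by simp only [hp']; omega) le_rfl
        exact TriRel.of_triBound (fun b hb hpb => hf b (by push_cast at *; omega)
          fun k => (hpp k).trans (hpb k)) hκ
          (T1.mono (fun k => by simp only [hp']; omega) le_rfl) T0'
      have hκB : X ^ h * B ≤ (κ + 3) * (X ^ h * B) := le_mul_of_one_le_left hXB0 (by linarith)
      have hlev : lsum p + s + h + 1 + 1 ≤ lsum p + s + H + 1 := by push_cast at *; omega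
      set A' := {v ∈ A | lsum v = lsum p + s + h + 1 + 1} with hA'
      have hA'A : #A' ≤ #A := card_filter_le _ _
      obtain ⟨J', hJ', T2⟩ := hrel.fill (θ := θ) (W := W) (E := E) (E₁ := E₁) (A := A') (q := q)
        (C := C) (M := M)
        (by omega) (by rw [lp']; push_cast; omega) (hXB0.trans hκB) (hθ.trans (hXB.trans hκB))
        (by linarith) hE hE₁ hq
        (fun v hv hpv k => (hnear v (by omega) (fun k => (hpp k).trans (hpv k)) k).trans
          (by gcongr))
        (fun v hv hpv hvE hvθ => mem_filter.2
          ⟨hA v (by omega) (fun k => (hpp k).trans (hpv k)) hvE hvθ, hv⟩)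
        (lt_of_le_of_lt (by gcongr) (hcard.trans_le (Nat.pow_le_pow_left hμM 2)))
      have e1 : lsum p + s + (h + 1 : ℕ) = lsum p + s + h + 1 := by push_cast; ring
      refine ⟨J + J', ?_, ?_, ?_⟩ <;> simp only [e1]
      · have h3 : #{v ∈ A | lsum v ≤ lsum p + s + h + 1} + #A' ≤
            #{v ∈ A | lsum v ≤ lsum p + s + h + 1 + 1} := by
          rw [← card_union_of_disjoint]
          · refine card_le_card fun v hv => ?_
            simp only [mem_union, mem_filter, hA'] at hv ⊢
            rcases hv with hv | hv
            · exact ⟨hv.1, by omega⟩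
            · exact ⟨hv.1, by omega⟩
          · rw [disjoint_left]
            intro v hv hv'
            simp only [mem_filter, hA'] at hv hv'
            omega
        have h4 : J' * μ ≤ J' * M := Nat.mul_le_mul_left _ hμM
        nlinarith
      · refine T1.mono (fun k => by push_cast; omega) ?_
        rw [pow_succ]
        nlinarith
      · refine T2.mono (fun k => by simp only [hp']; push_cast; omega) ?_
        rw [← mul_assoc, ← mul_assoc, pow_succ]
        refine mul_le_mul_of_nonneg_right ?_ hB0
        rw [mul_comm _ X]
        refine mul_le_mul_of_nonneg_right ?_ (by positivity)
        rw [hX, pow_succ]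
        exact mul_le_mul (pow_le_pow_right₀ hW1 (by omega)) hκW (by linarith) (by positivity)
  intro h hh
  obtain ⟨J, hJ, T0, -⟩ := claim h hh
  have hJ0 : J ≤ J₀ := by
    have := hJ.trans ((Nat.mul_le_mul_left 67 (card_filter_le _ _)).trans hcard')
    exact Nat.le_of_mul_le_mul_right this (by omega)
  refine T0.mono (fun k => by push_cast; omega) ?_
  rw [pow_mul]
  exact mul_le_mul_of_nonneg_right (pow_le_pow_right₀ hX1 hh) hB0

end

/-! ### Enlarging cubes -/

/-- `|f| ≤ B` on the cube of radius `r` around `q`. -/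
def CubeBound (f : Lattice3 → ℝ) (q : Lattice3) (r : ℕ) (B : ℝ) : Prop :=
  ∀ x, (∀ k, |x k - q k| ≤ r) → |f x| ≤ B

/-- The map `x ↦ q + σ x`. -/
def signedShift (q σ x : Lattice3) : Lattice3 := fun k => q k + σ k * x k

section
variable {q σ : Lattice3}

theorem signedShift_add_single (x : Lattice3) (i : Fin 3) (c : ℤ) :
    signedShift q σ (x + Pi.single i c) = signedShift q σ x + Pi.single i (σ i * c) := by
  ext k
  by_cases h : k = i
  · subst h; simp [signedShift]; ring
  · simp [signedShift, h]

theorem nbrSum_signedShift (f : Lattice3 → ℝ) (hσ : ∀ k, σ k = 1 ∨ σ k = -1) (b : Lattice3) :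
    nbrSum (fun x => f (signedShift q σ x)) b = nbrSum f (signedShift q σ b) := by
  unfold nbrSum
  refine sum_congr rfl fun i _ => ?_
  simp only [sub_eq_add_neg, ← Pi.single_neg, signedShift_add_single]
  rcases hσ i with h | h <;> rw [h] <;> simp [add_comm]

-- Reflections preserve sparseness because segments are allowed in every direction with coordinates
-- in `{-1, 0, 1}`, not only in those of the rows `e_{i+1} - e_{i+2}`.
open scoped Classical in
theorem SparseAt.preimage_signedShift {E : Set Lattice3} {C : ℕ} {x : Lattice3}
    (hσ : ∀ k, σ k = 1 ∨ σ k = -1) (h : SparseAt E C (signedShift q σ x)) :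
    SparseAt (signedShift q σ ⁻¹' E) C x := by
  intro L b v hL hv hb
  have habs : ∀ k (y : ℤ), |σ k * y| = |y| := fun k y => by
    rcases hσ k with h | h <;> rw [h] <;> simp
  have := h L (signedShift q σ b) (fun k => σ k * v k) hL ⟨?_, fun k => by
    rw [habs]; exact hv.2 k⟩ (fun t ht k => ?_)
  · have e : ∀ t : ℕ, (fun k => b k + (t : ℕ) * v k) ∈ signedShift q σ ⁻¹' E ↔
        (fun k => signedShift q σ b k + (t : ℕ) * (σ k * v k)) ∈ E := fun t => by
      rw [Set.mem_preimage, show signedShift q σ (fun k => b k + (t : ℕ) * v k) =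
        fun k => signedShift q σ b k + (t : ℕ) * (σ k * v k) by
          ext k; simp only [signedShift]; ring]
    simpa only [e] using this
  · obtain ⟨k, hk⟩ := hv.1
    refine ⟨k, ?_⟩
    rcases hσ k with h | h <;> simpa [h] using hk
  · rw [show signedShift q σ b k + t * (σ k * v k) - signedShift q σ x k =
      σ k * (b k + t * v k - x k) by simp only [signedShift]; ring, habs]
    exact hb t ht k

end

section
variable {f : Lattice3 → ℝ} {θ B W κ : ℝ} {E E₁ : Set Lattice3} {A : Finset Lattice3}
  {q : Lattice3}

theorem abs_le_of_nbrSum {c : Lattice3} {Z : ℝ} (i : Fin 3) (hκ : 0 ≤ κ)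
    (hc : |nbrSum f c| ≤ κ * |f c|) (h : |f c| ≤ Z)
    (h1 : |f (c + Pi.single (i + 1) 1)| ≤ Z) (h1' : |f (c - Pi.single (i + 1) 1)| ≤ Z)
    (h2 : |f (c + Pi.single (i + 2) 1)| ≤ Z) (h2' : |f (c - Pi.single (i + 2) 1)| ≤ Z) :
    (|f (c - Pi.single i 1)| ≤ Z → |f (c + Pi.single i 1)| ≤ (κ + 5) * Z) ∧
    (|f (c + Pi.single i 1)| ≤ Z → |f (c - Pi.single i 1)| ≤ (κ + 5) * Z) := by
  rw [nbrSum, sum_fin3 _ i] at hc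
  have h3 : κ * |f c| ≤ κ * Z := mul_le_mul_of_nonneg_left h hκ
  have h4 := hc.trans h3
  clear hc h3 h
  constructor
  · intro h
    rw [abs_le] at *
    constructor <;> linarith [h.1, h.2, h1.1, h1.2, h1'.1, h1'.2, h2.1, h2.2, h2'.1, h2'.2, h4.1, h4.2]
  · intro h
    rw [abs_le] at *
    constructor <;> linarith [h.1, h.2, h1.1, h1.2, h1'.1, h1'.2, h2.1, h2.2, h2'.1, h2'.2, h4.1, h4.2]

/-- The equation at the point just below determines the value one layer further out over a face of
the cube. Each layer is narrower by one on all sides, so pyramids are built on the faces. -/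
theorem CubeBound.pyramid {r : ℕ} (hB : CubeBound f q r B) (hκ : 0 ≤ κ) (hB0 : 0 ≤ B)
    (hf : ∀ b, (∀ k, |b k - q k| ≤ 2 * r) → |nbrSum f b| ≤ κ * |f b|) (h : ℕ) (hr : h ≤ r) :
    ∀ (x : Lattice3) (i : Fin 3), |x i - q i| ≤ r + h → |x (i + 1) - q (i + 1)| ≤ r - h →
      |x (i + 2) - q (i + 2)| ≤ r - h → |f x| ≤ (κ + 5) ^ h * B := by
  induction h with
  | zero =>
    intro x i h0 h1 h2
    simpa using hB x (forall_fin3 i (by simpa using h0) (by simpa using h1) (by simpa using h2))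
  | succ h ih =>
    intro x i h0 h1 h2
    have ih' := ih (by omega)
    push_cast at h0 h1 h2
    have hZ0 : 0 ≤ (κ + 5) ^ h * B := by positivity
    have hZ : (κ + 5) ^ h * B ≤ (κ + 5) ^ (h + 1) * B := by
      rw [pow_succ]; nlinarith
    by_cases hx : |x i - q i| ≤ r + h
    · exact (ih' x i hx (by omega) (by omega)).trans hZ
    rw [pow_succ, mul_comm _ (κ + 5), mul_assoc]
    rw [abs_le] at h0 h1 h2 hx
    rcases le_or_gt 0 (x i - q i) with hs | hs
    · set c := x - Pi.single i 1 with hc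
      have hxc : x = c + Pi.single i 1 := by rw [hc]; simp
      have c0 : c i = x i - 1 := by simp [hc]
      have c1 : c (i + 1) = x (i + 1) := by simp [hc]
      have c2 : c (i + 2) = x (i + 2) := by simp [hc]
      rw [hxc]
      refine (abs_le_of_nbrSum i hκ (hf c (forall_fin3 i ?_ ?_ ?_)) ?_ ?_ ?_ ?_ ?_).1 ?_
      · rw [c0, abs_le]; omega
      · rw [c1, abs_le]; omega
      · rw [c2, abs_le]; omega
      all_goals
        refine ih' _ i ?_ ?_ ?_ <;> rw [abs_le] <;>
          simp only [Pi.add_apply, Pi.sub_apply, c0, c1, c2, Pi.single_eq_same, Pi.single_apply,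
            fin3_ne1, fin3_ne2, fin3_ne3, fin3_ne1', fin3_ne2', fin3_ne3', if_false] <;> omega
    · set c := x + Pi.single i 1 with hc
      have hxc : x = c - Pi.single i 1 := by rw [hc]; simp
      have c0 : c i = x i + 1 := by simp [hc]
      have c1 : c (i + 1) = x (i + 1) := by simp [hc]
      have c2 : c (i + 2) = x (i + 2) := by simp [hc]
      rw [hxc]
      refine (abs_le_of_nbrSum i hκ (hf c (forall_fin3 i ?_ ?_ ?_)) ?_ ?_ ?_ ?_ ?_).2 ?_
      · rw [c0, abs_le]; omega
      · rw [c1, abs_le]; omega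
      · rw [c2, abs_le]; omega
      all_goals
        refine ih' _ i ?_ ?_ ?_ <;> rw [abs_le] <;>
          simp only [Pi.add_apply, Pi.sub_apply, c0, c1, c2, Pi.single_eq_same, Pi.single_apply,
            fin3_ne1, fin3_ne2, fin3_ne3, fin3_ne1', fin3_ne2', fin3_ne3', if_false] <;> omega

/-- A bound on a cube extends to the rhombic dodecahedron spanned by the cube. -/
theorem CubeBound.dodecahedron {r : ℕ} (hB : CubeBound f q r B) (hκ : 0 ≤ κ) (hB0 : 0 ≤ B)
    (hf : ∀ b, (∀ k, |b k - q k| ≤ 2 * r) → |nbrSum f b| ≤ κ * |f b|) (x : Lattice3)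
    (hx : ∀ i j, i ≠ j → |x i - q i| + |x j - q j| ≤ 2 * r) : |f x| ≤ (κ + 5) ^ r * B := by
  have h1 : (1 : ℝ) ≤ κ + 5 := by linarith
  by_cases hc : ∀ k, |x k - q k| ≤ r
  · exact (hB x hc).trans (le_mul_of_one_le_left hB0 (one_le_pow₀ h1))
  · push Not at hc
    obtain ⟨i, hi⟩ := hc
    have a1 := hx i (i + 1) (by simp)
    have a2 := hx i (i + 2) (by simp)
    have p1 := abs_nonneg (x (i + 1) - q (i + 1))
    have p2 := abs_nonneg (x (i + 2) - q (i + 2))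
    obtain ⟨h, hh⟩ := Int.eq_ofNat_of_zero_le (a := |x i - q i| - r) (by omega)
    refine (hB.pyramid hκ hB0 hf h (by omega) x i (by omega) (by omega) (by omega)).trans ?_
    exact mul_le_mul_of_nonneg_right (pow_le_pow_right₀ h1 (by omega)) hB0

open scoped Classical in
/-- A bound on a cube extends to a bigger cube, unless there are many large points. -/
theorem CubeBound.enlarge {g : ℕ} (hg : 1000 ≤ g) (hκ : 0 ≤ κ) (hκW : κ + 5 ≤ W)
    (hgW : 50 * (g : ℝ) ≤ W) (hB0 : 0 ≤ B) (hθ : θ ≤ B)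
    (hf : ∀ b, (∀ k, |b k - q k| ≤ 20 * g) → |nbrSum f b| ≤ κ * |f b|)
    (hB : CubeBound f q (10 * g) B) (hE : E ⊆ E₁) (hE₁ : ∀ P, P ∉ E₁ → SparseAt E 4 P)
    (hq : SparseAt E₁ 1000 q)
    (hA : ∀ v, (∀ k, |v k - q k| ≤ 20 * g) → v ∉ E → θ < |f v| → v ∈ A)
    (hcard : 50000 * (Nat.log 2 (5 * g) + 1) * #A < g ^ 2) :
    CubeBound f q (11 * g) (W ^ (600 * g ^ 2) * B) := by
  intro x hx
  have hW1 : 1 ≤ W := by linarith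
  -- A reflection about `q` moves the target point into the positive octant, with coordinates `a`.
  set σ : Lattice3 := fun k => if 0 ≤ x k - q k then 1 else -1 with hσdef
  have hσ : ∀ k, σ k = 1 ∨ σ k = -1 := fun k => by
    simp only [hσdef]; split_ifs <;> simp
  set a : Lattice3 := fun k => |x k - q k| with ha
  have hxa : signedShift q σ a = x := by
    ext k
    simp only [signedShift, ha, hσdef]
    split_ifs with h
    · rw [abs_of_nonneg h]; ring
    · rw [abs_of_neg (by omega)]; ring
  have hσσ : ∀ k, σ k * σ k = 1 := fun k => by rcases hσ k with h | h <;> rw [h] <;> rfl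
  have hσabs : ∀ v k, |signedShift q σ v k - q k| = |v k| := fun v k => by
    simp only [signedShift, add_sub_cancel_left]
    rcases hσ k with h | h <;> rw [h] <;> simp
  -- The tetrahedron starts at level `lsum p + 5 g` and `a` is `7 g` planes higher. The corner there
  -- is `p + 7 g / 2 + (g - 1) / 6 ≤ p + 4 g = a`, so `a` is reached, and `2 g + 7 g + 1 + 6 J₀ ≤ 10
  -- g` is the size condition for `J₀ = (g - 1) / 6`.
  set p : Lattice3 := fun k => a k - 4 * g with hp
  have ha0 : ∀ k, 0 ≤ a k := fun k => abs_nonneg _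
  have ha1 : ∀ k, a k ≤ 11 * g := fun k => by have := hx k; push_cast at this; exact this
  have hpa : ∀ k, p k = a k - 4 * g := fun k => rfl
  have hlp : lsum a = lsum p + 12 * g := by simp only [lsum, hp]; ring
  have hbox : ∀ v, lsum v ≤ lsum p + (5 * g : ℕ) + (7 * g : ℕ) + 1 → (∀ k, p k ≤ v k) →
      ∀ k, |v k| ≤ 20 * g := fun v hv hpv => by
    push_cast at hv
    rw [lsum, lsum] at hv
    have b0 := hpv 0
    have b1 := hpv 1
    have b2 := hpv 2
    have c0 := hpa 0
    have c1 := hpa 1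
    have c2 := hpa 2
    have d0 := ha0 0
    have d1 := ha0 1
    have d2 := ha0 2
    have e0 := ha1 0
    have e1 := ha1 1
    have e2 := ha1 2
    exact Fin.forall_fin_succ.2 ⟨by rw [abs_le]; omega, Fin.forall_fin_two.2
      ⟨by change |v 1| ≤ _; rw [abs_le]; omega, by change |v 2| ≤ _; rw [abs_le]; omega⟩⟩
  -- On the two base planes `v_i + v_j ≤ p_i + p_j + 5 g + 1 ≤ 19 g + 1`, so the base lies in the
  -- rhombic dodecahedron of the cube of radius `10 g`.
  have hbase : ∀ c : ℤ, c ≤ 1 → 0 ≤ c →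
      TriBound (fun v => f (signedShift q σ v)) p (lsum p + (5 * g : ℕ) + c)
        (W ^ (10 * g) * B) := fun c hc hc0 v hv hpv => by
    refine (hB.dodecahedron hκ hB0 (fun b hb => hf b fun k => by
      have := hb k; push_cast at this; omega) _ ?_).trans
      (mul_le_mul_of_nonneg_right (pow_le_pow_left₀ (by linarith) hκW _) hB0)
    intro i j hij
    rw [hσabs, hσabs]
    push_cast at hv ⊢
    have key : ∀ i, |v i| + |v (i + 1)| ≤ 20 * g := fun i => by
      rw [lsum_eq v i, lsum_eq p i] at hv
      have b0 := hpv i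
      have b1 := hpv (i + 1)
      have b2 := hpv (i + 2)
      have c0 := hpa i
      have c1 := hpa (i + 1)
      have c2 := hpa (i + 2)
      have d0 := ha0 i
      have d1 := ha0 (i + 1)
      have d2 := ha0 (i + 2)
      have e0 := ha1 i
      have e1 := ha1 (i + 1)
      have e2 := ha1 (i + 2)
      rcases abs_cases (v i) with h | h <;> rcases abs_cases (v (i + 1)) with h' | h' <;> omega
    have hij' : j = i + 1 ∨ i = j + 1 := by revert i j; decide
    rcases hij' with rfl | rfl
    · have := key i; omega
    · have := key j; omega
  have hcard1 : 50000 * #A < g ^ 2 := lt_of_le_of_lt (by nlinarith) hcard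
  have hgR : (1000 : ℝ) ≤ g := by exact_mod_cast hg
  have hcardA : #(A.image fun y k => σ k * (y k - q k)) ≤ #A := card_image_le
  have key := tetrahedron_fill (f := fun v => f (signedShift q σ v)) (θ := θ)
    (B := W ^ (10 * g) * B) (W := W) (κ := κ) (E := signedShift q σ ⁻¹' E)
    (E₁ := signedShift q σ ⁻¹' E₁) (A := A.image fun y k => σ k * (y k - q k)) (p := p) (q := 0)
    (C := 1000) (s := 5 * g) (H := 7 * g) (μ := g) (J₀ := (g - 1) / 6) hg (by omega) hκ
    (by linarith) (by push_cast; linarith) (by positivity)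
    (hθ.trans (le_mul_of_one_le_left hB0 (one_le_pow₀ hW1)))
    (fun b hb hpb => by
      rw [nbrSum_signedShift f hσ]
      refine hf _ fun k => ?_
      rw [hσabs]
      exact hbox b (by omega) hpb k)
    (by simpa using hbase 0 (by norm_num) le_rfl) (hbase 1 le_rfl (by norm_num))
    (Set.preimage_mono hE) (fun P hP => (hE₁ _ hP).preimage_signedShift hσ)
    (SparseAt.preimage_signedShift hσ (by
      have : signedShift q σ 0 = q := by ext k; simp [signedShift]
      rwa [this]))
    (fun v hv hpv k => by
      have := hbox v hv hpv k
      simp only [Pi.zero_apply, sub_zero]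
      push_cast
      omega)
    (fun v hv hpv hvE hvθ => mem_image.2 ⟨signedShift q σ v, hA _ (fun k => by
      rw [hσabs]; exact hbox v hv hpv k) hvE hvθ, by
        ext k
        simp only [signedShift, add_sub_cancel_left]
        rw [← mul_assoc, hσσ, one_mul]⟩)
    (lt_of_le_of_lt (Nat.mul_le_mul_left _ hcardA) hcard)
    (by
      have h1 : g ≤ 7 * ((g - 1) / 6) := by omega
      have h2 : g * g ≤ 7 * ((g - 1) / 6) * g := Nat.mul_le_mul_right _ h1
      nlinarith)
    (7 * g) le_rfl a (by rw [hlp]; push_cast; ring) (fun k => by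
      beta_reduce
      rw [hpa]
      have : 7 * g / 2 + (g - 1) / 6 ≤ 4 * g := by omega
      have : ((7 * g / 2 + (g - 1) / 6 : ℕ) : ℤ) ≤ 4 * g := by exact_mod_cast this
      omega)
  simp only [hxa] at key
  refine key.trans ?_
  rw [← mul_assoc, ← pow_add]
  refine mul_le_mul_of_nonneg_right (pow_le_pow_right₀ hW1 ?_) hB0
  -- The exponents add up to `10 g + 7 g (85 g + 1) ≤ 600 g²`.
  nlinarith

end

/-! ### The local estimate -/

/-- The sequence of radii of the growing cubes, divided by ten. -/
def growRad : ℕ → ℕ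
  | 0 => 1000
  | t + 1 => 11 * growRad t / 10

theorem le_growRad (t : ℕ) : 1000 + t ≤ growRad t := by
  induction t with
  | zero => simp [growRad]
  | succ t ih => rw [growRad]; omega

theorem growRad_succ_ge (t : ℕ) : 12 * growRad t ≤ 11 * growRad (t + 1) := by
  have := le_growRad t
  rw [growRad]; omega

/-- The radii grow at least by the factor `12 / 11`. So the number of stopped seeds is dominated by
the last scale and costs no further logarithm. -/
theorem sum_growRad_le (τ : ℕ) : ∑ t ∈ range τ, growRad t ≤ 11 * growRad τ := by
  induction τ with
  | zero => simp
  | succ τ ih => rw [sum_range_succ]; have := growRad_succ_ge τ; omega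

theorem exists_growRad (m : ℕ) (hm : 10001 ≤ m) : ∃ τ, m ≤ 10 * growRad τ ∧
    100 * growRad τ ≤ 11 * m ∧ ∀ t < τ, 10 * growRad t ≤ m := by
  classical
  have hex : ∃ τ, m ≤ 10 * growRad τ := ⟨m, by have := le_growRad m; omega⟩
  have hlt : ∀ t < Nat.find hex, 10 * growRad t ≤ m := fun t ht =>
    (not_le.1 (Nat.find_min hex ht)).le
  refine ⟨Nat.find hex, Nat.find_spec hex, ?_, hlt⟩
  have h0 : Nat.find hex ≠ 0 := fun h => by
    have := Nat.find_spec hex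
    rw [h] at this
    simp only [growRad] at this
    omega
  obtain ⟨t, ht⟩ := Nat.exists_eq_succ_of_ne_zero h0
  have := hlt t (by omega)
  rw [ht, Nat.succ_eq_add_one, growRad]
  omega

theorem card_near_le (S : Finset Lattice3) (v : Lattice3) (c : ℕ)
    (h : ∀ P ∈ S, ∀ k, |P k - v k| ≤ c) : #S ≤ (2 * c + 1) ^ 3 := by
  have h1 : S ⊆ Fintype.piFinset fun k => Icc (v k - c) (v k + c) := fun P hP => by
    rw [Fintype.mem_piFinset]
    intro k
    have := abs_le.1 (h P hP k)
    rw [mem_Icc]; omega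
  refine (card_le_card h1).trans (le_of_eq ?_)
  rw [Fintype.card_piFinset, Fin.prod_univ_three, Int.card_Icc, Int.card_Icc, Int.card_Icc]
  have : ∀ k : Fin 3, (v k + c + 1 - (v k - c)).toNat = 2 * c + 1 := fun k => by omega
  rw [this, this, this]; ring

theorem SparseAt.of_le {E : Set Lattice3} {C C' : ℕ} {q : Lattice3} (h : SparseAt E C q)
    (hC : C' ≤ C) : SparseAt E C' q := by
  intro L b v hL hv hb
  refine h L b v hL hv fun t ht k => (hb t ht k).trans ?_
  gcongr

/-- The exponent `6600 g²` reproduces itself: `6600 + 600 ≤ 6600 · (12 / 11)²`. -/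
theorem mul_sq_add_mul_sq_le {a b : ℕ} (h : 12 * a ≤ 11 * b) :
    600 * a ^ 2 + 6600 * a ^ 2 ≤ 6600 * b ^ 2 := by
  nlinarith [mul_self_le_mul_self (Nat.zero_le _) h]

theorem mul_sq_le_mul_sq {a b : ℕ} (h : 100 * a ≤ 11 * b) : 6600 * a ^ 2 ≤ 100 * b ^ 2 := by
  nlinarith [mul_self_le_mul_self (Nat.zero_le _) h]

section
variable {f : Lattice3 → ℝ} {θ W κ : ℝ} {E E₁ E₂ : Set Lattice3} {A S : Finset Lattice3}
  {c : Lattice3} {m : ℕ}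

open scoped Classical in
theorem card_seeds_near_le (r : ℕ) :
    ∑ q ∈ S, #{v ∈ A | ∀ k, |v k - q k| ≤ r} ≤ #A * (2 * r + 1) ^ 3 := by
  have := sum_card_bipartiteAbove_eq_sum_card_bipartiteBelow (s := S) (t := A)
    (fun q v => ∀ k, |v k - q k| ≤ (r : ℤ))
  simp only [bipartiteAbove, bipartiteBelow] at this
  rw [this]
  refine (sum_le_card_nsmul A _ ((2 * r + 1) ^ 3) fun v _ => ?_).trans (by simp)
  refine card_near_le _ v r fun P hP k => ?_
  rw [abs_sub_comm]
  exact (mem_filter.1 hP).2 k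

open scoped Classical in
/-- If few points near `c` are large, then `f c` is small. -/
theorem card_large_ge (hm : 10001 ≤ m) (hκ : 0 ≤ κ) (hκW : κ + 5 ≤ W) (hmW : 50 * (m : ℝ) ≤ W)
    (hθ : 0 ≤ θ) (hf : ∀ b, (∀ k, |b k - c k| ≤ 4 * m) → |nbrSum f b| ≤ κ * |f b|)
    (hE : E ⊆ E₁) (hE₁ : ∀ P, P ∉ E₁ → SparseAt E 4 P)
    (hE₂ : ∀ P, P ∉ E₂ → SparseAt E₁ 10000 P)
    (hS : ∀ P ∈ S, P ∉ E₂ ∧ ∀ k, |P k - c k| ≤ m) (hSc : 4 * m ^ 3 ≤ #S)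
    (hA : ∀ v, (∀ k, |v k - c k| ≤ 4 * m) → v ∉ E → θ < |f v| → v ∈ A)
    (hfc : W ^ (100 * m ^ 2) * θ < |f c|) :
    m ^ 2 ≤ 10 ^ 10 * (Nat.log 2 (5 * m) + 1) * #A := by
  by_contra hcon
  push Not at hcon
  have hmR : (10001 : ℝ) ≤ m := by exact_mod_cast hm
  have hW1 : 1 ≤ W := by linarith
  obtain ⟨τ, hτ1, hτ2, hτ⟩ := exists_growRad m hm
  set Λ := 50000 * (Nat.log 2 (5 * m) + 1) with hΛ
  set bl : ℕ → Finset Lattice3 := fun t => {P ∈ S | (growRad t) ^ 2 ≤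
    Λ * #{v ∈ A | ∀ k, |v k - P k| ≤ (20 * growRad t : ℕ)}} with hbl
  set b0 : Finset Lattice3 := {P ∈ S | 1 ≤ #{v ∈ A | ∀ k, |v k - P k| ≤ (10000 : ℕ)}} with hb0
  -- A seed outside this union starts with no large point within distance `10000` and is stopped at
  -- no scale, so its cube grows until it contains `c` and contradicts the size of `f c`.
  have hcover : S ⊆ b0 ∪ (range τ).biUnion bl := by
    intro P hP
    by_contra hno
    simp only [mem_union, mem_biUnion, mem_range, not_or, not_exists, not_and] at hno
    obtain ⟨hPE, hPc⟩ := hS P hP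
    have hPs := hE₂ P hPE
    have : ∀ t ≤ τ, CubeBound f P (10 * growRad t) (W ^ (6600 * growRad t ^ 2) * θ) := by
      intro t
      induction t with
      | zero =>
        intro _ v hv
        simp only [growRad] at hv
        refine le_trans ?_ (le_mul_of_one_le_left hθ (one_le_pow₀ hW1))
        by_contra hlt
        have hvE : v ∉ E := fun h => hPs.not_mem (fun k => by simpa using hv k) (hE h)
        refine hno.1 (mem_filter.2 ⟨hP, card_pos.2 ⟨v, mem_filter.2 ⟨hA v (fun k => ?_) hvE
          (not_le.1 hlt), fun k => by simpa using hv k⟩⟩⟩)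
        have h1 := abs_le.1 (hv k)
        have h2 := abs_le.1 (hPc k)
        rw [abs_le]
        push_cast at h1
        omega
      | succ t ih =>
        intro ht
        have hgt := hτ t (by omega)
        have hgt' : 10 * (growRad t : ℝ) ≤ m := by exact_mod_cast hgt
        have hg := le_growRad t
        have hfar : ∀ v : Lattice3, (∀ k, |v k - P k| ≤ 20 * growRad t) →
            ∀ k, |v k - c k| ≤ 4 * m := fun v hv k => by
          have h1 := abs_le.1 (hv k)
          have h2 := abs_le.1 (hPc k)
          rw [abs_le]
          omega
        have hnot : ¬ growRad t ^ 2 ≤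
            Λ * #{v ∈ A | ∀ k, |v k - P k| ≤ (20 * growRad t : ℕ)} := fun h =>
          hno.2 t (by omega) (mem_filter.2 ⟨hP, h⟩)
        have key := CubeBound.enlarge (f := f) (θ := θ) (W := W) (κ := κ) (q := P)
          (B := W ^ (6600 * growRad t ^ 2) * θ)
          (A := {v ∈ A | ∀ k, |v k - P k| ≤ (20 * growRad t : ℕ)})
          (E := E) (E₁ := E₁) (g := growRad t) (by omega) hκ hκW
          (by linarith) (by positivity) (le_mul_of_one_le_left hθ (one_le_pow₀ hW1))
          (fun b hb => hf b (hfar b hb)) (ih (by omega)) hE hE₁ (hPs.of_le (by norm_num))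
          (fun v hv hvE hvθ => mem_filter.2 ⟨hA v (hfar v hv) hvE hvθ, by push_cast; exact hv⟩)
          (lt_of_le_of_lt (Nat.mul_le_mul_right _ (Nat.mul_le_mul_left _ (Nat.add_le_add_right
            (Nat.log_mono_right (by omega)) 1))) (not_le.1 hnot))
        intro v hv
        refine (key v fun k => (hv k).trans ?_).trans ?_
        · rw [growRad]
          have : 10 * (11 * growRad t / 10) ≤ 11 * growRad t := by omega
          exact_mod_cast this
        · rw [← mul_assoc, ← pow_add]
          refine mul_le_mul_of_nonneg_right (pow_le_pow_right₀ hW1 ?_) hθ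
          have := growRad_succ_ge t
          exact mul_sq_add_mul_sq_le this
    have h1 := this τ le_rfl c (fun k => by
      rw [abs_sub_comm]
      have : (m : ℤ) ≤ (10 * growRad τ : ℕ) := by exact_mod_cast hτ1
      exact (hPc k).trans this)
    refine absurd (h1.trans (mul_le_mul_of_nonneg_right (pow_le_pow_right₀ hW1 ?_) hθ))
      (not_le.2 hfc)
    exact mul_sq_le_mul_sq hτ2
  have hb0' : #b0 ≤ #A * 20001 ^ 3 := by
    refine le_trans ?_ (card_seeds_near_le (S := b0) (A := A) 10000)
    simpa using card_nsmul_le_sum b0 _ 1 fun P hP => (mem_filter.1 hP).2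
  -- Each large point is near at most `(41 g)³` seeds, and a stopped seed has at least `g² / Λ`
  -- large points near it. Here `68921 = 41³`.
  have hbl' : ∀ t, #(bl t) ≤ Λ * #A * 68921 * growRad t := by
    intro t
    have hg := le_growRad t
    have h1 := card_seeds_near_le (S := bl t) (A := A) (20 * growRad t)
    have h2 : #(bl t) * growRad t ^ 2 ≤ Λ * ∑ P ∈ bl t,
        #{v ∈ A | ∀ k, |v k - P k| ≤ (20 * growRad t : ℕ)} := by
      rw [mul_sum]
      simpa using card_nsmul_le_sum (bl t) _ _ fun P hP => (mem_filter.1 hP).2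
    have h3 : (2 * (20 * growRad t) + 1) ^ 3 ≤ (41 * growRad t) ^ 3 :=
      Nat.pow_le_pow_left (by omega) 3
    have h4 : #(bl t) * growRad t ^ 2 ≤ Λ * #A * 68921 * growRad t * growRad t ^ 2 := by
      calc _ ≤ Λ * (#A * (2 * (20 * growRad t) + 1) ^ 3) := h2.trans (Nat.mul_le_mul_left _ h1)
        _ ≤ Λ * (#A * (41 * growRad t) ^ 3) := by gcongr
        _ = _ := by ring
    exact Nat.le_of_mul_le_mul_right h4 (by have : 0 < growRad t := by omega
                                            positivity)
  have h5 := (card_le_card hcover).trans (card_union_le _ _)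
  have h6 : #((range τ).biUnion bl) ≤ Λ * #A * 68921 * (2 * m) := by
    calc #((range τ).biUnion bl) ≤ ∑ t ∈ range τ, Λ * #A * 68921 * growRad t :=
          card_biUnion_le.trans (sum_le_sum fun t _ => hbl' t)
      _ = Λ * #A * 68921 * ∑ t ∈ range τ, growRad t := (mul_sum _ _ _).symm
      _ ≤ _ := Nat.mul_le_mul_left _ ((sum_growRad_le τ).trans (by omega))
  have h7 : #A * 20001 ^ 3 ≤ Λ * #A * 68921 * m := by
    have : 20001 ^ 3 ≤ 50000 * 68921 * m := by omega
    calc #A * 20001 ^ 3 ≤ #A * (50000 * 68921 * m) := Nat.mul_le_mul_left _ this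
      _ = 50000 * 1 * #A * 68921 * m := by ring
      _ ≤ _ := by rw [hΛ]; gcongr; omega
  have h8 : 4 * m ^ 3 ≤ 206763 * (Λ * #A) * m := by
    calc 4 * m ^ 3 ≤ _ := hSc.trans (h5.trans (Nat.add_le_add (hb0'.trans h7) h6))
      _ = _ := by ring
  have h9 : 4 * m ^ 2 ≤ 206763 * (Λ * #A) :=
    Nat.le_of_mul_le_mul_right (h8.trans' (le_of_eq (by ring))) (by omega)
  have h10 : 206763 * (Λ * #A) ≤ 4 * (10 ^ 10 * (Nat.log 2 (5 * m) + 1) * #A) := by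
    rw [hΛ]
    calc _ = 10338150000 * ((Nat.log 2 (5 * m) + 1) * #A) := by ring
      _ ≤ 40000000000 * ((Nat.log 2 (5 * m) + 1) * #A) := by gcongr; norm_num
      _ = _ := by ring
  omega

end

/-! ### Paths meet graded sets rarely -/

/-- The increments of the path `b` are comparable to the time differences. -/
def IsQuasiPath (L : ℕ) (b : ℕ → Space3) : Prop :=
  ∀ s t, s ≤ t → t < L → (t - s : ℝ) ≤ dist (b s) (b t) ∧ dist (b s) (b t) ≤ 2 * (t - s)

theorem card_le_of_diff_lt {S : Finset ℕ} {ρ : ℝ} (hρ : 0 ≤ ρ)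
    (h : ∀ s ∈ S, ∀ t ∈ S, s ≤ t → (t - s : ℝ) ≤ ρ) : (#S : ℝ) ≤ ρ + 1 := by
  rcases S.eq_empty_or_nonempty with rfl | hS
  · simp; linarith
  · have hsub : S ⊆ Icc (S.min' hS) (S.min' hS + ⌊ρ⌋₊) := fun t ht => by
      have h1 := S.min'_le t ht
      have h2 := h _ (S.min'_mem hS) t ht h1
      rw [mem_Icc]
      refine ⟨h1, ?_⟩
      have : t - S.min' hS ≤ ⌊ρ⌋₊ := Nat.le_floor (by rw [Nat.cast_sub h1]; exact h2)
      omega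
    have h1 := card_le_card hsub
    rw [Nat.card_Icc] at h1
    have h2 : #S ≤ ⌊ρ⌋₊ + 1 := by omega
    have h3 := Nat.floor_le hρ
    have h4 : (#S : ℝ) ≤ ⌊ρ⌋₊ + 1 := by exact_mod_cast h2
    linarith

open scoped Classical in
/-- A path meets a separated family of balls rarely. -/
theorem IsQuasiPath.card_near_le {L : ℕ} {b : ℕ → Space3} (hb : IsQuasiPath L b) {c : ℕ → Space3}
    {S ρ : ℝ} (hc : ∀ j j', j ≠ j' → S ≤ dist (c j) (c j')) (hρ : 0 ≤ ρ) {w : ℕ} (hw : 1 ≤ w)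
    (hwS : 2 * w + 2 * ρ ≤ S) :
    (#{t ∈ range L | ∃ j, dist (b t) (c j) < ρ} : ℝ) ≤ (L / w + 1) * (2 * ρ + 1) := by
  set T := {t ∈ range L | ∃ j, dist (b t) (c j) < ρ} with hT
  have hmaps : ∀ t ∈ T, t / w ∈ range (L / w + 1) := fun t ht => by
    rw [hT, mem_filter, mem_range] at ht
    rw [mem_range]
    exact Nat.lt_succ_of_le (Nat.div_le_div_right ht.1.le)
  rw [card_eq_sum_card_fiberwise (f := fun t => t / w) (t := range (L / w + 1))
    (fun t ht => hmaps t ht)]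
  push_cast
  refine (sum_le_card_nsmul _ _ (2 * ρ + 1) fun k _ => ?_).trans ?_
  · refine card_le_of_diff_lt (by positivity) fun s hs t ht hst => ?_
    simp only [hT, mem_filter, mem_range] at hs ht
    obtain ⟨⟨hsL, j, hj⟩, hsk⟩ := hs
    obtain ⟨⟨htL, j', hj'⟩, htk⟩ := ht
    obtain ⟨h1, h2⟩ := hb s t hst htL
    have hts : t - s ≤ w := by
      have e1 := Nat.div_add_mod s w
      have e2 := Nat.div_add_mod t w
      have e3 := Nat.mod_lt t (show 0 < w by omega)
      rw [hsk] at e1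
      rw [htk] at e2
      omega
    have hts' : (t - s : ℝ) ≤ w := by
      have : ((t - s : ℕ) : ℝ) ≤ w := by exact_mod_cast hts
      rwa [Nat.cast_sub hst] at this
    have tri := dist_triangle4 (c j) (b s) (b t) (c j')
    rw [dist_comm (c j) (b s)] at tri
    -- Within a time block of length `w` the path moves by at most `2 w`, so by separation it can
    -- meet only one ball. The hits then span a time of at most `2 ρ`.
    have hjj : j = j' := by
      by_contra hne
      have := hc j j' hne
      linarith
    subst hjj
    have := dist_triangle_right (b s) (b t) (c j)
    linarith
  · rw [card_range, nsmul_eq_mul]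
    push_cast
    have : ((L / w : ℕ) : ℝ) ≤ L / w := Nat.cast_div_le
    gcongr

theorem sum_le_two_mul_of_lacunary {ι : Type*} (I : Finset ι) (g : ι → ℝ) (hg : ∀ i ∈ I, 0 ≤ g i)
    (h : ∀ i ∈ I, ∀ j ∈ I, i ≠ j → 2 * g i ≤ g j ∨ 2 * g j ≤ g i) {Λ : ℝ} (hΛ0 : 0 ≤ Λ)
    (hΛ : ∀ i ∈ I, g i ≤ Λ) : ∑ i ∈ I, g i ≤ 2 * Λ := by
  classical
  induction I using Finset.induction_on_max_value g generalizing Λ with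
  | empty => simp; linarith
  | insert a s ha hmax ih =>
    have ga := hg a (mem_insert_self a s)
    rw [sum_insert ha]
    have := ih (fun i hi => hg i (mem_insert_of_mem hi))
      (fun i hi j hj => h i (mem_insert_of_mem hi) j (mem_insert_of_mem hj)) (Λ := g a / 2)
      (by linarith) (fun i hi => by
        rcases h i (mem_insert_of_mem hi) a (mem_insert_self a s)
          (fun hia => ha (hia ▸ hi)) with h1 | h1
        · linarith
        · have := hmax i hi
          linarith)
    have := hΛ a (mem_insert_self a s)
    linarith

/-- The centres `c` of the balls of a graded set with scale lengths `l ≥ X`. -/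
structure IsBallSystem (N : ℕ) {d : ℕ} (l : Fin d → ℝ) (ε X : ℝ)
    (c : Fin d → ℕ → Fin N → Space3) : Prop where
  le : ∀ i, X ≤ l i
  geometric : ∀ i j, i < j → l i ^ (1 + 2 * ε) ≤ l j
  separated : ∀ i t j j', j ≠ j' → l i ^ (1 + ε) ≤ dist (c i j t) (c i j' t)

section
variable {N d : ℕ} {l : Fin d → ℝ} {ε X : ℝ} {c : Fin d → ℕ → Fin N → Space3}

theorem IsBallSystem.sum_le (h : IsBallSystem N l ε X c) (hX : 1 ≤ X) (hε : 0 < ε)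
    (h2 : 2 ≤ X ^ ε) (I : Finset (Fin d)) {Λ : ℝ} (hΛ0 : 0 ≤ Λ) (hΛ : ∀ i ∈ I, l i ≤ Λ) :
    ∑ i ∈ I, l i ≤ 2 * Λ := by
  have hl : ∀ i, 0 < l i := fun i => by linarith [h.le i]
  have key : ∀ i j, i < j → 2 * l i ≤ l j := fun i j hij => by
    refine le_trans ?_ (h.geometric i j hij)
    have h1 : X ^ ε ≤ l i ^ (2 * ε) :=
      (Real.rpow_le_rpow (by linarith) (h.le i) hε.le).trans
        (Real.rpow_le_rpow_of_exponent_le (by linarith [h.le i]) (by linarith))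
    rw [Real.rpow_add (hl i), Real.rpow_one, mul_comm]
    exact mul_le_mul_of_nonneg_left (h2.trans h1) (hl i).le
  refine sum_le_two_mul_of_lacunary I l (fun i _ => (hl i).le) (fun i _ j _ hij => ?_) hΛ0 hΛ
  rcases lt_or_gt_of_ne hij with h | h
  · exact Or.inl (key i j h)
  · exact Or.inr (key j i h)

/-- The geometric condition makes `l i ^ (-ε)` drop at least by the factor `X ^ (2 ε²) ≥ 2` from one
scale to the next, so the density of all balls is bounded independently of the number `d` of scales.
-/
theorem IsBallSystem.sum_rpow_le (h : IsBallSystem N l ε X c) (hX : 1 ≤ X) (hε : 0 < ε)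
    (h2 : 2 ≤ X ^ (2 * ε ^ 2)) (I : Finset (Fin d)) :
    ∑ i ∈ I, l i ^ (-ε) ≤ 2 * X ^ (-ε) := by
  have hl : ∀ i, 0 < l i := fun i => by linarith [h.le i]
  have key : ∀ i j, i < j → 2 * l j ^ (-ε) ≤ l i ^ (-ε) := fun i j hij => by
    have h1 : l j ^ (-ε) ≤ (l i ^ (1 + 2 * ε)) ^ (-ε) :=
      Real.rpow_le_rpow_of_nonpos (Real.rpow_pos_of_pos (hl i) _) (h.geometric i j hij)
        (by linarith)
    rw [← Real.rpow_mul (hl i).le, show (1 + 2 * ε) * -ε = -ε + -(2 * ε ^ 2) by ring,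
      Real.rpow_add (hl i), Real.rpow_neg (hl i).le (2 * ε ^ 2)] at h1
    have h3 : 2 ≤ l i ^ (2 * ε ^ 2) :=
      h2.trans (Real.rpow_le_rpow (by linarith) (h.le i) (by positivity))
    have h4 : 0 < l i ^ (-ε) := Real.rpow_pos_of_pos (hl i) _
    have h5 : (l i ^ (2 * ε ^ 2))⁻¹ ≤ 2⁻¹ := inv_anti₀ (by norm_num) h3
    nlinarith
  refine sum_le_two_mul_of_lacunary I _ (fun i _ => (Real.rpow_pos_of_pos (hl i) _).le)
    (fun i _ j _ hij => ?_) (Real.rpow_nonneg (by linarith) _) (fun i _ =>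
      Real.rpow_le_rpow_of_nonpos (by linarith) (h.le i) (by linarith))
  rcases lt_or_gt_of_ne hij with h | h
  · exact Or.inr (key i j h)
  · exact Or.inl (key j i h)

-- Time blocks of length about `l ^ (1 + ε) / 4` are used. A path spends a fraction of order `l ^
-- (-ε)` of its time near the balls, plus a boundary term of order `l` for an incomplete block.
open scoped Classical in
theorem IsBallSystem.card_scale_near_le (h : IsBallSystem N l ε X c) (hX : 1 ≤ X) (hε : 0 < ε)
    {D : ℝ} (hD : 1 ≤ D) (hDX : 8 * D ≤ X ^ ε) {L : ℕ} {b : ℕ → Space3} (hb : IsQuasiPath L b)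
    (i : Fin d) (s : Fin N) :
    (#{t ∈ range L | ∃ j, dist (b t) (c i j s) < D * l i} : ℝ) ≤
      24 * D * L * l i ^ (-ε) + 3 * D * l i := by
  have hl1 : 1 ≤ l i := hX.trans (h.le i)
  have hl : 0 < l i := by linarith
  set P := l i ^ (1 + ε) with hP
  have hPl : P = l i ^ ε * l i := by rw [hP, add_comm, Real.rpow_add hl, Real.rpow_one]
  have hPε : 8 * D ≤ l i ^ ε := hDX.trans (Real.rpow_le_rpow (by linarith) (h.le i) hε.le)
  have hP8 : 8 * (D * l i) ≤ P := by rw [hPl]; nlinarith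
  have hDl : 1 ≤ D * l i := by nlinarith
  have hw1 : 1 ≤ ⌊P / 4⌋₊ := Nat.le_floor (by push_cast; linarith)
  have hw2 : (⌊P / 4⌋₊ : ℝ) ≤ P / 4 := Nat.floor_le (by linarith)
  have hw3 : P / 8 ≤ (⌊P / 4⌋₊ : ℝ) := by
    have := Nat.lt_floor_add_one (P / 4)
    linarith
  refine (hb.card_near_le (c := fun j => c i j s) (S := P) (fun j j' hj => h.separated i s j j' hj)
    (ρ := D * l i) (by positivity) hw1 (by linarith)).trans ?_
  have hPpos : 0 < P := by linarith
  have e1 : (L : ℝ) / ⌊P / 4⌋₊ ≤ 8 * L / P := by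
    rw [div_le_div_iff₀ (by linarith) hPpos]
    nlinarith [(Nat.cast_nonneg L : (0 : ℝ) ≤ L)]
  have e2 : 8 * L / P * (D * l i) = 8 * D * L * l i ^ (-ε) := by
    rw [hPl, Real.rpow_neg hl.le]
    field_simp
  calc ((L : ℝ) / ⌊P / 4⌋₊ + 1) * (2 * (D * l i) + 1)
      ≤ (8 * L / P + 1) * (3 * (D * l i)) := by
        gcongr
        linarith
    _ = 3 * (8 * L / P * (D * l i)) + 3 * (D * l i) := by ring
    _ = _ := by rw [e2]; ring

open scoped Classical in
/-- A path meets the enlarged balls of a graded set rarely. -/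
theorem IsBallSystem.card_near_le (h : IsBallSystem N l ε X c) (hX : 1 ≤ X) (hε : 0 < ε)
    (h2 : 2 ≤ X ^ (2 * ε ^ 2)) {D : ℝ} (hD : 1 ≤ D) (hDX : 8 * D ≤ X ^ ε) {L : ℕ} {b : ℕ → Space3}
    (hb : IsQuasiPath L b) (I : Finset (Fin d)) {Λ : ℝ} (hΛ0 : 0 ≤ Λ) (hΛ : ∀ i ∈ I, l i ≤ Λ) :
    (#{t ∈ range L | ∃ i ∈ I, ∃ j s, dist (b t) (c i j s) < D * l i} : ℝ) ≤
      N * D * (48 * L * X ^ (-ε) + 6 * Λ) := by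
  have hsub : {t ∈ range L | ∃ i ∈ I, ∃ j s, dist (b t) (c i j s) < D * l i} ⊆
      I.biUnion fun i => (univ : Finset (Fin N)).biUnion fun s =>
        {t ∈ range L | ∃ j, dist (b t) (c i j s) < D * l i} := fun t ht => by
    simp only [mem_filter, mem_biUnion, mem_univ, true_and] at ht ⊢
    obtain ⟨h1, i, hi, j, s, h2⟩ := ht
    exact ⟨i, hi, s, h1, j, h2⟩
  have h1 : #{t ∈ range L | ∃ i ∈ I, ∃ j s, dist (b t) (c i j s) < D * l i} ≤
      ∑ i ∈ I, ∑ s : Fin N, #{t ∈ range L | ∃ j, dist (b t) (c i j s) < D * l i} :=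
    (card_le_card hsub).trans (card_biUnion_le.trans (sum_le_sum fun i _ => card_biUnion_le))
  have h1' : (#{t ∈ range L | ∃ i ∈ I, ∃ j s, dist (b t) (c i j s) < D * l i} : ℝ) ≤
      ∑ i ∈ I, ∑ s : Fin N, (#{t ∈ range L | ∃ j, dist (b t) (c i j s) < D * l i} : ℝ) := by
    exact_mod_cast h1
  refine h1'.trans ((sum_le_sum fun i _ => sum_le_sum fun s _ =>
    h.card_scale_near_le hX hε hD hDX hb i s).trans ?_)
  have e1 := h.sum_le hX hε (by linarith) I hΛ0 hΛ
  have e2 := h.sum_rpow_le hX hε h2 I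
  calc ∑ i ∈ I, ∑ _s : Fin N, (24 * D * L * l i ^ (-ε) + 3 * D * l i)
      = N * D * (24 * L * ∑ i ∈ I, l i ^ (-ε) + 3 * ∑ i ∈ I, l i) := by
        simp only [sum_const, card_univ, Fintype.card_fin, nsmul_eq_mul]
        rw [mul_sum, mul_sum, ← sum_add_distrib, mul_sum]
        exact sum_congr rfl fun i _ => by ring
    _ ≤ N * D * (24 * L * (2 * X ^ (-ε)) + 3 * (2 * Λ)) := by gcongr
    _ = _ := by ring

end

/-! ### Sparseness of graded sets on lattice segments -/

theorem dist_latticePoint_sq (a b : Lattice3) :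
    dist (latticePoint a) (latticePoint b) ^ 2 = ∑ k, ((a k - b k : ℤ) : ℝ) ^ 2 := by
  rw [EuclideanSpace.dist_eq, Real.sq_sqrt (by positivity)]
  refine sum_congr rfl fun k _ => ?_
  rw [Real.dist_eq, sq_abs]
  simp [latticePoint]

theorem abs_le_dist_latticePoint (a b : Lattice3) (k : Fin 3) :
    |((a k - b k : ℤ) : ℝ)| ≤ dist (latticePoint a) (latticePoint b) := by
  refine abs_le_of_sq_le_sq ?_ dist_nonneg
  rw [dist_latticePoint_sq]
  exact single_le_sum (f := fun k => ((a k - b k : ℤ) : ℝ) ^ 2) (fun _ _ => sq_nonneg _)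
    (mem_univ k)

theorem dist_latticePoint_le {a b : Lattice3} {C : ℝ}
    (h : ∀ k, |((a k - b k : ℤ) : ℝ)| ≤ C) : dist (latticePoint a) (latticePoint b) ≤ 2 * C := by
  have hC : 0 ≤ C := (abs_nonneg _).trans (h 0)
  refine (sq_le_sq₀ dist_nonneg (by positivity)).1 ?_
  rw [dist_latticePoint_sq, Fin.sum_univ_three]
  have h0 := sq_le_sq' (abs_le.1 (h 0)).1 (abs_le.1 (h 0)).2
  have h1 := sq_le_sq' (abs_le.1 (h 1)).1 (abs_le.1 (h 1)).2
  have h2 := sq_le_sq' (abs_le.1 (h 2)).1 (abs_le.1 (h 2)).2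
  nlinarith

theorem isQuasiPath_segment (L : ℕ) (b : Lattice3) {v : Lattice3} (hv : IsUnitStep v) :
    IsQuasiPath L fun t => latticePoint fun k => b k + (t : ℕ) * v k := by
  intro s t hst _
  have hst' : (0 : ℝ) ≤ t - s := by
    have : (s : ℝ) ≤ t := by exact_mod_cast hst
    linarith
  have hdiff : ∀ k, |((((b k + (s : ℤ) * v k) - (b k + (t : ℤ) * v k) : ℤ)) : ℝ)| =
      (t - s) * |(v k : ℝ)| := fun k => by
    push_cast
    rw [show (b k + s * v k : ℝ) - (b k + t * v k) = -((t - s) * v k) by ring, abs_neg, abs_mul,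
      abs_of_nonneg hst']
  have hvk : ∀ k, |(v k : ℝ)| ≤ 1 := fun k => by exact_mod_cast hv.2 k
  constructor
  · obtain ⟨k, hk⟩ := hv.1
    refine le_trans ?_ (abs_le_dist_latticePoint _ _ k)
    rw [hdiff]
    have : (1 : ℝ) ≤ |(v k : ℝ)| := by exact_mod_cast Int.one_le_abs hk
    nlinarith
  · refine dist_latticePoint_le fun k => ?_
    rw [hdiff]
    have := hvk k
    nlinarith

/-- The lattice points in the balls with centres `c i j s` and radii `D l i`, `i ∈ I`, and in the
balls with centres `z j` and radius `ρ`. -/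
def nearSet {N d : ℕ} (l : Fin d → ℝ) (c : Fin d → ℕ → Fin N → Space3) (z : ℕ → Lattice3)
    (I : Finset (Fin d)) (D ρ : ℝ) : Set Lattice3 :=
  {a | (∃ i ∈ I, ∃ j s, dist (latticePoint a) (c i j s) < D * l i) ∨
    ∃ j, dist (latticePoint a) (latticePoint (z j)) < ρ}

section
variable {N d : ℕ} {l : Fin d → ℝ} {ε X : ℝ} {c : Fin d → ℕ → Fin N → Space3} {z : ℕ → Lattice3}
  {I : Finset (Fin d)} {D ρ : ℝ}

theorem nearSet_mono {D' ρ' : ℝ} (hl : ∀ i, 0 ≤ l i) (hD : D ≤ D') (hρ : ρ ≤ ρ') :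
    nearSet l c z I D ρ ⊆ nearSet l c z I D' ρ' := by
  rintro a (⟨i, hi, j, s, h⟩ | ⟨j, h⟩)
  · exact Or.inl ⟨i, hi, j, s, h.trans_le (mul_le_mul_of_nonneg_right hD (hl i))⟩
  · exact Or.inr ⟨j, h.trans_le hρ⟩

open scoped Classical in
theorem card_segment_nearSet_le (h : IsBallSystem N l ε X c) (hX : 1 ≤ X) (hε : 0 < ε)
    (h2 : 2 ≤ X ^ (2 * ε ^ 2)) (hD : 1 ≤ D) (hN : 0 < N) (hDX : 19200 * (N * D) ≤ X ^ ε)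
    (hz : ∀ j j', j ≠ j' → ε⁻¹ ≤ dist (latticePoint (z j)) (latticePoint (z j'))) (hρ : 0 ≤ ρ)
    {w : ℕ} (hw1 : 400 * (2 * ρ + 1) ≤ w) (hw2 : 2 * w + 2 * ρ ≤ ε⁻¹) {L : ℕ} {b v : Lattice3}
    (hv : IsUnitStep v) {Λ : ℝ} (hΛ0 : 0 ≤ Λ)
    (hΛ : ∀ i ∈ I, ∀ t < L, ∀ j s, dist (latticePoint fun k => b k + (t : ℕ) * v k) (c i j s) <
      D * l i → l i ≤ Λ)
    (hL : ∀ t < L, ∀ j, dist (latticePoint fun k => b k + (t : ℕ) * v k) (latticePoint (z j)) < ρ →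
      w ≤ L) :
    (#{t ∈ range L | (fun k => b k + (t : ℕ) * v k) ∈ nearSet l c z I D ρ} : ℝ) ≤
      3 / 400 * L + 6 * (N * D) * Λ := by
  have hb := isQuasiPath_segment L b hv
  have hL0 : (0 : ℝ) ≤ L := Nat.cast_nonneg L
  have hN1 : (1 : ℝ) ≤ N := by exact_mod_cast hN
  have hXε : 0 < X ^ ε := Real.rpow_pos_of_pos (by linarith) _
  set T1 := {t ∈ range L | ∃ i ∈ {i ∈ I | l i ≤ Λ}, ∃ j s,
    dist (latticePoint fun k => b k + (t : ℕ) * v k) (c i j s) < D * l i} with hT1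
  set T2 := {t ∈ range L | ∃ j,
    dist (latticePoint fun k => b k + (t : ℕ) * v k) (latticePoint (z j)) < ρ} with hT2
  have hsub : {t ∈ range L | (fun k => b k + (t : ℕ) * v k) ∈ nearSet l c z I D ρ} ⊆ T1 ∪ T2 := by
    intro t ht
    rw [mem_filter, mem_range] at ht
    simp only [mem_filter, mem_range, mem_union, hT1, hT2]
    obtain ⟨htL, ⟨i, hi, j, s, hd⟩ | hd⟩ := ht
    · exact Or.inl ⟨htL, i, ⟨hi, hΛ i hi t htL j s hd⟩, j, s, hd⟩
    · exact Or.inr ⟨htL, hd⟩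
  have c1 : (#T1 : ℝ) ≤ N * D * (48 * L * X ^ (-ε) + 6 * Λ) :=
    h.card_near_le hX hε h2 hD (by nlinarith) hb _ hΛ0 (fun i hi => (mem_filter.1 hi).2)
  have c1' : N * D * (48 * L * X ^ (-ε)) ≤ L / 400 := by
    rw [Real.rpow_neg (by linarith), show N * D * (48 * L * (X ^ ε)⁻¹) =
      (48 * (N * D) * L) / X ^ ε by ring, div_le_iff₀ hXε]
    nlinarith
  have c2 : (#T2 : ℝ) ≤ L / 200 := by
    rcases T2.eq_empty_or_nonempty with h0 | ⟨t, ht⟩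
    · rw [h0, card_empty, Nat.cast_zero]; positivity
    · rw [hT2, mem_filter, mem_range] at ht
      obtain ⟨htL, j, hj⟩ := ht
      have hwL : (w : ℝ) ≤ L := by exact_mod_cast hL t htL j hj
      have hw0 : (0 : ℝ) < w := by linarith
      have hw0' : 1 ≤ w := by exact_mod_cast hw0
      refine (hb.card_near_le (c := fun j => latticePoint (z j)) hz hρ hw0' hw2).trans ?_
      have e1 : 1 ≤ (L : ℝ) / w := by rw [le_div_iff₀ hw0]; linarith
      have e2 : (L : ℝ) / w * (2 * ρ + 1) ≤ L / 400 := by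
        rw [div_mul_eq_mul_div, div_le_iff₀ hw0]
        nlinarith
      nlinarith
  have c3 : (#{t ∈ range L | (fun k => b k + (t : ℕ) * v k) ∈ nearSet l c z I D ρ} : ℝ) ≤
      #T1 + #T2 := by exact_mod_cast (card_le_card hsub).trans (card_union_le _ _)
  calc _ ≤ _ := c3
    _ ≤ N * D * (48 * L * X ^ (-ε) + 6 * Λ) + L / 200 := add_le_add c1 c2
    _ ≤ _ := by linarith

-- A segment of `L` points within `C L` of `p` can reach a ball only if the radius of that ball is a
-- small fraction of `L`, since `p` lies outside its enlargement by the factor `D'`. So both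
-- boundary terms are negligible against `L`.
open scoped Classical in
theorem sparseAt_nearSet (h : IsBallSystem N l ε X c) (hX : 1 ≤ X) (hε : 0 < ε)
    (h2 : 2 ≤ X ^ (2 * ε ^ 2)) (hD : 1 ≤ D) (hN : 0 < N) (hDX : 19200 * (N * D) ≤ X ^ ε)
    (hz : ∀ j j', j ≠ j' → ε⁻¹ ≤ dist (latticePoint (z j)) (latticePoint (z j'))) (hρ : 0 ≤ ρ)
    {w : ℕ} (hw1 : 400 * (2 * ρ + 1) ≤ w) (hw2 : 2 * w + 2 * ρ ≤ ε⁻¹) {C : ℕ} (hC : 1 ≤ C)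
    {D' ρ' : ℝ} (hD' : D + 2 * C * (2400 * (N * D)) ≤ D') (hρ' : ρ + 2 * C * w ≤ ρ') {p : Lattice3}
    (hp : p ∉ nearSet l c z I D' ρ') : SparseAt (nearSet l c z I D ρ) C p := by
  intro L b v hL hv hbp
  have hN1 : (1 : ℝ) ≤ N := by exact_mod_cast hN
  have hC1 : (1 : ℝ) ≤ C := by exact_mod_cast hC
  have hND : 0 < N * D := by positivity
  simp only [nearSet, Set.mem_ofPred_eq, not_or, not_exists, not_and, not_lt] at hp
  have hdist : ∀ t < L, dist (latticePoint p) (latticePoint fun k => b k + (t : ℕ) * v k) ≤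
      2 * (C * L) := fun t ht => by
    rw [dist_comm]
    refine dist_latticePoint_le fun k => ?_
    exact_mod_cast hbp t ht k
  have key := card_segment_nearSet_le (I := I) (L := L) (b := b) (Λ := L / (2400 * (N * D))) h hX hε
    h2 hD hN hDX hz hρ hw1 hw2 hv (by positivity) (fun i hi t ht j s hd => by
      have h1 := hp.1 i hi j s
      have h3 := dist_triangle (latticePoint p) (latticePoint fun k => b k + (t : ℕ) * v k)
        (c i j s)
      have h4 := hdist t ht
      have hl : 0 < l i := by linarith [h.le i]
      rw [le_div_iff₀ (by positivity)]
      have h5 : (D + 2 * C * (2400 * (N * D))) * l i ≤ D' * l i :=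
        mul_le_mul_of_nonneg_right hD' hl.le
      have h6 : 2 * C * (l i * (2400 * (N * D))) ≤ 2 * C * L := by linarith
      exact le_of_mul_le_mul_left h6 (by positivity))
    (fun t ht j hd => by
      have h1 := hp.2 j
      have h3 := dist_triangle (latticePoint p) (latticePoint fun k => b k + (t : ℕ) * v k)
        (latticePoint (z j))
      have h4 := hdist t ht
      have h6 : 2 * (C : ℝ) * w ≤ 2 * C * L := by linarith
      exact_mod_cast le_of_mul_le_mul_left h6 (by positivity))
  have e : 6 * (N * D) * (L / (2400 * (N * D))) = L / 400 := by field_simp; norm_num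
  rw [e] at key
  have : (100 : ℝ) * #{t ∈ range L | (fun k => b k + (t : ℕ) * v k) ∈ nearSet l c z I D ρ} ≤ L := by
    linarith
  exact_mod_cast this

open scoped Classical in
theorem exists_seeds_not_mem_nearSet (h : IsBallSystem N l ε X c) (hX : 1 ≤ X) (hε : 0 < ε)
    (h2 : 2 ≤ X ^ (2 * ε ^ 2)) (hD : 1 ≤ D) (hN : 0 < N) (hDX : 19200 * (N * D) ≤ X ^ ε)
    (hz : ∀ j j', j ≠ j' → ε⁻¹ ≤ dist (latticePoint (z j)) (latticePoint (z j'))) (hρ : 0 ≤ ρ)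
    {w : ℕ} (hw1 : 400 * (2 * ρ + 1) ≤ w) (hw2 : 2 * w + 2 * ρ ≤ ε⁻¹) {m : ℕ} (hwm : w ≤ m)
    (hI : ∀ i ∈ I, 60 * (N * D) * l i ≤ m) (a : Lattice3) :
    ∃ S : Finset Lattice3, 4 * m ^ 3 ≤ #S ∧
      ∀ P ∈ S, P ∉ nearSet l c z I D ρ ∧ ∀ k, |P k - a k| ≤ m := by
  set L := 2 * m + 1 with hL
  have hN1 : (1 : ℝ) ≤ N := by exact_mod_cast hN
  have hND : 0 < N * D := by positivity
  set F : ℕ × ℕ → ℕ → Lattice3 := fun xy t k =>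
    (![a 0 - m + xy.1, a 1 - m + xy.2, a 2 - m] : Lattice3) k + (t : ℕ) * (Pi.single 2 1 : Lattice3) k
    with hF
  have F0 : ∀ xy t, F xy t 0 = a 0 - m + xy.1 := fun xy t => by simp [hF]
  have F1 : ∀ xy t, F xy t 1 = a 1 - m + xy.2 := fun xy t => by simp [hF]
  have F2 : ∀ xy t, F xy t 2 = a 2 - m + t := fun xy t => by simp [hF]
  have hunit : IsUnitStep (Pi.single 2 1) := ⟨⟨2, by simp⟩, fun k => by fin_cases k <;> simp⟩
  refine ⟨(((range L ×ˢ range L) ×ˢ range L).filter fun q => F q.1 q.2 ∉ nearSet l c z I D ρ).image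
    fun q => F q.1 q.2, ?_, ?_⟩
  · rw [card_image_of_injOn]
    · have h1 : ∀ xy ∈ range L ×ˢ range L,
          L - L / 2 ≤ #{t ∈ range L | F xy t ∉ nearSet l c z I D ρ} := by
        intro xy _
        have key := card_segment_nearSet_le (I := I) (L := L)
          (b := ![a 0 - m + xy.1, a 1 - m + xy.2, a 2 - m]) (Λ := m / (60 * (N * D))) h hX hε
          h2 hD hN hDX hz hρ hw1 hw2 hunit (by positivity) (fun i hi t ht j s hd => by
            rw [le_div_iff₀ (by positivity)]
            linarith [hI i hi]) (fun t ht j hd => by omega)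
        have e : 6 * (N * D) * (m / (60 * (N * D))) = (m : ℝ) / 10 := by field_simp; ring
        rw [e] at key
        have h2 := card_filter_add_card_filter_not (s := range L)
          (fun t => F xy t ∈ nearSet l c z I D ρ)
        rw [card_range] at h2
        have h3 : (2 : ℝ) * #{t ∈ range L | F xy t ∈ nearSet l c z I D ρ} ≤ L := by
          have : (L : ℝ) = 2 * m + 1 := by rw [hL]; push_cast; ring
          simp only [hF]
          linarith
        have h4 : 2 * #{t ∈ range L | F xy t ∈ nearSet l c z I D ρ} ≤ L := by exact_mod_cast h3
        omega
      have h2 : (L * L) * (L - L / 2) ≤ #(((range L ×ˢ range L) ×ˢ range L).filter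
          fun q => F q.1 q.2 ∉ nearSet l c z I D ρ) := by
        rw [card_filter, sum_product]
        simp only [← card_filter]
        simpa using card_nsmul_le_sum _ _ _ h1
      refine le_trans ?_ h2
      have h3 : m ≤ L - L / 2 := by omega
      calc 4 * m ^ 3 = (2 * m * (2 * m)) * m := by ring
        _ ≤ (L * L) * (L - L / 2) := by gcongr <;> omega
    · rintro ⟨⟨x, y⟩, t⟩ _ ⟨⟨x', y'⟩, t'⟩ _ h
      simp only at h
      have h0 := congrFun h 0
      have h1 := congrFun h 1
      have h2 := congrFun h 2
      rw [F0, F0] at h0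
      rw [F1, F1] at h1
      rw [F2, F2] at h2
      simp only at h0 h1
      simp only [Prod.mk.injEq]
      omega
  · intro P hP
    simp only [mem_image, mem_filter, mem_product, mem_range, Prod.exists] at hP
    obtain ⟨x, y, t, ⟨⟨⟨hx, hy⟩, ht⟩, hE⟩, rfl⟩ := hP
    refine ⟨hE, Fin.forall_fin_succ.2 ⟨?_, Fin.forall_fin_two.2 ⟨?_, ?_⟩⟩⟩
    · rw [F0, abs_le]; simp only; omega
    · change |F (x, y) t 1 - a 1| ≤ m
      rw [F1, abs_le]; simp only; omega
    · change |F (x, y) t 2 - a 2| ≤ m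
      rw [F2, abs_le]; omega

end

/-- The local estimate needs three nested sets, each sparse at every point outside the next. They
are neighbourhoods of the same balls with radii enlarged by the factors `1`, `20000 N` and `10 ^ 12
N²`. -/
theorem card_large_ge_of_nearSet {N d : ℕ} {l : Fin d → ℝ} {ε X : ℝ}
    {c : Fin d → ℕ → Fin N → Space3} {z : ℕ → Lattice3} {I : Finset (Fin d)}
    (h : IsBallSystem N l ε X c) (hX : 1 ≤ X) (hε : 0 < ε) (h2 : 2 ≤ X ^ (2 * ε ^ 2)) (hN : 0 < N)
    (hDX : 10 ^ 17 * (N : ℝ) ^ 3 ≤ X ^ ε) (hε' : 10 ^ 15 ≤ ε⁻¹)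
    (hz : ∀ j j', j ≠ j' → ε⁻¹ ≤ dist (latticePoint (z j)) (latticePoint (z j')))
    {m : ℕ} (hm : 10 ^ 15 ≤ m) (hI : ∀ i ∈ I, 10 ^ 14 * (N : ℝ) ^ 3 * l i ≤ m)
    {f : Lattice3 → ℝ} {θ W κ : ℝ} {A : Finset Lattice3} {a : Lattice3}
    (hκ : 0 ≤ κ) (hκW : κ + 5 ≤ W) (hmW : 50 * (m : ℝ) ≤ W)
    (hθ : 0 ≤ θ) (hf : ∀ b, (∀ k, |b k - a k| ≤ 4 * m) → |nbrSum f b| ≤ κ * |f b|)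
    (hA : ∀ v, (∀ k, |v k - a k| ≤ 4 * m) → v ∉ nearSet l c z I 1 1 → θ < |f v| → v ∈ A)
    (hfa : W ^ (100 * m ^ 2) * θ < |f a|) :
    m ^ 2 ≤ 10 ^ 10 * (Nat.log 2 (5 * m) + 1) * #A := by
  have hN1 : (1 : ℝ) ≤ N := by exact_mod_cast hN
  have hN2 : (N : ℝ) ≤ (N : ℝ) ^ 2 := by nlinarith
  have hN3 : (N : ℝ) ^ 2 ≤ (N : ℝ) ^ 3 := by nlinarith [sq_nonneg (N : ℝ)]
  have hl : ∀ i, 0 ≤ l i := fun i => by linarith [h.le i]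
  -- The radii around the lattice centres follow `w = 400 (2 ρ + 1)` and `ρ' = ρ + 2 C w`: from `ρ =
  -- 1` with `C = 4` to `9601`, then with `C = 10000` to `153624009601`. The last `w` forces `ε⁻¹ ≥
  -- 10 ^ 15`.
  obtain ⟨S, hSc, hS⟩ := exists_seeds_not_mem_nearSet (D := 10 ^ 12 * (N : ℝ) ^ 2)
    (ρ := 153624009601) (w := 122899207681200) (m := m) h hX hε h2 (by nlinarith) hN
    (by nlinarith) hz (by norm_num) (by norm_num) (by norm_num; linarith) (by omega)
    (fun i hi => by
      refine le_trans ?_ (hI i hi)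
      refine mul_le_mul_of_nonneg_right ?_ (hl i)
      nlinarith) a
  refine card_large_ge (E := nearSet l c z I 1 1) (E₁ := nearSet l c z I (20000 * (N : ℝ)) 9601)
    (E₂ := nearSet l c z I (10 ^ 12 * (N : ℝ) ^ 2) 153624009601) (S := S)
    (by omega) hκ hκW hmW hθ hf
    (nearSet_mono hl (by nlinarith) (by norm_num)) (fun P hP => ?_) (fun P hP => ?_) hS hSc hA hfa
  · exact sparseAt_nearSet (w := 1200) (C := 4) h hX hε h2 le_rfl hN (by nlinarith) hz (by norm_num)
      (by norm_num) (by norm_num; linarith) (by norm_num) (by push_cast; linarith) (by norm_num) hP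
  · exact sparseAt_nearSet (w := 7681200) (C := 10000) h hX hε h2 (by linarith) hN (by nlinarith) hz
      (by norm_num) (by norm_num) (by norm_num; linarith) (by norm_num) (by push_cast; nlinarith)
      (by norm_num) hP

/-! ### Walks in cones along which the function decays at most geometrically -/

/-- `a'` can be reached from `a` by `t` steps in direction `σ e_i`, each step having `l¹` length at
most two and positive `σ e_i` component. -/
def ConeRel (i : Fin 3) (σ t : ℤ) (a a' : Lattice3) : Prop :=
  t ≤ σ * (a' i - a i) ∧
    σ * (a' i - a i) + |a' (i + 1) - a (i + 1)| + |a' (i + 2) - a (i + 2)| ≤ 2 * t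

theorem ConeRel.trans {i : Fin 3} {σ t t' : ℤ} {a b c : Lattice3} (h : ConeRel i σ t a b)
    (h' : ConeRel i σ t' b c) : ConeRel i σ (t + t') a c := by
  obtain ⟨h1, h2⟩ := h
  obtain ⟨h3, h4⟩ := h'
  have e : σ * (c i - a i) = σ * (b i - a i) + σ * (c i - b i) := by ring
  have e1 := abs_sub_le (c (i + 1)) (b (i + 1)) (a (i + 1))
  have e2 := abs_sub_le (c (i + 2)) (b (i + 2)) (a (i + 2))
  constructor <;> rw [e] <;> linarith

theorem ConeRel.refl (i : Fin 3) (σ : ℤ) (a : Lattice3) : ConeRel i σ 0 a a := by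
  simp [ConeRel]

theorem ConeRel.side_le {i : Fin 3} {σ t : ℤ} {a a' : Lattice3} (h : ConeRel i σ t a a') :
    |a' (i + 1) - a (i + 1)| + |a' (i + 2) - a (i + 2)| ≤ σ * (a' i - a i) := by
  obtain ⟨h1, h2⟩ := h
  linarith

theorem abs_sub_eq_of_sign {σ : ℤ} (hσ : σ = 1 ∨ σ = -1) {x : ℤ} (h : 0 ≤ σ * x) : |x| = σ * x := by
  rcases hσ with rfl | rfl
  · rw [one_mul] at h ⊢; exact abs_of_nonneg h
  · rw [neg_one_mul] at h ⊢; exact abs_of_nonpos (by omega)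

theorem ConeRel.abs_le {i : Fin 3} {σ t : ℤ} (hσ : σ = 1 ∨ σ = -1) (ht : 0 ≤ t) {a a' : Lattice3}
    (h : ConeRel i σ t a a') (k : Fin 3) : |a' k - a k| ≤ σ * (a' i - a i) := by
  have h0 := abs_sub_eq_of_sign hσ (ht.trans h.1)
  have h1 := h.side_le
  have p1 := abs_nonneg (a' (i + 1) - a (i + 1))
  have p2 := abs_nonneg (a' (i + 2) - a (i + 2))
  exact forall_fin3 (P := fun k => |a' k - a k| ≤ σ * (a' i - a i)) i (by omega) (by omega)
    (by omega) k

theorem ConeRel.dist_le {i : Fin 3} {σ t : ℤ} (hσ : σ = 1 ∨ σ = -1) (ht : 0 ≤ t)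
    {a a' : Lattice3} (h : ConeRel i σ t a a') :
    (t : ℝ) ≤ dist (latticePoint a) (latticePoint a') ∧
      dist (latticePoint a) (latticePoint a') ≤ 2 * t := by
  have h0 := abs_sub_eq_of_sign hσ (ht.trans h.1)
  rw [dist_comm]
  constructor
  · refine le_trans ?_ (abs_le_dist_latticePoint a' a i)
    have : t ≤ |a' i - a i| := h0 ▸ h.1
    exact_mod_cast this
  · have h2 := h.2
    rw [← h0] at h2
    have ht' : (0 : ℝ) ≤ 2 * t := by exact_mod_cast (by omega : (0 : ℤ) ≤ 2 * t)
    refine (sq_le_sq₀ dist_nonneg ht').1 ?_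
    rw [dist_latticePoint_sq, sum_fin3 _ i]
    have h3 : (|((a' i - a i : ℤ) : ℝ)| + |((a' (i + 1) - a (i + 1) : ℤ) : ℝ)| +
        |((a' (i + 2) - a (i + 2) : ℤ) : ℝ)|) ≤ 2 * t := by exact_mod_cast h2
    rw [← sq_abs ((a' i - a i : ℤ) : ℝ), ← sq_abs ((a' (i + 1) - a (i + 1) : ℤ) : ℝ),
      ← sq_abs ((a' (i + 2) - a (i + 2) : ℤ) : ℝ)]
    have p0 := abs_nonneg ((a' i - a i : ℤ) : ℝ)
    have p1 := abs_nonneg ((a' (i + 1) - a (i + 1) : ℤ) : ℝ)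
    have p2 := abs_nonneg ((a' (i + 2) - a (i + 2) : ℤ) : ℝ)
    nlinarith [mul_nonneg p0 p1, mul_nonneg p0 p2, mul_nonneg p1 p2]

section
variable {f : Lattice3 → ℝ} {κ : ℝ}

theorem abs_sub_single_le {c : Lattice3} (i : Fin 3) (hc : |nbrSum f c| ≤ κ * |f c|) :
    |f (c - Pi.single i 1)| ≤ κ * |f c| + |f (c + Pi.single i 1)| +
      |f (c + Pi.single (i + 1) 1)| + |f (c - Pi.single (i + 1) 1)| +
      |f (c + Pi.single (i + 2) 1)| + |f (c - Pi.single (i + 2) 1)| ∧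
    |f (c + Pi.single i 1)| ≤ κ * |f c| + |f (c - Pi.single i 1)| +
      |f (c + Pi.single (i + 1) 1)| + |f (c - Pi.single (i + 1) 1)| +
      |f (c + Pi.single (i + 2) 1)| + |f (c - Pi.single (i + 2) 1)| := by
  rw [nbrSum, sum_fin3 _ i] at hc
  have h0 := le_abs_self (f (c - Pi.single i 1))
  have h0' := neg_abs_le (f (c - Pi.single i 1))
  have h1 := le_abs_self (f (c + Pi.single i 1))
  have h1' := neg_abs_le (f (c + Pi.single i 1))
  have h2 := le_abs_self (f (c - Pi.single (i + 1) 1))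
  have h2' := neg_abs_le (f (c - Pi.single (i + 1) 1))
  have h3 := le_abs_self (f (c + Pi.single (i + 1) 1))
  have h3' := neg_abs_le (f (c + Pi.single (i + 1) 1))
  have h4 := le_abs_self (f (c - Pi.single (i + 2) 1))
  have h4' := neg_abs_le (f (c - Pi.single (i + 2) 1))
  have h5 := le_abs_self (f (c + Pi.single (i + 2) 1))
  have h5' := neg_abs_le (f (c + Pi.single (i + 2) 1))
  obtain ⟨h6, h7⟩ := abs_le.1 hc
  constructor
  · rw [abs_le]; constructor <;> linarith
  · rw [abs_le]; constructor <;> linarith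

theorem coneRel_sub {i : Fin 3} {σ : ℤ} (hσ : σ = 1 ∨ σ = -1) (c : Lattice3) :
    ConeRel i σ 1 (c - Pi.single i σ) c ∧ ConeRel i σ 1 (c - Pi.single i σ) (c + Pi.single i σ) ∧
    ∀ τ : ℤ, (τ = 1 ∨ τ = -1) →
      ConeRel i σ 1 (c - Pi.single i σ) (c + Pi.single (i + 1) τ) ∧
      ConeRel i σ 1 (c - Pi.single i σ) (c + Pi.single (i + 2) τ) := by
  refine ⟨?_, ?_, fun τ hτ => ⟨?_, ?_⟩⟩
  · rcases hσ with rfl | rfl <;> simp [ConeRel]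
  · rcases hσ with rfl | rfl <;> simp [ConeRel]
  · rcases hσ with rfl | rfl <;> rcases hτ with rfl | rfl <;> simp [ConeRel]
  · rcases hσ with rfl | rfl <;> rcases hτ with rfl | rfl <;> simp [ConeRel]

/-- The equation at `c = a + σ e_i` expresses `f a` by `f c` and the five other neighbours of `c`.
If all six values were below `|f a| / (κ + 5)`, the equation would fail. -/
theorem exists_coneRel_one (hκ : 0 ≤ κ) (i : Fin 3) {σ : ℤ} (hσ : σ = 1 ∨ σ = -1) (a : Lattice3) :
    ∃ a', ConeRel i σ 1 a a' ∧
      (|nbrSum f (a + Pi.single i σ)| ≤ κ * |f (a + Pi.single i σ)| →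
        |f a| ≤ (κ + 5) * |f a'|) := by
  set c := a + Pi.single i σ with hc
  have hac : a = c - Pi.single i σ := by rw [hc]; simp
  obtain ⟨r0, r1, r2⟩ := coneRel_sub (i := i) hσ c
  rw [← hac] at r0 r1 r2
  by_cases hh : |nbrSum f c| ≤ κ * |f c|
  swap; · exact ⟨c, r0, fun h => absurd h hh⟩
  by_contra hcon
  push Not at hcon
  have k0 := (hcon _ r0).2
  have k1 := (hcon _ r1).2
  have k2 := (hcon _ (r2 1 (Or.inl rfl)).1).2
  have k3 := (hcon _ (r2 1 (Or.inl rfl)).2).2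
  have k4 := (hcon _ (r2 (-1) (Or.inr rfl)).1).2
  have k5 := (hcon _ (r2 (-1) (Or.inr rfl)).2).2
  simp only [Pi.single_neg, ← sub_eq_add_neg] at k4 k5
  have key : |f a| ≤ κ * |f c| + |f (c + Pi.single i σ)| +
      |f (c + Pi.single (i + 1) 1)| + |f (c - Pi.single (i + 1) 1)| +
      |f (c + Pi.single (i + 2) 1)| + |f (c - Pi.single (i + 2) 1)| := by
    have := abs_sub_single_le i hh
    rcases hσ with rfl | rfl
    · rw [hac]; exact this.1
    · rw [hac]
      simp only [Pi.single_neg, ← sub_eq_add_neg, sub_neg_eq_add]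
      exact this.2
  have k6 : κ * ((κ + 5) * |f c|) ≤ κ * |f a| := mul_le_mul_of_nonneg_left k0.le hκ
  have k7 := mul_le_mul_of_nonneg_left key (by linarith : 0 ≤ κ + 5)
  nlinarith

/-- Starting at `a`, one can walk in direction `σ e_i` with `f` decreasing at most geometrically. -/
theorem exists_chain (f : Lattice3 → ℝ) (hκ : 0 ≤ κ) (i : Fin 3) {σ : ℤ} (hσ : σ = 1 ∨ σ = -1)
    (a : Lattice3) : ∃ b : ℕ → Lattice3, b 0 = a ∧
      (∀ s t : ℕ, s ≤ t → ConeRel i σ (t - s) (b s) (b t)) ∧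
      ∀ t : ℕ, (∀ s < t, |nbrSum f (b s + Pi.single i σ)| ≤ κ * |f (b s + Pi.single i σ)|) →
        |f a| ≤ (κ + 5) ^ t * |f (b t)| := by
  choose g hg1 hg2 using fun a => exists_coneRel_one (f := f) hκ i hσ a
  refine ⟨fun t => g^[t] a, rfl, fun s t hst => ?_, fun t => ?_⟩
  · induction t, hst using Nat.le_induction with
    | base => simpa using ConeRel.refl i σ _
    | succ t ht ih =>
      have := ih.trans (hg1 (g^[t] a))
      rw [← Function.iterate_succ_apply' g t a] at this
      convert this using 1
      push_cast; ring
  · induction t with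
    | zero => simp
    | succ t ih =>
      intro h
      have h1 := ih fun s hs => h s (by omega)
      have h2 := hg2 _ (h t (by omega))
      simp only [Function.iterate_succ_apply']
      calc |f a| ≤ (κ + 5) ^ t * |f (g^[t] a)| := h1
        _ ≤ (κ + 5) ^ t * ((κ + 5) * |f (g (g^[t] a))|) := by gcongr
        _ = _ := by rw [pow_succ]; ring

theorem isQuasiPath_chain {i : Fin 3} {σ : ℤ} (hσ : σ = 1 ∨ σ = -1) {b : ℕ → Lattice3}
    (hb : ∀ s t : ℕ, s ≤ t → ConeRel i σ (t - s) (b s) (b t)) (L t₀ : ℕ) :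
    IsQuasiPath L fun t => latticePoint (b (t₀ + t)) := by
  intro s t hst _
  have := (hb (t₀ + s) (t₀ + t) (by omega)).dist_le hσ (by push_cast; omega)
  push_cast at this
  constructor
  · convert this.1 using 1; ring
  · convert this.2 using 1; ring

/-- A window of a chain. -/
theorem exists_window {i : Fin 3} {σ : ℤ} {b : ℕ → Lattice3}
    (hb : ∀ s t : ℕ, s ≤ t → ConeRel i σ (t - s) (b s) (b t)) (H L : ℕ) :
    ∃ t₀ : ℕ, ∀ t < L, (H : ℤ) ≤ σ * (b (t₀ + t) i - b 0 i) ∧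
      σ * (b (t₀ + t) i - b 0 i) < H + 2 * L := by
  classical
  have hex : ∃ t : ℕ, (H : ℤ) ≤ σ * (b t i - b 0 i) := ⟨H, by
    have := (hb 0 H (by omega)).1
    simpa using this⟩
  refine ⟨Nat.find hex, fun t ht => ?_⟩
  have h1 := Nat.find_spec hex
  -- A step raises the height by at most two, so at the first time the height is at least `H` it is
  -- at most `H + 1`.
  have hup : σ * (b (Nat.find hex) i - b 0 i) ≤ H + 1 := by
    rcases Nat.eq_zero_or_eq_succ_pred (Nat.find hex) with h0 | h0
    · rw [h0]; simp; omega
    · have h2 := not_le.1 (Nat.find_min hex (m := (Nat.find hex).pred) (by omega))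
      have h3 := (hb (Nat.find hex).pred (Nat.find hex) (by omega)).2
      have p1 := abs_nonneg (b (Nat.find hex) (i + 1) - b (Nat.find hex).pred (i + 1))
      have p2 := abs_nonneg (b (Nat.find hex) (i + 2) - b (Nat.find hex).pred (i + 2))
      have h4 : ((Nat.find hex : ℕ) : ℤ) - ((Nat.find hex).pred : ℕ) = 1 := by omega
      rw [h4] at h3
      have e : σ * (b (Nat.find hex) i - b 0 i) = σ * (b (Nat.find hex).pred i - b 0 i) +
        σ * (b (Nat.find hex) i - b (Nat.find hex).pred i) := by ring
      omega
  have h5 := hb (Nat.find hex) (Nat.find hex + t) (by omega)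
  have p1 := abs_nonneg (b (Nat.find hex + t) (i + 1) - b (Nat.find hex) (i + 1))
  have p2 := abs_nonneg (b (Nat.find hex + t) (i + 2) - b (Nat.find hex) (i + 2))
  have h6 := h5.1
  have h7 := h5.2
  push_cast at h6 h7
  have e : σ * (b (Nat.find hex + t) i - b 0 i) = σ * (b (Nat.find hex) i - b 0 i) +
    σ * (b (Nat.find hex + t) i - b (Nat.find hex) i) := by ring
  constructor <;> rw [e] <;> omega

end

/-! ### Forty-four descendants with disjoint cubes -/

section
variable {f : Lattice3 → ℝ} {κ : ℝ} {P : Lattice3 → Prop} {a : Lattice3} {R L : ℕ}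

/-- Height windows of length `2 L` start at the multiples of `2 R + 2 L`, so points from different
windows differ by more than `2 R` in height. The last window ends at `40 R + 42 L ≤ 41 R`. -/
theorem exists_children (hκ : 0 ≤ κ) (hL : 1 ≤ L) (hLR : 42 * L ≤ R)
    (hf : ∀ c, (∀ k, |c k - a k| ≤ 42 * R) → |nbrSum f c| ≤ κ * |f c|)
    (hP : ∀ b : ℕ → Lattice3, IsQuasiPath L (fun t => latticePoint (b t)) →
      (∀ t < L, dist (latticePoint a) (latticePoint (b t)) ≤ 84 * R) → ∃ t < L, P (b t))
    (i : Fin 3) {σ : ℤ} (hσ : σ = 1 ∨ σ = -1) :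
    ∃ x : ℕ → Lattice3, ∀ j ≤ 20, P (x j) ∧ |f a| ≤ (κ + 5) ^ (42 * R) * |f (x j)| ∧
      j * (2 * R + 2 * L : ℤ) ≤ σ * (x j i - a i) ∧
      σ * (x j i - a i) < j * (2 * R + 2 * L : ℤ) + 2 * L ∧
      |x j (i + 1) - a (i + 1)| + |x j (i + 2) - a (i + 2)| ≤ σ * (x j i - a i) ∧
      ∀ j' ≤ 20, j < j' →
        |x j' (i + 1) - x j (i + 1)| + |x j' (i + 2) - x j (i + 2)| ≤ σ * (x j' i - x j i) := by
  obtain ⟨b, hb0, hb, hfb⟩ := exists_chain f hκ i hσ a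
  have hR : 42 ≤ R := by omega
  have hY : 1 ≤ κ + 5 := by linarith
  have hexist : ∀ j : ℕ, ∃ τ : ℕ, j ≤ 20 → P (b τ) ∧
      (j * (2 * R + 2 * L) : ℤ) ≤ σ * (b τ i - a i) ∧
      σ * (b τ i - a i) < j * (2 * R + 2 * L) + 2 * L := by
    intro j
    by_cases hj : j ≤ 20
    swap; · exact ⟨0, fun h => absurd h hj⟩
    obtain ⟨t₀, ht₀⟩ := exists_window hb (j * (2 * R + 2 * L)) L
    rw [hb0] at ht₀
    push_cast at ht₀
    have hjR : (j * (2 * R + 2 * L) : ℤ) ≤ 20 * (2 * R + 2 * L) := by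
      have : (j : ℤ) ≤ 20 := by exact_mod_cast hj
      gcongr
    obtain ⟨t, ht, htP⟩ := hP (fun t => b (t₀ + t)) (isQuasiPath_chain hσ hb L t₀) (fun t ht => by
      have h1 := hb 0 (t₀ + t) (by omega)
      rw [hb0] at h1
      have h2 := (h1.dist_le hσ (by push_cast; omega)).2
      refine h2.trans ?_
      have h3 := h1.1
      have h4 := (ht₀ t ht).2
      have h5 : (2 * ((t₀ + t : ℕ) - (0 : ℕ)) : ℤ) ≤ 84 * R := by push_cast at h3 ⊢; omega
      exact_mod_cast h5)
    exact ⟨t₀ + t, fun _ => ⟨htP, ht₀ t ht⟩⟩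
  choose τ hτ using hexist
  have hup : ∀ j ≤ 20, σ * (b (τ j) i - a i) < 41 * R := fun j hj => by
    have h1 := (hτ j hj).2.2
    have hjR : (j * (2 * R + 2 * L) : ℤ) ≤ 20 * (2 * R + 2 * L) := by
      have : (j : ℤ) ≤ 20 := by exact_mod_cast hj
      gcongr
    omega
  refine ⟨fun j => b (τ j), fun j hj => ?_⟩
  obtain ⟨h1, h2, h3⟩ := hτ j hj
  have ha := hb 0 (τ j) (by omega)
  rw [hb0] at ha
  refine ⟨h1, ?_, h2, h3, ha.side_le, fun j' hj' hjj => ?_⟩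
  · refine (hfb (τ j) fun s hs => hf _ fun k => ?_).trans
      (mul_le_mul_of_nonneg_right (pow_le_pow_right₀ hY ?_) (abs_nonneg _))
    · have e1 := hb 0 s (by omega)
      rw [hb0] at e1
      have e2 := e1.abs_le hσ (by push_cast; omega) k
      have e3 := (hb s (τ j) hs.le).1
      have e4 := hup j hj
      have e5 : σ * (b (τ j) i - a i) = σ * (b (τ j) i - b s i) + σ * (b s i - a i) := by ring
      have e6 : |(Pi.single i σ : Lattice3) k| ≤ 1 := by
        rw [Pi.single_apply]
        rcases hσ with rfl | rfl <;> split_ifs <;> simp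
      have e7 := abs_add_le (b s k - a k) ((Pi.single i σ : Lattice3) k)
      rw [Pi.add_apply, add_sub_right_comm]
      omega
    · have e1 := ha.1
      have e4 := hup j hj
      push_cast at e1
      omega
  · have hle : τ j ≤ τ j' := by
      by_contra hlt
      have e1 := (hb (τ j') (τ j) (by omega)).1
      have e2 := (hτ j' hj').2.1
      have e3 : σ * (b (τ j) i - a i) = σ * (b (τ j) i - b (τ j') i) + σ * (b (τ j') i - a i) := by
        ring
      have e4 : ((j + 1) * (2 * R + 2 * L) : ℤ) ≤ j' * (2 * R + 2 * L) := by
        have : (j + 1 : ℤ) ≤ j' := by exact_mod_cast hjj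
        gcongr
      rw [add_mul, one_mul] at e4
      omega
    exact (hb _ _ hle).side_le

/-- There are `44` good points near `a`, such that the cubes of radius `R` around them are
disjoint. -/
theorem exists_forty_four_children (hκ : 0 ≤ κ) (hL : 1 ≤ L) (hLR : 42 * L ≤ R) (ha : P a)
    (hf : ∀ c, (∀ k, |c k - a k| ≤ 42 * R) → |nbrSum f c| ≤ κ * |f c|)
    (hP : ∀ b : ℕ → Lattice3, IsQuasiPath L (fun t => latticePoint (b t)) →
      (∀ t < L, dist (latticePoint a) (latticePoint (b t)) ≤ 84 * R) → ∃ t < L, P (b t)) :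
    ∃ x : (Fin 20 ⊕ Fin 20) ⊕ (Fin 3 ⊕ Unit) → Lattice3,
      (∀ j, P (x j) ∧ |f a| ≤ (κ + 5) ^ (42 * R) * |f (x j)| ∧ ∀ k, |x j k - a k| ≤ 41 * R) ∧
      ∀ j j', j ≠ j' → ∃ k, 2 * R < |x j k - x j' k| := by
  have hR : 42 ≤ R := by omega
  have hY : 1 ≤ κ + 5 := by linarith
  obtain ⟨x, hx⟩ := exists_children hκ hL hLR hf hP 2 (σ := 1) (Or.inl rfl)
  obtain ⟨y, hy⟩ := exists_children hκ hL hLR hf hP 2 (σ := -1) (Or.inr rfl)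
  have e1 : (2 : Fin 3) + 1 = 0 := rfl
  have e2 : (2 : Fin 3) + 2 = 1 := rfl
  simp only [e1, e2, one_mul, neg_one_mul] at hx hy
  have hbound : ∀ (z : Lattice3) (i : Fin 3) (h : ℤ) (j : ℕ), j ≤ 20 →
      h < j * (2 * R + 2 * L : ℤ) + 2 * L → 0 ≤ h → |z i - a i| = h →
      |z (i + 1) - a (i + 1)| + |z (i + 2) - a (i + 2)| ≤ h → ∀ k, |z k - a k| ≤ 41 * R := by
    intro z i h j hj h1 h2 h3 h4
    have hjR : (j * (2 * R + 2 * L) : ℤ) ≤ 20 * (2 * R + 2 * L) := by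
      have : (j : ℤ) ≤ 20 := by exact_mod_cast hj
      gcongr
    have p1 := abs_nonneg (z (i + 1) - a (i + 1))
    have p2 := abs_nonneg (z (i + 2) - a (i + 2))
    exact forall_fin3 i (by omega) (by omega) (by omega)
  -- the direction of the remaining three points
  have hdir : ∃ (i : Fin 3) (σ : ℤ), i ≠ 2 ∧ (σ = 1 ∨ σ = -1) ∧
      (∀ j ≤ 20, σ * (x j i - a i) < 34 * R) ∧ (∀ j ≤ 20, σ * (y j i - a i) < 34 * R) := by
    -- By the cone condition a walk at sideways distance `34 R` is already at height `34 R`. Less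
    -- than `7 R` of height then remains, too little to come back below `27 R`.
    have blockx : ∀ (i : Fin 3) (σ : ℤ), i ≠ 2 → (σ = 1 ∨ σ = -1) →
        σ * (x 20 i - a i) < 27 * R → ∀ j ≤ 20, σ * (x j i - a i) < 34 * R := by
      intro i σ hi hσ h j hj
      by_contra hlt
      obtain ⟨-, -, l1, u1, s1, c1⟩ := hx j hj
      obtain ⟨-, -, l2, u2, s2, -⟩ := hx 20 le_rfl
      rcases Nat.lt_or_eq_of_le hj with hj' | rfl
      · have c2 := c1 20 le_rfl hj'
        have q0 := neg_abs_le (x 20 0 - x j 0)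
        have q0' := le_abs_self (x 20 0 - x j 0)
        have q1 := neg_abs_le (x 20 1 - x j 1)
        have q1' := le_abs_self (x 20 1 - x j 1)
        have r0 := neg_abs_le (x j 0 - a 0)
        have r0' := le_abs_self (x j 0 - a 0)
        have r1 := neg_abs_le (x j 1 - a 1)
        have r1' := le_abs_self (x j 1 - a 1)
        push_cast at u2
        fin_cases i
        · rcases hσ with rfl | rfl <;> simp only [Fin.zero_eta] at h hlt <;> omega
        · rcases hσ with rfl | rfl <;> simp only [Fin.mk_one] at h hlt <;> omega
        · exact absurd rfl hi
      · omega
    have blocky : ∀ (i : Fin 3) (σ : ℤ), i ≠ 2 → (σ = 1 ∨ σ = -1) →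
        σ * (y 20 i - a i) < 27 * R → ∀ j ≤ 20, σ * (y j i - a i) < 34 * R := by
      intro i σ hi hσ h j hj
      by_contra hlt
      obtain ⟨-, -, l1, u1, s1, c1⟩ := hy j hj
      obtain ⟨-, -, l2, u2, s2, -⟩ := hy 20 le_rfl
      rcases Nat.lt_or_eq_of_le hj with hj' | rfl
      · have c2 := c1 20 le_rfl hj'
        have q0 := neg_abs_le (y 20 0 - y j 0)
        have q0' := le_abs_self (y 20 0 - y j 0)
        have q1 := neg_abs_le (y 20 1 - y j 1)
        have q1' := le_abs_self (y 20 1 - y j 1)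
        have r0 := neg_abs_le (y j 0 - a 0)
        have r0' := le_abs_self (y j 0 - a 0)
        have r1 := neg_abs_le (y j 1 - a 1)
        have r1' := le_abs_self (y j 1 - a 1)
        push_cast at u2
        fin_cases i
        · rcases hσ with rfl | rfl <;> simp only [Fin.zero_eta] at h hlt <;> omega
        · rcases hσ with rfl | rfl <;> simp only [Fin.mk_one] at h hlt <;> omega
        · exact absurd rfl hi
      · omega
    obtain ⟨-, -, l1, u1, s1, -⟩ := hx 20 le_rfl
    obtain ⟨-, -, l2, u2, s2, -⟩ := hy 20 le_rfl
    push_cast at u1 u2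
    have r0 := neg_abs_le (x 20 0 - a 0)
    have r0' := le_abs_self (x 20 0 - a 0)
    have r1 := neg_abs_le (x 20 1 - a 1)
    have r1' := le_abs_self (x 20 1 - a 1)
    have s0 := neg_abs_le (y 20 0 - a 0)
    have s0' := le_abs_self (y 20 0 - a 0)
    have s1 := neg_abs_le (y 20 1 - a 1)
    have s1' := le_abs_self (y 20 1 - a 1)
    -- If both `e_0` and `-e_0` fail, one walk ends beyond `27 R` and the other beyond `-27 R` in
    -- this coordinate. The cone leaves both less than `14 R` in the direction `e_1`, which is then
    -- free.
    by_cases d1 : 1 * (x 20 0 - a 0) < 27 * R ∧ 1 * (y 20 0 - a 0) < 27 * R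
    · exact ⟨0, 1, by decide, Or.inl rfl, blockx 0 1 (by decide) (Or.inl rfl) d1.1,
        blocky 0 1 (by decide) (Or.inl rfl) d1.2⟩
    by_cases d2 : -1 * (x 20 0 - a 0) < 27 * R ∧ -1 * (y 20 0 - a 0) < 27 * R
    · exact ⟨0, -1, by decide, Or.inr rfl, blockx 0 (-1) (by decide) (Or.inr rfl) d2.1,
        blocky 0 (-1) (by decide) (Or.inr rfl) d2.2⟩
    refine ⟨1, 1, by decide, Or.inl rfl, blockx 1 1 (by decide) (Or.inl rfl) ?_,
        blocky 1 1 (by decide) (Or.inl rfl) ?_⟩ <;> omega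
  obtain ⟨i, σ, hi, hσ, hxi, hyi⟩ := hdir
  obtain ⟨z, hz⟩ := exists_children hκ hL hLR hf hP i hσ
  -- The last three points of the sideways walk are beyond `36 R`, hence more than `2 R` away from
  -- both vertical walks, which stay below `34 R`.
  have hz36 : ∀ j, 18 ≤ j → j ≤ 20 → 36 * (R : ℤ) < σ * (z j i - a i) := fun j h1 h2 => by
    have h3 := (hz j h2).2.2.1
    have : (18 * (2 * R + 2 * L) : ℤ) ≤ j * (2 * R + 2 * L) := by
      have : (18 : ℤ) ≤ j := by exact_mod_cast h1
      gcongr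
    omega
  have hsep : ∀ (v w : ℤ) (j j' : ℕ), j < j' → j * (2 * R + 2 * L : ℤ) ≤ v →
      v < j * (2 * R + 2 * L : ℤ) + 2 * L → j' * (2 * R + 2 * L : ℤ) ≤ w → 2 * R < w - v := by
    intro v w j j' hjj h1 h2 h3
    have e4 : ((j + 1) * (2 * R + 2 * L) : ℤ) ≤ j' * (2 * R + 2 * L) := by
      have : (j + 1 : ℤ) ≤ j' := by exact_mod_cast hjj
      gcongr
    rw [add_mul, one_mul] at e4
    omega
  have hsep0 : ∀ (j : ℕ) (v : ℤ), 1 ≤ j → j * (2 * R + 2 * L : ℤ) ≤ v → 2 * R < v := by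
    intro j v hj h
    have : (1 * (2 * R + 2 * L) : ℤ) ≤ j * (2 * R + 2 * L) := by
      have : (1 : ℤ) ≤ j := by exact_mod_cast hj
      gcongr
    omega
  have hσabs : ∀ v w : ℤ, σ * v - σ * w ≤ |v - w| := fun v w => by
    rw [← mul_sub]
    rcases hσ with rfl | rfl
    · simpa using le_abs_self (v - w)
    · simpa using neg_le_abs (v - w)
  refine ⟨Sum.elim (Sum.elim (fun j => x (j + 1)) fun j => y (j + 1))
    (Sum.elim (fun j => z (j + 18)) fun _ => a), ?_, ?_⟩
  · rintro ((j | j) | (j | j))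
    · obtain ⟨p1, p2, p3, p4, p5, -⟩ := hx (j + 1) (by omega)
      have h0 : 0 < x (j + 1) 2 - a 2 := by
        have := hsep0 _ _ (by omega) p3; omega
      exact ⟨p1, p2, hbound _ 2 _ (j + 1) (by omega) p4 h0.le (abs_of_pos h0) p5⟩
    · obtain ⟨p1, p2, p3, p4, p5, -⟩ := hy (j + 1) (by omega)
      have h0 : 0 < -(y (j + 1) 2 - a 2) := by
        have := hsep0 _ _ (by omega) p3; omega
      exact ⟨p1, p2, hbound _ 2 _ (j + 1) (by omega) p4 h0.le
        (abs_of_neg (show y (j + 1) 2 - a 2 < 0 by omega)) p5⟩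
    · obtain ⟨p1, p2, p3, p4, p5, -⟩ := hz (j + 18) (by omega)
      have h0 : 0 < σ * (z (j + 18) i - a i) := by
        have := hsep0 _ _ (by omega) p3; omega
      exact ⟨p1, p2, hbound _ i _ (j + 18) (by omega) p4 h0.le (abs_sub_eq_of_sign hσ h0.le) p5⟩
    · refine ⟨ha, le_mul_of_one_le_left (abs_nonneg _) (one_le_pow₀ hY), fun k => ?_⟩
      simp
  · have xx : ∀ j j' : Fin 20, j < j' → 2 * (R : ℤ) < x (j' + 1) 2 - x (j + 1) 2 := fun j j' h => by
      obtain ⟨-, -, l1, u1, -⟩ := hx (j + 1) (by omega)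
      obtain ⟨-, -, l2, -⟩ := hx (j' + 1) (by omega)
      have := hsep _ _ (j + 1) (j' + 1) (by omega) l1 u1 l2
      omega
    have yy : ∀ j j' : Fin 20, j < j' → 2 * (R : ℤ) < y (j + 1) 2 - y (j' + 1) 2 := fun j j' h => by
      obtain ⟨-, -, l1, u1, -⟩ := hy (j + 1) (by omega)
      obtain ⟨-, -, l2, -⟩ := hy (j' + 1) (by omega)
      have := hsep _ _ (j + 1) (j' + 1) (by omega) l1 u1 l2
      omega
    have zz : ∀ j j' : Fin 3, j < j' → 2 * (R : ℤ) < |z (j' + 18) i - z (j + 18) i| :=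
        fun j j' h => by
      obtain ⟨-, -, l1, u1, -⟩ := hz (j + 18) (by omega)
      obtain ⟨-, -, l2, -⟩ := hz (j' + 18) (by omega)
      have := hsep _ _ (j + 18) (j' + 18) (by omega) l1 u1 l2
      have h2 := hσabs (z (j' + 18) i - a i) (z (j + 18) i - a i)
      rw [sub_sub_sub_cancel_right] at h2
      omega
    have xa : ∀ j : Fin 20, 2 * (R : ℤ) < x (j + 1) 2 - a 2 := fun j =>
      hsep0 _ _ (by omega) (hx (j + 1) (by omega)).2.2.1
    have ya : ∀ j : Fin 20, 2 * (R : ℤ) < -(y (j + 1) 2 - a 2) := fun j =>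
      hsep0 _ _ (by omega) (hy (j + 1) (by omega)).2.2.1
    have za : ∀ j : Fin 3, 2 * (R : ℤ) < |z (j + 18) i - a i| := fun j => by
      have h1 := hz36 (j + 18) (by omega) (by omega)
      have h2 := hσabs (z (j + 18) i - a i) 0
      rw [sub_zero, mul_zero, sub_zero] at h2
      omega
    have zx : ∀ (j : Fin 3) (j' : Fin 20), 2 * (R : ℤ) < |z (j + 18) i - x (j' + 1) i| :=
        fun j j' => by
      have h1 := hz36 (j + 18) (by omega) (by omega)
      have h2 := hxi (j' + 1) (by omega)
      have h3 := hσabs (z (j + 18) i - a i) (x (j' + 1) i - a i)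
      rw [sub_sub_sub_cancel_right] at h3
      omega
    have zy : ∀ (j : Fin 3) (j' : Fin 20), 2 * (R : ℤ) < |z (j + 18) i - y (j' + 1) i| :=
        fun j j' => by
      have h1 := hz36 (j + 18) (by omega) (by omega)
      have h2 := hyi (j' + 1) (by omega)
      have h3 := hσabs (z (j + 18) i - a i) (y (j' + 1) i - a i)
      rw [sub_sub_sub_cancel_right] at h3
      omega
    rintro ((j | j) | (j | j)) ((j' | j') | (j' | j')) hne <;> simp only [Sum.elim_inl, Sum.elim_inr]
    · have hne' : j ≠ j' := fun h => hne (by rw [h])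
      refine ⟨2, ?_⟩
      rcases lt_or_gt_of_ne hne' with h | h
      · have := xx j j' h; rw [lt_abs]; omega
      · have := xx j' j h; rw [lt_abs]; omega
    · refine ⟨2, ?_⟩
      have := xa j; have := ya j'; rw [lt_abs]; omega
    · exact ⟨i, by rw [abs_sub_comm]; exact zx j' j⟩
    · exact ⟨2, (xa j).trans_le (le_abs_self _)⟩
    · refine ⟨2, ?_⟩
      have := xa j'; have := ya j; rw [lt_abs]; omega
    · have hne' : j ≠ j' := fun h => hne (by rw [h])
      refine ⟨2, ?_⟩
      rcases lt_or_gt_of_ne hne' with h | h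
      · have := yy j j' h; rw [lt_abs]; omega
      · have := yy j' j h; rw [lt_abs]; omega
    · exact ⟨i, by rw [abs_sub_comm]; exact zy j' j⟩
    · exact ⟨2, (ya j).trans_le (neg_le_abs _)⟩
    · exact ⟨i, zx j j'⟩
    · exact ⟨i, zy j j'⟩
    · have hne' : j ≠ j' := fun h => hne (by rw [h])
      refine ⟨i, ?_⟩
      rcases lt_or_gt_of_ne hne' with h | h
      · rw [abs_sub_comm]; exact zz j j' h
      · exact zz j' j h
    · exact ⟨i, za j⟩
    · exact ⟨2, by rw [abs_sub_comm]; exact (xa j').trans_le (le_abs_self _)⟩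
    · exact ⟨2, by rw [abs_sub_comm]; exact (ya j').trans_le (neg_le_abs _)⟩
    · exact ⟨i, by rw [abs_sub_comm]; exact za j'⟩
    · exact absurd rfl hne

end

/-! ### The tree of good points -/

open scoped Classical in
/-- The tree of good points: at each clean scale a good point has `44` good descendants. -/
theorem exists_separated_points {f : Lattice3 → ℝ} {κ : ℝ} (hκ : 0 ≤ κ) {m : ℕ} (hm : 42 ≤ m)
    {G : ℕ → Lattice3 → Prop} {clean : ℕ → Prop} (hG : ∀ k a, G (k + 1) a → G k a)
    (hclean : ∀ k a, clean k → G (k + 1) a → ∀ b : ℕ → Lattice3,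
      IsQuasiPath (m * 42 ^ k / 42) (fun t => latticePoint (b t)) →
      (∀ t < m * 42 ^ k / 42, dist (latticePoint a) (latticePoint (b t)) ≤ 84 * (m * 42 ^ k : ℕ)) →
      ∃ t < m * 42 ^ k / 42, G k (b t)) (k : ℕ) :
    ∀ a, G k a → (∀ c, (∀ i, |c i - a i| ≤ (m * 42 ^ k : ℕ)) → |nbrSum f c| ≤ κ * |f c|) →
      ∃ T : Finset Lattice3, 44 ^ #{j ∈ range k | clean j} ≤ #T ∧
        (∀ x ∈ T, G 0 x ∧ |f a| ≤ (κ + 5) ^ (2 * (m * 42 ^ k)) * |f x| ∧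
          ∀ i, |x i - a i| + m ≤ (m * 42 ^ k : ℕ)) ∧
        ∀ x ∈ T, ∀ y ∈ T, x ≠ y → ∃ i, 2 * m < |x i - y i| := by
  have hY : 1 ≤ κ + 5 := by linarith
  induction k with
  | zero =>
    intro a ha hf
    refine ⟨{a}, by simp, fun x hx => ?_, fun x hx y hy hxy => ?_⟩
    · rw [mem_singleton] at hx
      subst hx
      exact ⟨ha, le_mul_of_one_le_left (abs_nonneg _) (one_le_pow₀ hY), by simp⟩
    · rw [mem_singleton] at hx hy
      exact absurd (hx.trans hy.symm) hxy
  | succ k ih =>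
    intro a ha hf
    set R := m * 42 ^ k with hR
    have hR' : m * 42 ^ (k + 1) = 42 * R := by rw [hR, pow_succ]; ring
    rw [hR'] at hf ⊢
    have hmR : m ≤ R := Nat.le_mul_of_pos_right m (by positivity)
    by_cases hc : clean k
    · rw [range_add_one, filter_insert, if_pos hc, card_insert_of_notMem (by simp), pow_succ]
      obtain ⟨x, hx, hsep⟩ := exists_forty_four_children (R := R) (L := R / 42) (P := G k) hκ
        (by omega) (by omega) (hG k a ha) (fun c hc => hf c (by push_cast; exact hc))
        (hclean k a hc ha)
      have hfx : ∀ j (c : Lattice3), (∀ i, |c i - x j i| ≤ R) → ∀ i, |c i - a i| ≤ (42 * R : ℕ) :=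
        fun j c hc i => by
          have h1 := (hx j).2.2 i
          have h2 := hc i
          have h3 := abs_sub_le (c i) (x j i) (a i)
          push_cast
          omega
      choose T hT1 hT2 hT3 using fun j => ih (x j) (hx j).1 fun c hc => hf c (hfx j c hc)
      refine ⟨univ.biUnion T, ?_, fun y hy => ?_, fun y hy y' hy' hne => ?_⟩
      · rw [card_biUnion]
        · refine le_trans ?_ (card_nsmul_le_sum univ _ _ fun j _ => hT1 j)
          simp [mul_comm]
        -- The invariant `|x i - a i| + m ≤ m 42 ^ k` keeps whole cubes of radius `m` inside those
        -- of the ancestors, so disjointness passes down the tree.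
        · intro j _ j' _ hjj
          rw [Function.onFun, disjoint_left]
          intro y hy hy'
          obtain ⟨i, hi⟩ := hsep j j' hjj
          have h1 := (hT2 j y hy).2.2 i
          have h2 := (hT2 j' y hy').2.2 i
          have h3 := abs_sub_le (x j i) (y i) (x j' i)
          rw [abs_sub_comm (x j i) (y i)] at h3
          omega
      · simp only [mem_biUnion, mem_univ, true_and] at hy
        obtain ⟨j, hy⟩ := hy
        obtain ⟨h1, h2, h3⟩ := hT2 j y hy
        refine ⟨h1, ?_, fun i => ?_⟩
        · calc |f a| ≤ (κ + 5) ^ (42 * R) * |f (x j)| := (hx j).2.1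
            _ ≤ (κ + 5) ^ (42 * R) * ((κ + 5) ^ (2 * R) * |f y|) := by gcongr
            -- The walking distances form a geometric series: `42 R + 2 R ≤ 2 · 42 R` closes the
            -- induction.
            _ = (κ + 5) ^ (44 * R) * |f y| := by rw [← mul_assoc, ← pow_add]; ring_nf
            _ ≤ _ := mul_le_mul_of_nonneg_right (pow_le_pow_right₀ hY (by omega)) (abs_nonneg _)
        · have h4 := (hx j).2.2 i
          have h5 := h3 i
          have h6 := abs_sub_le (y i) (x j i) (a i)
          push_cast
          omega
      · simp only [mem_biUnion, mem_univ, true_and] at hy hy'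
        obtain ⟨j, hy⟩ := hy
        obtain ⟨j', hy'⟩ := hy'
        by_cases hjj : j = j'
        · subst hjj
          exact hT3 j y hy y' hy' hne
        · obtain ⟨i, hi⟩ := hsep j j' hjj
          refine ⟨i, ?_⟩
          have h1 := (hT2 j y hy).2.2 i
          have h2 := (hT2 j' y' hy').2.2 i
          have h3 := abs_sub_le (x j i) (y i) (x j' i)
          have h4 := abs_sub_le (y i) (y' i) (x j' i)
          rw [abs_sub_comm (x j i) (y i)] at h3
          omega
    -- At a scale that is not clean the point is simply kept, without branching.
    · rw [range_add_one, filter_insert, if_neg hc]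
      obtain ⟨T, h1, h2, h3⟩ := ih a (hG k a ha) fun c hc => hf c fun i => by
        have := hc i
        push_cast
        omega
      refine ⟨T, h1, fun x hx => ⟨(h2 x hx).1, (h2 x hx).2.1.trans ?_, fun i => ?_⟩, h3⟩
      · exact mul_le_mul_of_nonneg_right (pow_le_pow_right₀ hY (by omega)) (abs_nonneg _)
      · have := (h2 x hx).2.2 i
        push_cast at this ⊢
        omega

/-! ### Good points and clean scales -/

/-- The point `a` is far from the balls with centres `c i j s` and radii `l i`, `i ∈ I`, up to scale
`ρ`. -/
def IsGoodPoint {N d : ℕ} (l : Fin d → ℝ) (c : Fin d → ℕ → Fin N → Space3) (I : Finset (Fin d))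
    (ρ : ℝ) (a : Lattice3) : Prop :=
  ∀ i ∈ I, ∀ j s, 2 * l i + min (l i) (4 * ρ) ≤ dist (latticePoint a) (c i j s)

/-- No scale length is comparable to `R`. -/
def IsCleanScale (N : ℕ) {d : ℕ} (l : Fin d → ℝ) (I : Finset (Fin d)) (R : ℝ) : Prop :=
  ∀ i ∈ I, 2000 * N * l i ≤ R ∨ 168 * R ≤ l i

section
variable {N d : ℕ} {l : Fin d → ℝ} {ε X : ℝ} {c : Fin d → ℕ → Fin N → Space3} {I : Finset (Fin d)}

theorem IsGoodPoint.mono {ρ ρ' : ℝ} {a : Lattice3} (h : IsGoodPoint l c I ρ' a) (hρ : ρ ≤ ρ') :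
    IsGoodPoint l c I ρ a := fun i hi j s =>
  le_trans (by gcongr) (h i hi j s)

/-- The tripled balls occupy at most `L / 100` of the times through their density, and at most `L /
2` through the boundary terms, which `36 N l i ≤ L` controls. -/
theorem IsBallSystem.exists_far (h : IsBallSystem N l ε X c) (hX : 1 ≤ X) (hε : 0 < ε)
    (h2 : 2 ≤ X ^ (2 * ε ^ 2)) (hN : 0 < N) (hNX : 19200 * (N : ℝ) ≤ X ^ ε) {L : ℕ} (hL : 1 ≤ L)
    {b : ℕ → Space3} (hb : IsQuasiPath L b) (I : Finset (Fin d))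
    (hI : ∀ i ∈ I, 36 * N * l i ≤ L) :
    ∃ t < L, ∀ i ∈ I, ∀ j s, 3 * l i ≤ dist (b t) (c i j s) := by
  classical
  by_contra hcon
  push Not at hcon
  have hN1 : (1 : ℝ) ≤ N := by exact_mod_cast hN
  have hL1 : (1 : ℝ) ≤ L := by exact_mod_cast hL
  have hXε : 0 < X ^ ε := Real.rpow_pos_of_pos (by linarith) _
  have key := h.card_near_le hX hε h2 (D := 3) (by norm_num) (by linarith) hb I
    (Λ := L / (36 * N)) (by positivity) (fun i hi => by
      rw [le_div_iff₀ (by positivity)]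
      linarith [hI i hi])
  rw [filter_true_of_mem (fun t ht => hcon t (mem_range.1 ht)), card_range] at key
  have e1 : (N : ℝ) * 3 * (48 * L * X ^ (-ε)) ≤ L / 100 := by
    rw [Real.rpow_neg (by linarith), show (N : ℝ) * 3 * (48 * L * (X ^ ε)⁻¹) =
      (144 * N * L) / X ^ ε by ring, div_le_iff₀ hXε]
    nlinarith
  have e2 : (N : ℝ) * 3 * (6 * (L / (36 * N))) = L / 2 := by field_simp; norm_num
  rw [mul_add, e2] at key
  linarith

/-- At a clean scale, balls much smaller than `R` are avoided by choosing a suitable time on the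
path. From balls with `l i ≥ 168 R` the point `a` has the spare distance `168 R`, and moving by `84
R` leaves more than the `4 R` required. -/
theorem IsGoodPoint.exists_near (h : IsBallSystem N l ε X c) (hX : 1 ≤ X) (hε : 0 < ε)
    (h2 : 2 ≤ X ^ (2 * ε ^ 2)) (hN : 0 < N) (hNX : 19200 * (N : ℝ) ≤ X ^ ε) {R : ℕ} (hR : 500 ≤ R)
    (hclean : IsCleanScale N l I R) {a : Lattice3} (ha : IsGoodPoint l c I (42 * R) a)
    {b : ℕ → Lattice3} (hb : IsQuasiPath (R / 42) (fun t => latticePoint (b t)))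
    (hba : ∀ t < R / 42, dist (latticePoint a) (latticePoint (b t)) ≤ 84 * R) :
    ∃ t < R / 42, IsGoodPoint l c I R (b t) := by
  classical
  have hRL : (R : ℝ) ≤ 50 * (R / 42 : ℕ) := by
    have : R ≤ 50 * (R / 42) := by omega
    exact_mod_cast this
  have hl : ∀ i, 0 < l i := fun i => by linarith [h.le i]
  obtain ⟨t, ht, hfar⟩ := h.exists_far hX hε h2 hN hNX (by omega) hb
    {i ∈ I | 2000 * N * l i ≤ R} (fun i hi => by
      have := (mem_filter.1 hi).2
      nlinarith)
  refine ⟨t, ht, fun i hi j s => ?_⟩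
  rcases hclean i hi with hi' | hi'
  · have := hfar i (mem_filter.2 ⟨hi, hi'⟩) j s
    have := min_le_left (l i) (4 * R)
    linarith
  · have h1 := ha i hi j s
    have h3 := dist_triangle (latticePoint a) (latticePoint (b t)) (c i j s)
    have h4 := hba t ht
    rw [min_eq_right (by linarith)] at h1 ⊢
    linarith [(Nat.cast_nonneg R : (0 : ℝ) ≤ R)]

/-- Iterating `l i ^ (1 + 2 ε) ≤ l j` makes the largest length a power of `x` whose exponent is
exponential in the number of lengths. Hence only boundedly many scale lengths lie between `n ^ (1 /
4)` and `n`. -/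
theorem IsBallSystem.rpow_card_le (h : IsBallSystem N l ε X c) (hε : 0 < ε) {x : ℝ} (hx : 1 ≤ x)
    (I : Finset (Fin d)) (hI : ∀ i ∈ I, x ≤ l i) :
    I = ∅ ∨ ∃ i ∈ I, x ^ ((1 + 2 * ε) ^ (#I - 1)) ≤ l i := by
  induction I using Finset.induction_on_max with
  | empty => exact Or.inl rfl
  | insert a s ha ih =>
    right
    refine ⟨a, mem_insert_self a s, ?_⟩
    have has : a ∉ s := fun h => lt_irrefl _ (ha a h)
    rw [card_insert_of_notMem has, Nat.add_sub_cancel]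
    rcases ih (fun i hi => hI i (mem_insert_of_mem hi)) with h0 | ⟨i, hi, hle⟩
    · rw [h0]
      simpa using hI a (mem_insert_self a s)
    · refine le_trans ?_ (h.geometric i a (ha i hi))
      have h1 : #s = (#s - 1) + 1 := by
        have := card_pos.2 ⟨i, hi⟩; omega
      rw [h1, pow_succ, Real.rpow_mul (by linarith)]
      exact Real.rpow_le_rpow (Real.rpow_nonneg (by linarith) _) hle (by linarith)

theorem IsBallSystem.card_scales_le (h : IsBallSystem N l ε X c) (hε : 0 < ε) {n : ℝ} (hn : 1 < n)
    {B : ℕ} (hB : 4 < (1 + 2 * ε) ^ B) (I : Finset (Fin d))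
    (hI : ∀ i ∈ I, n ^ (1 / 4 : ℝ) ≤ l i ∧ l i ≤ n) : #I ≤ B := by
  rcases h.rpow_card_le hε (Real.one_le_rpow hn.le (by norm_num)) I (fun i hi => (hI i hi).1) with
    h0 | ⟨i, hi, hle⟩
  · rw [h0]; simp
  · have h1 := hle.trans (hI i hi).2
    rw [← Real.rpow_mul (by linarith)] at h1
    nth_rewrite 2 [← Real.rpow_one n] at h1
    rw [Real.rpow_le_rpow_left_iff hn] at h1
    by_contra hlt
    have h2 : (1 + 2 * ε) ^ B ≤ (1 + 2 * ε) ^ (#I - 1) :=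
      pow_le_pow_right₀ (by linarith) (by omega)
    linarith

-- A scale length spoils only those `m 42 ^ j` that lie within a window of ratio `2000 N · 168 =
-- 336000 N ≤ 42 ^ B`, hence at most `B` values of `j`.
open scoped Classical in
theorem card_not_isCleanScale_le {m B : ℕ} (hN : 0 < N)
    (hB : 336000 * N ≤ 42 ^ B) (k : ℕ) :
    #{j ∈ range k | ¬ IsCleanScale N l I (m * 42 ^ j : ℕ)} ≤ #I * B := by
  have hB1 : 1 ≤ B := by
    rcases Nat.eq_zero_or_pos B with rfl | h
    · simp at hB; omega
    · exact h
  have hsub : {j ∈ range k | ¬ IsCleanScale N l I (m * 42 ^ j : ℕ)} ⊆ I.biUnion fun i =>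
      {j ∈ range k | ((m * 42 ^ j : ℕ) : ℝ) < 2000 * N * l i ∧ l i < 168 * (m * 42 ^ j : ℕ)} := by
    intro j hj
    rw [mem_filter] at hj
    obtain ⟨hj, h⟩ := hj
    simp only [IsCleanScale] at h
    push Not at h
    obtain ⟨i, hi, h1, h2⟩ := h
    exact mem_biUnion.2 ⟨i, hi, mem_filter.2 ⟨hj, h1, h2⟩⟩
  refine (card_le_card hsub).trans (card_biUnion_le.trans
    ((sum_le_card_nsmul _ _ B fun i _ => ?_).trans (by simp)))
  have hcard := card_le_of_diff_lt (S := {j ∈ range k | ((m * 42 ^ j : ℕ) : ℝ) < 2000 * N * l i ∧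
    l i < 168 * (m * 42 ^ j : ℕ)}) (ρ := (B - 1 : ℕ)) (Nat.cast_nonneg _) (fun s hs t ht hst => by
      have h1 := (mem_filter.1 hs).2.2
      have h2 := (mem_filter.1 ht).2.1
      have hN0 : (0 : ℝ) < 2000 * N := by
        have : (0 : ℝ) < N := by exact_mod_cast hN
        linarith
      have h3 : ((m * 42 ^ t : ℕ) : ℝ) < 2000 * N * (168 * (m * 42 ^ s : ℕ)) :=
        h2.trans (mul_lt_mul_of_pos_left h1 hN0)
      have h4 : m * 42 ^ t < 2000 * N * (168 * (m * 42 ^ s)) := by exact_mod_cast h3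
      have h5 : m * 42 ^ t < m * 42 ^ (B + s) := by
        refine h4.trans_le ?_
        rw [pow_add]
        calc 2000 * N * (168 * (m * 42 ^ s)) = (336000 * N) * (m * 42 ^ s) := by ring
          _ ≤ 42 ^ B * (m * 42 ^ s) := Nat.mul_le_mul_right _ hB
          _ = _ := by ring
      have h6 : t < B + s := (Nat.pow_lt_pow_iff_right (by norm_num)).1
        (Nat.lt_of_mul_lt_mul_left h5)
      rw [← Nat.cast_sub hst]
      exact_mod_cast (by omega : t - s ≤ B - 1))
  have : (#{j ∈ range k | ((m * 42 ^ j : ℕ) : ℝ) < 2000 * N * l i ∧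
    l i < 168 * (m * 42 ^ j : ℕ)} : ℝ) ≤ ((B - 1 + 1 : ℕ) : ℝ) := by rw [Nat.cast_add, Nat.cast_one]; exact hcard
  have h2 : B - 1 + 1 = B := by omega
  rw [h2] at this
  exact_mod_cast this

end

/-! ### Combining the tree with the local estimate -/

open scoped Classical in
/-- The lower bound for the number of large points, in terms of the size `4 m` of the cubes on which
the local estimate is applied and the number `k` of scales of the tree. -/
theorem card_large_ge_of_tree {N d : ℕ} {l : Fin d → ℝ} {ε X : ℝ}
    {c : Fin d → ℕ → Fin N → Space3} {z : ℕ → Lattice3} {I : Finset (Fin d)}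
    (h : IsBallSystem N l ε X c) (hX : 1 ≤ X) (hε : 0 < ε) (h2 : 2 ≤ X ^ (2 * ε ^ 2)) (hN : 0 < N)
    (hDX : 10 ^ 17 * (N : ℝ) ^ 3 ≤ X ^ ε) (hε' : 10 ^ 15 ≤ ε⁻¹)
    (hz : ∀ j j', j ≠ j' → ε⁻¹ ≤ dist (latticePoint (z j)) (latticePoint (z j')))
    {n m k B₁ B₂ : ℕ} (hm : 10 ^ 15 ≤ m) (hmn : (n : ℝ) ^ (1 / 4 : ℝ) ≤ 8 * m)
    (hkn : 8 * (4 * m * 42 ^ k) ≤ n) (hIn : ∀ i ∈ I, 10 ^ 4 * N * l i ≤ n)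
    (hIm : ∀ i ∈ I, 10 ^ 14 * (N : ℝ) ^ 3 * l i ≤ m ∨ 8 * m < l i)
    (hB₁ : 4 < (1 + 2 * ε) ^ B₁) (hB₂ : 336000 * N ≤ 42 ^ B₂)
    {u : Lattice3 → ℝ} {κ W θ : ℝ} (hκ : 0 ≤ κ) (hκW : κ + 5 ≤ W) (hmW : 50 * (m : ℝ) ≤ W)
    (hθ : 0 ≤ θ) (hu : ∀ b, (∀ k, |b k| ≤ (n : ℤ)) → |nbrSum u b| ≤ κ * |u b|)
    (hθu : (κ + 5) ^ (2 * n) * W ^ (100 * m ^ 2) * θ < |u 0|)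
    {E : Set Lattice3} (hE : ∀ a : Lattice3, (∀ k, |a k| ≤ (n : ℤ)) → a ∈ E →
      (∃ j, dist (latticePoint a) (latticePoint (z j)) < 1) ∨
        ∃ i ∈ I, ∃ j s, dist (latticePoint a) (c i j s) < l i)
    {A : Finset Lattice3} (hA : ∀ a : Lattice3, (∀ k, |a k| ≤ (n : ℤ)) → a ∉ E → θ ≤ |u a| → a ∈ A) :
    44 ^ (k - B₁ * B₂) * m ^ 2 ≤ 10 ^ 10 * (Nat.log 2 (5 * m) + 1) * #A := by
  have hN1 : (1 : ℝ) ≤ N := by exact_mod_cast hN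
  have hN3 : (N : ℝ) ≤ (N : ℝ) ^ 3 := by nlinarith [sq_nonneg (N : ℝ), mul_self_nonneg (N - 1 : ℝ)]
  have hNX : 19200 * (N : ℝ) ≤ X ^ ε := by linarith
  have hY : 1 ≤ κ + 5 := by linarith
  have hl : ∀ i, 0 < l i := fun i => by linarith [h.le i]
  have h42 : m ≤ m * 42 ^ k := Nat.le_mul_of_pos_right m (by positivity)
  have hn : 32 * 10 ^ 15 ≤ n := by
    rw [mul_assoc] at hkn
    omega
  -- Lengths above `8 m` are handled by the tree, the others by the local estimate. The origin may
  -- lie in or near such a large ball, so the tree starts from a point of a walk from `0` at height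
  -- between `n / 4` and `3 n / 8`.
  set I' := {i ∈ I | 8 * (m : ℝ) < l i} with hI'
  have hI'n : ∀ i ∈ I', 10 ^ 4 * N * l i ≤ n := fun i hi => hIn i (mem_filter.1 hi).1
  -- a good starting point
  obtain ⟨b, hb0, hb, hub⟩ := exists_chain u hκ 2 (σ := 1) (Or.inl rfl) 0
  obtain ⟨t₀, ht₀⟩ := exists_window hb (n / 4) (n / 16)
  obtain ⟨t, ht, hfar⟩ := h.exists_far hX hε h2 hN hNX (L := n / 16) (by omega)
    (isQuasiPath_chain (Or.inl rfl) hb (n / 16) t₀) I' (fun i hi => by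
      have h1 := hI'n i hi
      have h3 : (n : ℝ) ≤ 20 * (n / 16 : ℕ) := by
        have : n ≤ 20 * (n / 16) := by omega
        exact_mod_cast this
      nlinarith [hl i])
  set a := b (t₀ + t) with ha
  have hheight := ht₀ t ht
  rw [hb0, ← ha] at hheight
  simp only [Pi.zero_apply, sub_zero, one_mul] at hheight
  have hcone := hb 0 (t₀ + t) (by omega)
  rw [hb0, ← ha] at hcone
  have hbox : ∀ s ≤ t₀ + t, ∀ k, |b s k| ≤ a 2 := fun s hs k => by
    have h1 := hb 0 s (by omega)
    rw [hb0] at h1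
    have h3 := h1.abs_le (Or.inl rfl) (by push_cast; omega) k
    have h4 := (hb s (t₀ + t) hs).1
    rw [← ha] at h4
    simp only [Pi.zero_apply, sub_zero, one_mul] at h3 h4
    omega
  have hua : |u 0| ≤ (κ + 5) ^ n * |u a| := by
    refine (hub (t₀ + t) fun s hs => hu _ fun k => ?_).trans
      (mul_le_mul_of_nonneg_right (pow_le_pow_right₀ hY ?_) (abs_nonneg _))
    · have h1 := hbox s hs.le k
      have h3 := abs_add_le (b s k) ((Pi.single 2 1 : Lattice3) k)
      have h4 : |(Pi.single 2 1 : Lattice3) k| ≤ 1 := by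
        rw [Pi.single_apply]; split_ifs <;> simp
      rw [Pi.add_apply]
      omega
    · have h1 := hcone.1
      simp only [Pi.zero_apply, sub_zero, one_mul] at h1
      push_cast at h1
      omega
  have habox : ∀ k, |a k| ≤ a 2 := hbox (t₀ + t) le_rfl
  -- the tree of good points
  obtain ⟨T, hT, hTx, hTsep⟩ := exists_separated_points (f := u) hκ (m := 4 * m) (by omega)
    (G := fun k => IsGoodPoint l c I' (4 * m * 42 ^ k : ℕ))
    (clean := fun k => IsCleanScale N l I' (4 * m * 42 ^ k : ℕ))
    (fun k x hx => hx.mono (by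
      have : 4 * m * 42 ^ k ≤ 4 * m * 42 ^ (k + 1) := by gcongr <;> omega
      exact_mod_cast this))
    (fun k x hk hx b hb hbx => by
      have : m ≤ m * 42 ^ k := Nat.le_mul_of_pos_right m (by positivity)
      refine IsGoodPoint.exists_near h hX hε h2 hN hNX (by rw [mul_assoc]; omega) hk ?_ hb hbx
      have e : ((4 * m * 42 ^ (k + 1) : ℕ) : ℝ) = 42 * (4 * m * 42 ^ k : ℕ) := by push_cast; ring
      rwa [e] at hx)
    k a (fun i hi j s => by
      have h1 := hfar i hi j s
      have h3 := min_le_left (l i) (4 * (4 * m * 42 ^ k : ℕ))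
      linarith)
    (fun x hx => hu x fun i => by
      have h1 := hx i
      have h3 := habox i
      have h4 := abs_sub_abs_le_abs_sub (x i) (a i)
      have h5 : 8 * ((4 * m * 42 ^ k : ℕ) : ℤ) ≤ n := by exact_mod_cast hkn
      omega)
  have hTbox : ∀ x ∈ T, ∀ v : Lattice3, (∀ k, |v k - x k| ≤ 4 * m) → ∀ k, |v k| ≤ n :=
    fun x hx v hv i => by
      have h0 := (hTx x hx).2.2 i
      have h1 := hv i
      have h3 := habox i
      have h4 := abs_sub_abs_le_abs_sub (v i) (a i)
      have h5 : 8 * ((4 * m * 42 ^ k : ℕ) : ℤ) ≤ n := by exact_mod_cast hkn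
      have h6 := abs_sub_le (v i) (x i) (a i)
      push_cast at h0 h5
      omega
  -- the local estimate
  have hlocal : ∀ x ∈ T, m ^ 2 ≤ 10 ^ 10 * (Nat.log 2 (5 * m) + 1) *
      #{v ∈ A | ∀ k, |v k - x k| ≤ 4 * m} := by
    intro x hx
    obtain ⟨hgood, hux, -⟩ := hTx x hx
    refine card_large_ge_of_nearSet (I := {i ∈ I | 10 ^ 14 * (N : ℝ) ^ 3 * l i ≤ m}) (θ := θ)
      (W := W) (κ := κ) (f := u) (a := x) h hX hε h2 hN hDX hε' hz hm
      (fun i hi => (mem_filter.1 hi).2) hκ hκW hmW hθ (fun b hb => hu b (hTbox x hx b hb))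
      (fun v hv hvE hvθ => mem_filter.2 ⟨hA v (hTbox x hx v hv) (fun hvE' => hvE ?_) hvθ.le, hv⟩) ?_
    · rcases hE v (hTbox x hx v hv) hvE' with ⟨j, hj⟩ | ⟨i, hi, j, s, hd⟩
      · exact Or.inr ⟨j, hj⟩
      · rcases hIm i hi with him | him
        · exact Or.inl ⟨i, mem_filter.2 ⟨hi, him⟩, j, s, by rwa [one_mul]⟩
        · exfalso
          have h1 := hgood i (mem_filter.2 ⟨hi, him⟩) j s
          have h3 := dist_triangle (latticePoint x) (latticePoint v) (c i j s)
          have h4 : dist (latticePoint x) (latticePoint v) ≤ 2 * (4 * m) := by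
            rw [dist_comm]
            exact dist_latticePoint_le fun k => by exact_mod_cast hv k
          -- Goodness at the bottom scale leaves the spare distance `8 m`, which covers the cube of
          -- radius `4 m` around `x`. So no ball of radius above `8 m` meets this cube.
          have h5 : 8 * (m : ℝ) ≤ min (l i) (4 * (4 * m * 42 ^ 0 : ℕ)) := by
            refine le_min him.le ?_
            push_cast
            linarith [(Nat.cast_nonneg m : (0 : ℝ) ≤ m)]
          linarith
    · have h1 : |u 0| ≤ (κ + 5) ^ (2 * n) * |u x| := by
        calc |u 0| ≤ (κ + 5) ^ n * |u a| := hua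
          _ ≤ (κ + 5) ^ n * ((κ + 5) ^ n * |u x|) := by
            refine mul_le_mul_of_nonneg_left (hux.trans ?_) (by positivity)
            exact mul_le_mul_of_nonneg_right (pow_le_pow_right₀ hY (by omega)) (abs_nonneg _)
          _ = _ := by rw [← mul_assoc, ← pow_add]; ring_nf
      have h3 := hθu.trans_le h1
      rw [mul_assoc] at h3
      exact lt_of_mul_lt_mul_left h3 (by positivity)
  have hsum : ∑ x ∈ T, #{v ∈ A | ∀ k, |v k - x k| ≤ 4 * m} ≤ #A := by
    rw [← card_biUnion]
    · exact card_le_card fun v hv => by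
        simp only [mem_biUnion, mem_filter] at hv
        exact hv.choose_spec.2.1
    · intro x hx y hy hxy
      rw [Function.onFun, disjoint_left]
      intro v hv hv'
      obtain ⟨i, hi⟩ := hTsep x hx y hy hxy
      have h1 := (mem_filter.1 hv).2 i
      have h3 := (mem_filter.1 hv').2 i
      have h4 := abs_sub_le (x i) (v i) (y i)
      rw [abs_sub_comm (x i) (v i)] at h4
      push_cast at hi
      omega
  have hI'card : #I' ≤ B₁ := h.card_scales_le hε (n := n) (by
      have : 1 < n := by omega
      exact_mod_cast this) hB₁ I' (fun i hi => by
    refine ⟨hmn.trans (mem_filter.1 hi).2.le, ?_⟩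
    have := hI'n i hi
    nlinarith [hl i])
  have hcl := card_not_isCleanScale_le (l := l) (I := I') (m := 4 * m) hN hB₂ k
  have hcl2 := card_filter_add_card_filter_not (s := range k)
    (fun j => IsCleanScale N l I' (4 * m * 42 ^ j : ℕ))
  rw [card_range] at hcl2
  have hexp : k - B₁ * B₂ ≤ #{j ∈ range k | IsCleanScale N l I' (4 * m * 42 ^ j : ℕ)} := by
    have : #I' * B₂ ≤ B₁ * B₂ := Nat.mul_le_mul_right _ hI'card
    omega
  calc 44 ^ (k - B₁ * B₂) * m ^ 2 ≤ #T * m ^ 2 :=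
        Nat.mul_le_mul_right _ ((Nat.pow_le_pow_right (by norm_num) hexp).trans hT)
    _ = ∑ x ∈ T, m ^ 2 := by simp
    _ ≤ ∑ x ∈ T, 10 ^ 10 * (Nat.log 2 (5 * m) + 1) * #{v ∈ A | ∀ k, |v k - x k| ≤ 4 * m} :=
        sum_le_sum hlocal
    _ = 10 ^ 10 * (Nat.log 2 (5 * m) + 1) * ∑ x ∈ T, #{v ∈ A | ∀ k, |v k - x k| ≤ 4 * m} :=
        (mul_sum _ _ _).symm
    _ ≤ _ := Nat.mul_le_mul_left _ hsum

/-! ### Exponents and the choice of the local scale -/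

/-- This numerical fact puts the final exponent above `3 / 2`: it is the gain of forty-four
descendants over the scale ratio. -/
theorem forty_two_rpow_le : (42 : ℝ) ^ (101 / 100 : ℝ) ≤ 44 := by
  refine le_of_pow_le_pow_left₀ (n := 100) (by norm_num) (by norm_num) ?_
  rw [← Real.rpow_natCast, ← Real.rpow_mul (by norm_num)]
  norm_num

theorem log_fifty_mul_le {x m : ℝ} (hx : 1 ≤ x) (hm : 0 < m) (hmx : m ≤ x ^ (0.499 : ℝ))
    (hx1 : 50000 ≤ x ^ (0.0005 : ℝ)) : Real.log (50 * m) ≤ x ^ (0.001 : ℝ) := by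
  have hx0 : 0 < x := by linarith
  have h1 := Real.log_le_rpow_div (x := 50 * m) (by positivity) (ε := 0.001) (by norm_num)
  refine h1.trans ?_
  have h2 : (50 * m) ^ (0.001 : ℝ) ≤ 50 * x ^ (0.0005 : ℝ) := by
    rw [Real.mul_rpow (by norm_num) hm.le]
    gcongr
    · exact Real.rpow_le_self_of_one_le (by norm_num) (by norm_num)
    · calc m ^ (0.001 : ℝ) ≤ (x ^ (0.499 : ℝ)) ^ (0.001 : ℝ) :=
          Real.rpow_le_rpow hm.le hmx (by norm_num)
        _ = x ^ (0.000499 : ℝ) := by rw [← Real.rpow_mul hx0.le]; norm_num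
        _ ≤ _ := Real.rpow_le_rpow_of_exponent_le hx (by norm_num)
  have h3 : x ^ (0.001 : ℝ) = x ^ (0.0005 : ℝ) * x ^ (0.0005 : ℝ) := by
    rw [← Real.rpow_add hx0]; norm_num
  rw [h3, div_le_iff₀ (by norm_num)]
  nlinarith

theorem natLog_le {m : ℕ} (hm : 1 ≤ m) : (Nat.log 2 (5 * m) : ℝ) ≤ 2 * Real.log (50 * m) := by
  have hm' : (1 : ℝ) ≤ m := by exact_mod_cast hm
  have h1 : ((2 ^ Nat.log 2 (5 * m) : ℕ) : ℝ) ≤ (5 * m : ℕ) := by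
    exact_mod_cast Nat.pow_log_le_self 2 (by omega)
  have h2 : (2 : ℝ) ^ Nat.log 2 (5 * m) ≤ 50 * m := by push_cast at h1; linarith
  have h3 := Real.log_le_log (by positivity) h2
  rw [Real.log_pow] at h3
  have h4 : (Nat.log 2 (5 * m) : ℝ) * (1 / 2) ≤ Nat.log 2 (5 * m) * Real.log 2 := by
    gcongr
    linarith [Real.log_two_gt_d9]
  linarith

/-- With `42 ^ k` comparable to `n / m ≥ n ^ 0.501`, the tree gives about `n ^ 0.506` cubes, as
`0.501 · 1.01 > 0.506`, and `m²` is at least `n ^ 0.997`. The product `n ^ 1.503` leaves `n ^ 0.001`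
for the logarithm and `n ^ 0.001` for the constants. The number `1344 = 42 · 32` comes from rounding
`k`. -/
theorem rpow_le_tree_count {n m b : ℕ} (hn : (1 : ℝ) ≤ n) (hm1 : (n : ℝ) ^ (0.4985 : ℝ) ≤ m)
    (hm2 : (m : ℝ) ≤ (n : ℝ) ^ (0.499 : ℝ)) (hx1 : 50000 ≤ (n : ℝ) ^ (0.0005 : ℝ))
    (hx2 : 3 * 10 ^ 10 * 1344 ^ 2 * 44 ^ b ≤ (n : ℝ) ^ (0.001 : ℝ)) :
    ∃ k, 8 * (4 * m * 42 ^ k) ≤ n ∧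
      (n : ℝ) ^ (1.501 : ℝ) * (10 ^ 10 * (Nat.log 2 (5 * m) + 1)) ≤
        (44 : ℝ) ^ (k - b) * (m : ℝ) ^ 2 := by
  set x : ℝ := (n : ℝ) with hx
  have hx0 : 0 < x := by linarith
  have hmR1 : (1 : ℝ) ≤ m := (Real.one_le_rpow hn (by norm_num)).trans hm1
  have hmpos : 1 ≤ m := by exact_mod_cast hmR1
  have hsplit : x = x ^ (0.499 : ℝ) * x ^ (0.501 : ℝ) := by
    rw [← Real.rpow_add hx0]; norm_num
  have h501 : 50000 ≤ x ^ (0.501 : ℝ) :=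
    hx1.trans (Real.rpow_le_rpow_of_exponent_le hn (by norm_num))
  have h499 : 0 < x ^ (0.499 : ℝ) := Real.rpow_pos_of_pos hx0 _
  have h32 : 32 * m ≤ n := by
    have : (32 : ℝ) * m ≤ x := by rw [hsplit]; nlinarith
    rw [hx] at this
    exact_mod_cast this
  have hq : n / (32 * m) ≠ 0 := (Nat.div_pos h32 (by omega)).ne'
  set k := Nat.log 42 (n / (32 * m)) with hk
  have hk1 : 42 ^ k ≤ n / (32 * m) := Nat.pow_log_le_self 42 hq
  have hk2 : n / (32 * m) < 42 ^ (k + 1) := Nat.lt_pow_succ_log_self (by norm_num) _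
  refine ⟨k, ?_, ?_⟩
  · calc 8 * (4 * m * 42 ^ k) = 32 * m * 42 ^ k := by ring
      _ ≤ 32 * m * (n / (32 * m)) := Nat.mul_le_mul_left _ hk1
      _ ≤ n := Nat.mul_div_le _ _
  · have h1 : n < 42 ^ (k + 1) * (32 * m) := (Nat.div_lt_iff_lt_mul (by omega)).1 hk2
    have h2 : x ≤ 1344 * m * 42 ^ k := by
      have : n ≤ 1344 * m * 42 ^ k := by rw [pow_succ] at h1; nlinarith
      rw [hx]
      exact_mod_cast this
    have h3 : x ^ (0.501 : ℝ) / 1344 ≤ 42 ^ k := by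
      rw [div_le_iff₀ (by norm_num)]
      refine le_of_mul_le_mul_left ?_ h499
      rw [← hsplit]
      refine h2.trans ?_
      have : (0 : ℝ) ≤ 42 ^ k := by positivity
      nlinarith
    have h4 : x ^ (0.506 : ℝ) / 1344 ^ 2 ≤ (44 : ℝ) ^ k := by
      calc x ^ (0.506 : ℝ) / 1344 ^ 2 ≤ x ^ (0.501 * (101 / 100) : ℝ) / 1344 ^ (101 / 100 : ℝ) := by
            refine div_le_div₀ (by positivity)
              (Real.rpow_le_rpow_of_exponent_le hn (by norm_num)) (by positivity) ?_
            rw [← Real.rpow_natCast]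
            exact Real.rpow_le_rpow_of_exponent_le (by norm_num) (by norm_num)
        _ = (x ^ (0.501 : ℝ) / 1344) ^ (101 / 100 : ℝ) := by
            rw [Real.div_rpow (Real.rpow_nonneg hx0.le _) (by norm_num), ← Real.rpow_mul hx0.le]
        _ ≤ ((42 : ℝ) ^ k) ^ (101 / 100 : ℝ) :=
            Real.rpow_le_rpow (by positivity) h3 (by norm_num)
        _ = ((42 : ℝ) ^ (101 / 100 : ℝ)) ^ k := by
            rw [← Real.rpow_natCast, ← Real.rpow_natCast, ← Real.rpow_mul (by norm_num),
              ← Real.rpow_mul (by norm_num), mul_comm]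
        _ ≤ 44 ^ k := pow_le_pow_left₀ (by positivity) forty_two_rpow_le k
    have h5 : (44 : ℝ) ^ k ≤ 44 ^ (k - b) * 44 ^ b := by
      rw [← pow_add]
      exact pow_le_pow_right₀ (by norm_num) (by omega)
    have h6 : x ^ (0.997 : ℝ) ≤ (m : ℝ) ^ 2 := by
      calc x ^ (0.997 : ℝ) = (x ^ (0.4985 : ℝ)) ^ 2 := by
            rw [← Real.rpow_natCast, ← Real.rpow_mul hx0.le]; norm_num
        _ ≤ (m : ℝ) ^ 2 := pow_le_pow_left₀ (by positivity) hm1 2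
    have h7 : (Nat.log 2 (5 * m) : ℝ) + 1 ≤ 3 * x ^ (0.001 : ℝ) := by
      have e1 := natLog_le hmpos
      have e2 := log_fifty_mul_le hn (by linarith) hm2 hx1
      have e3 : 1 ≤ x ^ (0.001 : ℝ) := Real.one_le_rpow hn (by norm_num)
      linarith
    have h8 : x ^ (0.506 : ℝ) / 1344 ^ 2 / 44 ^ b ≤ (44 : ℝ) ^ (k - b) := by
      rw [div_le_iff₀ (by positivity)]
      exact h4.trans h5
    calc x ^ (1.501 : ℝ) * (10 ^ 10 * (Nat.log 2 (5 * m) + 1))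
        ≤ x ^ (1.501 : ℝ) * (10 ^ 10 * (3 * x ^ (0.001 : ℝ))) := by gcongr
      _ = 3 * 10 ^ 10 * x ^ (1.502 : ℝ) := by
          rw [show (1.502 : ℝ) = 1.501 + 0.001 by norm_num, Real.rpow_add hx0]; ring
      _ ≤ x ^ (0.001 : ℝ) / (1344 ^ 2 * 44 ^ b) * x ^ (1.502 : ℝ) := by
          gcongr
          rw [le_div_iff₀ (by positivity)]
          linarith
      _ = x ^ (0.506 : ℝ) / 1344 ^ 2 / 44 ^ b * x ^ (0.997 : ℝ) := by
          have : x ^ (0.001 : ℝ) * x ^ (1.502 : ℝ) = x ^ (0.506 : ℝ) * x ^ (0.997 : ℝ) := by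
            rw [← Real.rpow_add hx0, ← Real.rpow_add hx0]; norm_num
          rw [div_mul_eq_mul_div, this]
          field_simp
      _ ≤ _ := by gcongr

/-- This is where `m` must be below `n ^ (1 / 2)`: the local loss is `exp` of `100 m² log (50 m Y)`,
and both `m²` and `m² log (50 m)` are at most `n`. -/
theorem growth_lt_exp {x Y : ℝ} {n m : ℕ} (hxn : x = n) (hx : 1 ≤ x) (hY : 1 ≤ Y) (hm : 1 ≤ m)
    (hm2 : (m : ℝ) ≤ x ^ (0.499 : ℝ)) (hx1 : 50000 ≤ x ^ (0.0005 : ℝ)) :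
    Y ^ (2 * n) * (50 * m * Y) ^ (100 * m ^ 2) <
      Real.exp ((102 * Real.log Y + 101) * x) := by
  have hx0 : 0 < x := by linarith
  have hmR : (1 : ℝ) ≤ m := by exact_mod_cast hm
  rw [← Real.log_lt_iff_lt_exp (by positivity), Real.log_mul (by positivity) (by positivity),
    Real.log_pow, Real.log_pow, Real.log_mul (by positivity) (by positivity)]
  have h1 := log_fifty_mul_le hx (by linarith) hm2 hx1
  have h2 : (m : ℝ) ^ 2 ≤ x ^ (0.998 : ℝ) := by
    calc (m : ℝ) ^ 2 ≤ (x ^ (0.499 : ℝ)) ^ 2 := pow_le_pow_left₀ (by positivity) hm2 2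
      _ = x ^ (0.998 : ℝ) := by rw [← Real.rpow_natCast, ← Real.rpow_mul hx0.le]; norm_num
  have h3 : (m : ℝ) ^ 2 ≤ x := h2.trans (by
    nth_rewrite 2 [← Real.rpow_one x]
    exact Real.rpow_le_rpow_of_exponent_le hx (by norm_num))
  have h0 : 0 ≤ Real.log (50 * m) := Real.log_nonneg (by linarith)
  have h4 : (m : ℝ) ^ 2 * Real.log (50 * m) ≤ x := by
    calc (m : ℝ) ^ 2 * Real.log (50 * m) ≤ x ^ (0.998 : ℝ) * x ^ (0.001 : ℝ) := by gcongr
      _ = x ^ (0.999 : ℝ) := by rw [← Real.rpow_add hx0]; norm_num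
      _ ≤ x := by
        nth_rewrite 2 [← Real.rpow_one x]
        exact Real.rpow_le_rpow_of_exponent_le hx (by norm_num)
  have hlY : 0 ≤ Real.log Y := Real.log_nonneg hY
  push_cast
  rw [← hxn]
  nlinarith [mul_le_mul_of_nonneg_right h3 hlY]

/-- Two candidates for the size of the cubes, far apart but polynomially close. -/
theorem eventually_exists_sizes {ε : ℝ} (hε : 0 < ε) {N : ℕ} (hN : 0 < N) :
    ∀ᶠ n : ℕ in atTop, ∃ m₁ m₂ : ℕ, (∀ m : ℕ, m = m₁ ∨ m = m₂ →
      (n : ℝ) ^ (0.4985 : ℝ) ≤ m ∧ (m : ℝ) ≤ (n : ℝ) ^ (0.499 : ℝ)) ∧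
      8 * (m₂ : ℝ) * (10 ^ 14 * (N : ℝ) ^ 3) ≤ m₁ ∧
      8 * (m₁ : ℝ) < (m₂ / (10 ^ 14 * (N : ℝ) ^ 3)) ^ (1 + 2 * ε) := by
  -- The sizes are `⌊n ^ 0.499⌋` and its quotient by `Q`. Their ratio exceeds `8 · 10 ^ 14 N³`, yet
  -- for large `n` any constant is beaten by the power `2 ε` of `n ^ 0.499`.
  set Q : ℕ := 10 ^ 15 * N ^ 3 with hQ
  set C : ℝ := 4 * Q * (10 ^ 14 * (N : ℝ) ^ 3) with hC
  have hQ1 : 1 ≤ Q := Nat.one_le_iff_ne_zero.2 (by positivity)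
  have hQR : (1 : ℝ) ≤ Q := by exact_mod_cast hQ1
  have hN0 : (0 : ℝ) < N := by exact_mod_cast hN
  have hCpos : 0 < C := by positivity
  have hcast := tendsto_natCast_atTop_atTop (R := ℝ)
  filter_upwards [((tendsto_rpow_atTop (y := 0.0005) (by norm_num)).comp hcast).eventually_ge_atTop
    (4 * Q : ℝ), (((tendsto_rpow_atTop (y := 2 * ε) (by positivity)).comp
    ((tendsto_rpow_atTop (y := 0.499) (by norm_num)).comp hcast))).eventually_gt_atTop
    (8 * C ^ (1 + 2 * ε)), hcast.eventually_ge_atTop 1] with n h1 h2 hn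
  simp only [Function.comp_apply] at h1 h2
  set x : ℝ := (n : ℝ) with hx
  have hx0 : 0 < x := by linarith
  set y : ℝ := x ^ (0.499 : ℝ) with hy
  have hy4985 : y = x ^ (0.4985 : ℝ) * x ^ (0.0005 : ℝ) := by
    rw [hy, ← Real.rpow_add hx0]; norm_num
  have h4985 : 1 ≤ x ^ (0.4985 : ℝ) := Real.one_le_rpow hn (by norm_num)
  have hyQ : 4 * Q * x ^ (0.4985 : ℝ) ≤ y := by rw [hy4985]; nlinarith
  have hy0 : 0 < y := by positivity
  have hyQ' : 4 * (Q : ℝ) ≤ y := by nlinarith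
  have hm1 : (⌊y⌋₊ : ℝ) ≤ y := Nat.floor_le hy0.le
  have hm1' : y < ⌊y⌋₊ + 1 := Nat.lt_floor_add_one y
  have hm2 : ((⌊y⌋₊ / Q : ℕ) : ℝ) * Q ≤ ⌊y⌋₊ := by exact_mod_cast Nat.div_mul_le_self _ _
  have hm2' : (⌊y⌋₊ : ℝ) < (((⌊y⌋₊ / Q : ℕ) : ℝ) + 1) * Q := by
    have := Nat.lt_div_mul_add (a := ⌊y⌋₊) (b := Q) (by omega)
    rw [add_mul, one_mul]
    exact_mod_cast this
  set m₂ : ℝ := ((⌊y⌋₊ / Q : ℕ) : ℝ) with hm₂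
  have hm20 : 0 ≤ m₂ := Nat.cast_nonneg _
  have hm24 : y ≤ 4 * Q * m₂ := by nlinarith
  have hm2low : x ^ (0.4985 : ℝ) ≤ m₂ := by
    have : 4 * (Q : ℝ) * x ^ (0.4985 : ℝ) ≤ 4 * Q * m₂ := hyQ.trans hm24
    exact le_of_mul_le_mul_left this (by positivity)
  have hm21 : m₂ ≤ ⌊y⌋₊ := by nlinarith
  refine ⟨⌊y⌋₊, ⌊y⌋₊ / Q, ?_, ?_, ?_⟩
  · rintro m (rfl | rfl)
    · exact ⟨hm2low.trans hm21, hm1⟩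
    · exact ⟨hm2low, hm21.trans hm1⟩
  · refine le_trans ?_ hm2
    have : (Q : ℝ) = 10 ^ 15 * (N : ℝ) ^ 3 := by rw [hQ]; push_cast; ring
    rw [this, ← hm₂]
    nlinarith [mul_nonneg hm20 (by positivity : (0 : ℝ) ≤ (N : ℝ) ^ 3)]
  · rw [← hm₂]
    have h3 : y / C ≤ m₂ / (10 ^ 14 * (N : ℝ) ^ 3) := by
      rw [div_le_div_iff₀ hCpos (by positivity), hC]
      nlinarith [mul_le_mul_of_nonneg_right hm24 (by positivity : (0 : ℝ) ≤ 10 ^ 14 * (N : ℝ) ^ 3)]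
    refine lt_of_lt_of_le ?_ (Real.rpow_le_rpow (by positivity) h3 (by positivity))
    rw [Real.div_rpow hy0.le hCpos.le, lt_div_iff₀ (by positivity), Real.rpow_add hy0, Real.rpow_one]
    have : 8 * y * C ^ (1 + 2 * ε) < y * y ^ (2 * ε) := by nlinarith
    refine lt_of_le_of_lt ?_ this
    gcongr

/-- If both sizes were comparable to a scale length, these two lengths would be distinct but closer
than the geometric condition allows. -/
theorem IsBallSystem.exists_size {N d : ℕ} {l : Fin d → ℝ} {ε X : ℝ}
    {c : Fin d → ℕ → Fin N → Space3} (h : IsBallSystem N l ε X c) (hX : 1 ≤ X) (hε : 0 < ε)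
    {m₁ m₂ D : ℝ} (hD : 0 < D) (hm₂ : 0 ≤ m₂) (h1 : 8 * m₂ * D ≤ m₁)
    (h2 : 8 * m₁ < (m₂ / D) ^ (1 + 2 * ε)) :
    (∀ i, D * l i ≤ m₁ ∨ 8 * m₁ < l i) ∨ ∀ i, D * l i ≤ m₂ ∨ 8 * m₂ < l i := by
  by_contra hcon
  push Not at hcon
  obtain ⟨⟨i, hi1, hi2⟩, j, hj1, hj2⟩ := hcon
  have hlt : l j < l i := by
    have : D * l j < D * l i := by nlinarith
    exact lt_of_mul_lt_mul_left this hD.le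
  have hji : j < i := by
    rcases lt_trichotomy j i with h' | h' | h'
    · exact h'
    · rw [h'] at hlt; exact absurd hlt (lt_irrefl _)
    · have h3 := h.geometric i j h'
      have h4 : l i ≤ l i ^ (1 + 2 * ε) :=
        Real.self_le_rpow_of_one_le (hX.trans (h.le i)) (by linarith)
      linarith
  have h3 := h.geometric j i hji
  have h4 : (m₂ / D) ^ (1 + 2 * ε) ≤ l j ^ (1 + 2 * ε) := by
    refine Real.rpow_le_rpow (by positivity) ?_ (by positivity)
    rw [div_le_iff₀ hD]
    linarith
  linarith

/-! ### Translation of the hypotheses and the main theorem -/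

theorem IsGeometricVector.rpow_le {d : ℕ} {ε : ℝ} {l : Fin d → ℝ} (h : IsGeometricVector ε l)
    (hε : 0 < ε) {i j : Fin d} (hij : i < j) : l i ^ (1 + 2 * ε) ≤ l j := by
  obtain ⟨i, hi⟩ := i
  obtain ⟨j, hj⟩ := j
  have hij' : i + 1 ≤ j := by simpa using hij
  clear hij
  induction j, hij' using Nat.le_induction with
  | base => exact h.2 _ _ rfl
  | succ j hj' ih =>
    refine (ih (by omega)).trans ?_
    refine le_trans ?_ (h.2 ⟨j, by omega⟩ ⟨j + 1, hj⟩ rfl)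
    exact Real.self_le_rpow_of_one_le (h.1 _).le (by linarith)

theorem IsGeometricVector.first_le {d : ℕ} {ε : ℝ} {l : Fin d → ℝ} (h : IsGeometricVector ε l)
    (hε : 0 < ε) (i : Fin d) (hd : 0 < d) : l ⟨0, hd⟩ ≤ l i := by
  rcases Nat.eq_zero_or_pos (i : ℕ) with h0 | h0
  · exact le_of_eq (congrArg l (Fin.ext h0.symm))
  · exact (Real.self_le_rpow_of_one_le (h.1 _).le (by linarith)).trans
      (h.rpow_le hε (i := ⟨0, hd⟩) (j := i) h0)

theorem IsScattered.exists_centres {N : ℕ} {l ε : ℝ} {Z : Set Space3} (h : IsScattered N l ε Z) :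
    ∃ c : ℕ → Fin N → Space3, Z = ⋃ j, ⋃ t, Metric.ball (c j t) l ∧
      ∀ t j j', j ≠ j' → l ^ (1 + ε) ≤ dist (c j t) (c j' t) := by
  obtain ⟨hl, c, hZ, hc⟩ := h
  exact ⟨c, hZ, fun t j j' hj => hc t j j' hj _ (Metric.mem_ball_self (by linarith)) _
    (Metric.mem_ball_self (by linarith))⟩

theorem diam_image_latticeCube_le (n : ℕ) :
    Metric.diam (latticePoint '' latticeCube 0 n) ≤ 4 * n := by
  refine Metric.diam_le_of_forall_dist_le (by positivity) ?_
  rintro _ ⟨a, ha, rfl⟩ _ ⟨b, hb, rfl⟩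
  refine (dist_latticePoint_le (C := 2 * n) fun k => ?_).trans (le_of_eq (by ring))
  have h1 := ha k
  have h2 := hb k
  simp only [Pi.zero_apply, sub_zero] at h1 h2
  push_cast
  refine (abs_sub _ _).trans ?_
  linarith

theorem mem_latticeCube_zero {n : ℕ} {a : Lattice3} :
    a ∈ latticeCube 0 n ↔ ∀ k, |a k| ≤ (n : ℤ) := by
  refine forall_congr' fun k => ?_
  simp only [Pi.zero_apply, sub_zero]
  exact_mod_cast Iff.rfl

theorem finite_latticeCube (n : ℕ) : (latticeCube 0 n).Finite := by
  refine (Set.finite_Icc (fun _ => -(n : ℤ) : Lattice3) (fun _ => n)).subset fun a ha => ?_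
  rw [mem_latticeCube_zero] at ha
  exact ⟨fun k => (abs_le.1 (ha k)).1, fun k => (abs_le.1 (ha k)).2⟩

theorem latticeLaplacian_eq (u : Lattice3 → ℝ) (a : Lattice3) :
    latticeLaplacian u a = -6 * u a + nbrSum u a := rfl

open scoped Classical in
/-- The main theorem for functions that do not vanish at the origin. -/
theorem exists_card_large_ge {ε : ℝ} (hε : 0 < ε) (hε' : 10 ^ 15 ≤ ε⁻¹) {N : ℕ} (hN : 0 < N) :
    ∃ CN : ℝ, 0 < CN ∧ ∀ (K : ℝ), 0 < K → ∀ n : ℕ, CN ^ 4 < (n : ℝ) → ∀ u : Lattice3 → ℝ, u 0 ≠ 0 →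
      (∀ a ∈ latticeCube 0 n, |nbrSum u a| ≤ (K + 6) * |u a|) →
      ∀ (d : ℕ) (l : Fin d → ℝ) (E E₀ : Set Space3) (Es : Fin d → Set Space3),
        IsGradedSet N l ε⁻¹ ε E E₀ Es → (∀ h : 0 < d, CN < l ⟨0, h⟩) →
        IsNormalIn l E₀ Es 1 ε (latticePoint '' latticeCube 0 n) →
        (n : ℝ) ^ (1.501 : ℝ) ≤ (({a | a ∈ latticeCube 0 n ∧ latticePoint a ∉ E ∧
          Real.exp (-(102 * Real.log (K + 11) + 101) * n) * |u 0| ≤ |u a|} :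
            Set Lattice3).ncard : ℝ) := by
  obtain ⟨B₁, hB₁⟩ : ∃ B₁ : ℕ, 4 < (1 + 2 * ε) ^ B₁ :=
    pow_unbounded_of_one_lt 4 (by linarith)
  obtain ⟨B₂, hB₂⟩ : ∃ B₂ : ℕ, 336000 * N ≤ 42 ^ B₂ :=
    ⟨336000 * N, (Nat.lt_pow_self (by norm_num)).le⟩
  have hcast := tendsto_natCast_atTop_atTop (R := ℝ)
  have hpow : ∀ {y : ℝ}, 0 < y → ∀ C : ℝ, ∀ᶠ n : ℕ in atTop, C ≤ (n : ℝ) ^ y := fun hy C =>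
    ((tendsto_rpow_atTop hy).comp hcast).eventually_ge_atTop C
  obtain ⟨X, hX1, hX2, hX3⟩ := ((eventually_ge_atTop (1 : ℝ)).and
    (((tendsto_rpow_atTop (y := 2 * ε ^ 2) (by positivity)).eventually_ge_atTop 2).and
      ((tendsto_rpow_atTop hε).eventually_ge_atTop (10 ^ 17 * (N : ℝ) ^ 3)))).exists
  obtain ⟨n₀, hn₀⟩ := eventually_atTop.1 ((eventually_exists_sizes hε hN).and
    ((hpow (y := 0.0005) (by norm_num) 50000).and
      ((hpow (y := 0.001) (by norm_num) (3 * 10 ^ 10 * 1344 ^ 2 * 44 ^ (B₁ * B₂))).and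
        ((hpow (y := 0.4985) (by norm_num) (10 ^ 15)).and
          ((hpow (y := ε / 2) (by positivity) (4 * (10 ^ 4 * N))).and (eventually_ge_atTop 1))))))
  -- One constant serves both purposes: `X` bounds the scale lengths from below, and `n₀` makes `n`
  -- large. Neither involves `K`, which enters only through the growth factors.
  refine ⟨max X (max n₀ 1), by positivity, ?_⟩
  intro K hK n hn u hu0 hu d l E E₀ Es hgr hfirst hnormal
  set CN := max X (max (n₀ : ℝ) 1) with hCN
  have hCN1 : 1 ≤ CN := (le_max_right _ _).trans (le_max_right _ _)
  have hCNn : (n₀ : ℝ) ≤ n := by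
    have h1 : (n₀ : ℝ) ≤ CN := (le_max_left _ _).trans (le_max_right _ _)
    have h2 : CN ≤ CN ^ 4 := le_self_pow₀ hCN1 (by norm_num)
    linarith
  obtain ⟨⟨m₁, m₂, hm, hm12, hm21⟩, hx1, hx2, hx3, hx4, hn1⟩ := hn₀ n (by exact_mod_cast hCNn)
  have hnR : (1 : ℝ) ≤ n := by exact_mod_cast hn1
  obtain ⟨z, hz, hzsep⟩ := hgr.unitscattered
  choose c hc hcsep using fun i => (hgr.scattered i).exists_centres
  have hsys : IsBallSystem N l ε X c :=
    { le := fun i => by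
        have h1 := hgr.geometric.first_le hε i (Fin.pos i)
        have h2 := hfirst (Fin.pos i)
        have h3 : X ≤ CN := le_max_left _ _
        linarith
      geometric := fun i j hij => hgr.geometric.rpow_le hε hij
      separated := hcsep }
  have hzsep' : ∀ j j', j ≠ j' → ε⁻¹ ≤ dist (latticePoint (z j)) (latticePoint (z j')) :=
    fun j j' hj => hzsep j j' hj _ (Metric.mem_ball_self one_pos) _ (Metric.mem_ball_self one_pos)
  obtain ⟨m, hmm, hml⟩ : ∃ m : ℕ, (m = m₁ ∨ m = m₂) ∧
      ∀ i, 10 ^ 14 * (N : ℝ) ^ 3 * l i ≤ m ∨ 8 * m < l i := by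
    rcases hsys.exists_size hX1 hε (by positivity) (Nat.cast_nonneg m₂) hm12 hm21 with h | h
    · exact ⟨m₁, Or.inl rfl, h⟩
    · exact ⟨m₂, Or.inr rfl, h⟩
  obtain ⟨hmlow, hmup⟩ := hm m hmm
  have hm15 : 10 ^ 15 ≤ m := by exact_mod_cast hx3.trans hmlow
  obtain ⟨k, hk, hcount⟩ := rpow_le_tree_count hnR hmlow hmup hx1 hx2
  -- Only pieces that meet the cube matter, and for these normality gives `l i ≤ (4 n) ^ (1 - ε /
  -- 2)`, which is far below `n / N` for large `n`.
  set I : Finset (Fin d) := {i | (Es i ∩ latticePoint '' latticeCube 0 n).Nonempty} with hI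
  set S : Set Lattice3 := {a | a ∈ latticeCube 0 n ∧ latticePoint a ∉ E ∧
    Real.exp (-(102 * Real.log (K + 11) + 101) * n) * |u 0| ≤ |u a|} with hS
  have hSfin : S.Finite := (finite_latticeCube n).subset fun a ha => ha.1
  have hlog : 0 ≤ Real.log (K + 11) := Real.log_nonneg (by linarith)
  have hmR : (1 : ℝ) ≤ m := by
    have : 1 ≤ m := by omega
    exact_mod_cast this
  have key := card_large_ge_of_tree (I := I) (m := m) (k := k) (u := u) (κ := K + 6)
    (W := 50 * m * (K + 11)) (θ := Real.exp (-(102 * Real.log (K + 11) + 101) * n) * |u 0|)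
    (E := {a | latticePoint a ∈ E}) (A := hSfin.toFinset) hsys hX1 hε hX2 hN hX3 hε' hzsep' hm15
    (by
      have : (n : ℝ) ^ (1 / 4 : ℝ) ≤ (n : ℝ) ^ (0.4985 : ℝ) :=
        Real.rpow_le_rpow_of_exponent_le hnR (by norm_num)
      linarith) hk
    (fun i hi => by
      have h1 := hnormal.2 i (mem_filter.1 hi).2
      have h2 : Metric.diam (latticePoint '' latticeCube 0 n) ^ (1 - ε / 2) ≤
          (4 * n : ℝ) ^ (1 - ε / 2) := by
        refine Real.rpow_le_rpow Metric.diam_nonneg (diam_image_latticeCube_le n) ?_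
        have : ε ≤ 1 := by
          have h3 : (1 : ℝ) ≤ ε⁻¹ := by linarith
          exact (one_le_inv₀ hε).1 h3
        linarith
      have h3 : (4 * n : ℝ) ^ (1 - ε / 2) * (n : ℝ) ^ (ε / 2) ≤ 4 * n := by
        calc (4 * n : ℝ) ^ (1 - ε / 2) * (n : ℝ) ^ (ε / 2)
            ≤ (4 * n : ℝ) ^ (1 - ε / 2) * (4 * n : ℝ) ^ (ε / 2) := by
              gcongr
              linarith
          _ = 4 * n := by
              rw [← Real.rpow_add (by positivity)]
              norm_num
      have h4 : (4 * n : ℝ) ^ (1 - ε / 2) * (4 * (10 ^ 4 * N)) ≤ 4 * n :=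
        le_trans (by gcongr) h3
      have h5 : l i * (4 * (10 ^ 4 * N)) ≤ 4 * n := le_trans (by
        have := h1.trans h2
        gcongr) h4
      linarith)
    (fun i _ => hml i) hB₁ hB₂ (by linarith) (by nlinarith)
    (by nlinarith) (by positivity)
    (fun b hb => hu b (mem_latticeCube_zero.2 hb))
    (by
      have hg := growth_lt_exp (x := n) (Y := K + 11) (n := n) (m := m) rfl hnR (by linarith)
        (by omega) hmup hx1
      have hu0' : 0 < |u 0| := abs_pos.2 hu0
      have e : K + 6 + 5 = K + 11 := by ring
      rw [e, ← mul_assoc]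
      refine mul_lt_of_lt_one_left hu0' ?_
      calc _ < Real.exp ((102 * Real.log (K + 11) + 101) * n) *
            Real.exp (-(102 * Real.log (K + 11) + 101) * n) := by
            gcongr
        _ = 1 := by rw [← Real.exp_add, neg_mul, add_neg_cancel, Real.exp_zero])
    (fun a ha haE => by
      have haE' : latticePoint a ∈ E := haE
      rw [hgr.eq_union] at haE'
      rcases haE' with h | h
      · rw [hz, Set.mem_iUnion] at h
        exact Or.inl h
      · obtain ⟨i, hi⟩ := Set.mem_iUnion.1 h
        refine Or.inr ⟨i, mem_filter.2 ⟨mem_univ _, latticePoint a, hi, a,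
          mem_latticeCube_zero.2 ha, rfl⟩, ?_⟩
        rw [hc i] at hi
        obtain ⟨j, hj⟩ := Set.mem_iUnion.1 hi
        obtain ⟨t, ht⟩ := Set.mem_iUnion.1 hj
        exact ⟨j, t, ht⟩)
    (fun a ha haE hθ => hSfin.mem_toFinset.2 ⟨mem_latticeCube_zero.2 ha, haE, hθ⟩)
  rw [Set.ncard_eq_toFinset_card S hSfin]
  have key' : (44 : ℝ) ^ (k - B₁ * B₂) * (m : ℝ) ^ 2 ≤
      10 ^ 10 * (Nat.log 2 (5 * m) + 1) * (#hSfin.toFinset : ℝ) := by exact_mod_cast key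
  have hpos : (0 : ℝ) < 10 ^ 10 * (Nat.log 2 (5 * m) + 1) := by positivity
  refine le_of_mul_le_mul_left ?_ hpos
  rw [mul_comm]
  exact hcount.trans key'

theorem theorem3p3 :
    ∃ p : ℝ, 3 / 2 < p ∧ ∃ ε₀ : ℝ, 0 < ε₀ ∧ ∀ ε : ℝ, 0 < ε → ε < ε₀ →
      -- `CK K` and `CN N` are the constants `C_{ε,K}` and `C_{ε,N}`
      ∃ (CK : ℝ → ℝ) (CN : ℕ → ℝ), (∀ K, 0 < K → 0 < CK K) ∧ (∀ N, 0 < N → 0 < CN N) ∧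
        ∀ (N : ℕ) (K : ℝ), 0 < N → 0 < K →
        ∀ n : ℕ, 0 < n → CN N ^ 4 < (n : ℝ) →
        ∀ u V : Lattice3 → ℝ,
          (∀ a ∈ latticeCube 0 n, latticeLaplacian u a = V a * u a) →
          (∀ a ∈ latticeCube 0 n, |V a| ≤ K) →
        ∀ (d : ℕ) (l : Fin d → ℝ) (E E₀ : Set Space3) (Es : Fin d → Set Space3),
          IsGradedSet N l ε⁻¹ ε E E₀ Es →
          (∀ h : 0 < d, CN N < l ⟨0, h⟩) →
          IsNormalIn l E₀ Es 1 ε (latticePoint '' latticeCube 0 n) →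
          (n : ℝ) ^ p ≤
            (({a | a ∈ latticeCube 0 n ∧ latticePoint a ∉ E ∧
              Real.exp (-CK K * n) * |u 0| ≤ |u a|} : Set Lattice3).ncard : ℝ) := by
  refine ⟨1.501, by norm_num, 1 / 10 ^ 15, by norm_num, fun ε hε hε₀ => ?_⟩
  have hε' : (10 : ℝ) ^ 15 ≤ ε⁻¹ := by
    rw [le_inv_comm₀ (by norm_num) hε, ← one_div]
    exact hε₀.le
  have hex : ∀ N : ℕ, ∃ CN : ℝ, 0 < N → _ := fun N => by
    by_cases hN : 0 < N
    · obtain ⟨CN, h⟩ := exists_card_large_ge hε hε' hN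
      exact ⟨CN, fun _ => h⟩
    · exact ⟨0, fun h => absurd h hN⟩
  choose CN hCN using hex
  refine ⟨fun K => 102 * Real.log (K + 11) + 101, CN, fun K hK => ?_, fun N hN => (hCN N hN).1, ?_⟩
  · have : 0 ≤ Real.log (K + 11) := Real.log_nonneg (by linarith)
    positivity
  intro N K hN hK n _ hn u V hu hV d l E E₀ Es hgr hfirst hnormal
  -- If `u 0 = 0` the threshold is zero and all points of the cube outside `E` count. Their number
  -- is bounded below by applying the estimate to the constant function `1`, whose neighbour sum is
  -- `6 ≤ K + 6`.
  by_cases hu0 : u 0 = 0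
  · have h1 := (hCN N hN).2 K hK n hn (fun _ => 1) one_ne_zero (fun a _ => by
      have : nbrSum (fun _ => 1) a = 6 := by simp [nbrSum]; norm_num
      rw [this]
      norm_num
      exact hK.le) d l E E₀ Es hgr hfirst hnormal
    refine h1.trans ?_
    have hfin : {a | a ∈ latticeCube 0 n ∧ latticePoint a ∉ E ∧
        Real.exp (-(102 * Real.log (K + 11) + 101) * n) * |u 0| ≤ |u a|}.Finite :=
      (finite_latticeCube n).subset fun a ha => ha.1
    refine Nat.cast_le.2 (Set.ncard_le_ncard (fun a ha => ⟨ha.1, ha.2.1, ?_⟩) hfin)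
    rw [hu0, abs_zero, mul_zero]
    exact abs_nonneg _
  · refine (hCN N hN).2 K hK n hn u hu0 (fun a ha => ?_) d l E E₀ Es hgr hfirst hnormal
    have h1 := hu a ha
    rw [latticeLaplacian_eq] at h1
    have h2 : nbrSum u a = (V a + 6) * u a := by linarith
    rw [h2, abs_mul]
    refine mul_le_mul_of_nonneg_right ((abs_add_le _ _).trans ?_) (abs_nonneg _)
    rw [abs_of_pos (by norm_num : (0 : ℝ) < 6)]
    linarith [hV a ha]
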